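/- Let $G$ be a finite group. A continuous map $f\colon X\to Y$ of (left) $G$-spaces is \emph{isovariant} if $f(gx)=gf(x)$ and $G_{f(x)}=G_x$ for all $g\in G$, $x\in X$, where $G_x$ is the isotropy group of $x$. Let $\mathsf{isvt\text{-}Top}$ be the category of $G$-spaces and isovariant maps, let $\mathsf{Map_{isvt}}(X,Y)$ be the set of isovariant maps with the subspace topology of the compact-open topology, and let $\mathsf{isvt\text{-}Top}_+$ be the category obtained from $\mathsf{isvt\text{-}Top}$ by adjoining a formal terminal object $\ast$ (with no morphisms from $\ast$ to a $G$-space), with $\mathsf{Map_{isvt}}(X,\ast)$ a one-point space. For a strictly increasing chain of subgroups $\mathbf H=(H_0<\dots<H_m)$ of $G$, $m\ge 0$ (that is, an object of the link orbit category $\mathcal L_G$), let $\Delta^{\mathbf H}_G=(G\times\Delta^m)/\!\sim$, where $(g,x)\sim(g',x)$ if for some $0\le k\le m$ one has $x=(t_0,\dots,t_{m-k},0,\dots,0)$ and $gH_k=g'H_k$, with $G$-action $g'\cdot[g,x]=[g'g,x]$. For a space $A$, $G$ acts on $\Delta^{\mathbf H}_G\times A$ through the first factor. Then for every chain $\mathbf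 H$ the functor $\Delta^{\mathbf H}_G\times-\colon\mathsf{Top}\to\mathsf{isvt\text{-}Top}_+$ is left adjoint to $\mathsf{Map_{isvt}}(\Delta^{\mathbf H}_G,-)$, and $\mathsf{isvt\text{-}Top}_+$ is a cofibrantly generated model category (with all small limits and colimits and with functorial factorizations) in which: (1) the set of generating cofibrations is $\{\Delta^{\mathbf H}_G\times S^{n-1}\to\Delta^{\mathbf H}_G\times D^n\}$ and the set of generating acyclic cofibrations is $\{\Delta^{\mathbf H}_G\times D^n\times\{0\}\to\Delta^{\mathbf H}_G\times D^n\times[0,1]\}$, where $\mathbf H$ runs over all chains and $n\ge 0$. That is, the domains of these maps are small relative to the respective relative cell complexes, the acyclic fibrations are the maps with the right lifting property against the first set, and the fibrations are those with the right lifting property against the second; (2) a map $f$ is a weak equivalence (resp. a fibration) if and only if $\mathsf{Map_{isvt}}(\Delta^{\mathbf H}_G,f)$ is a weak homotopy equivalence (resp. a Serre fibration) of spaces for every chain $\mathbf H$. -/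

import Mathlib

universe v u

open CategoryTheory Limits HomotopicalAlgebra

section WeakEquivalencesOfSpaces

open scoped Topology Topology.Homotopy unitInterval

/-- The map induced by `f` on path components. -/
def zerothHomotopyMap {X Y : Type u} [TopologicalSpace X] [TopologicalSpace Y] (f : C(X, Y)) :
    ZerothHomotopy X → ZerothHomotopy Y :=
  Quotient.map f (fun _ _ h ↦ h.map (map_continuous f))

/-- The map induced by `f` on the homotopy groups `π_n(-, x)`. -/
def homotopyGroupMap {X Y : Type u} [TopologicalSpace X] [TopologicalSpace Y] (f : C(X, Y))
    (n : ℕ) (x : X) : π_ n X x → π_ n Y (f x) :=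
  Quotient.map
    (fun γ : GenLoop (Fin n) X x ↦
      (⟨f.comp γ.1, fun y hy ↦ congrArg f (γ.2 y hy)⟩ : GenLoop (Fin n) Y (f x)))
    (fun _ _ h ↦ ContinuousMap.HomotopicRel.comp_continuousMap h f)

/-- Weak homotopy equivalences of topological spaces: maps inducing a bijection on path components
and on all homotopy groups, at all base points. -/
def weakHomotopyEquivalences : MorphismProperty TopCat.{u} := fun X _ f ↦
  Function.Bijective (zerothHomotopyMap f.hom) ∧
    ∀ (n : ℕ) (x : X), Function.Bijective (homotopyGroupMap f.hom (n + 1) x)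

/-- The inclusion `D^n × {0} ⟶ D^n × [0,1]`. -/
noncomputable def diskCylinderInclusion (n : ℕ) :
    TopCat.of (TopCat.disk.{u} n × ({0} : Set I)) ⟶ TopCat.of (TopCat.disk.{u} n × I) :=
  TopCat.ofHom ⟨fun p ↦ (p.1, p.2.1), by fun_prop⟩

/-- Serre fibrations: the maps with the right lifting property with respect to all the inclusions
`D^n × {0} ⟶ D^n × [0,1]`. -/
def serreFibrations : MorphismProperty TopCat.{u} :=
  (MorphismProperty.ofHoms (fun n : ℕ ↦ diskCylinderInclusion.{u} n)).rlp

end WeakEquivalencesOfSpaces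

/-- A `G`-space, for a (discrete) group `G`: a topological space with a continuous left action. -/
structure IsvtTop (G : Type u) [Group G] : Type (u + 1) where
  carrier : Type u
  [top : TopologicalSpace carrier]
  [act : MulAction G carrier]
  [cont : ContinuousConstSMul G carrier]

namespace IsvtTop

attribute [instance] top act cont

variable {G : Type u} [Group G]

/-- A continuous map of `G`-spaces is isovariant if it is equivariant and preserves isotropy
groups. -/
def IsIsovariant {X Y : IsvtTop G} (f : C(X.carrier, Y.carrier)) : Prop :=
  (∀ (g : G) (x : X.carrier), f (g • x) = g • f x) ∧
    ∀ x : X.carrier, MulAction.stabilizer G (f x) = MulAction.stabilizer G x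

/-- The category of `G`-spaces and isovariant maps. -/
instance : Category.{u} (IsvtTop G) where
  Hom X Y := {f : C(X.carrier, Y.carrier) // IsIsovariant f}
  id X := ⟨ContinuousMap.id _, fun _ _ ↦ rfl, fun _ ↦ rfl⟩
  comp f g := ⟨g.1.comp f.1, fun a x ↦ by simp [f.2.1, g.2.1],
    fun x ↦ (g.2.2 (f.1 x)).trans (f.2.2 x)⟩

/-- The functor `Map_isvt(X, -)`: the set of isovariant maps `X → Y` is topologized as a subspace
of the space of continuous maps with the compact-open topology. -/
def mapIsvt (X : IsvtTop G) : IsvtTop G ⥤ TopCat.{u} where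
  obj Y := TopCat.of {f : C(X.carrier, Y.carrier) // IsIsovariant f}
  map {Y Z} φ := TopCat.ofHom
    { toFun := fun f ↦ ⟨φ.1.comp f.1, fun a x ↦ by simp [f.2.1, φ.2.1],
        fun x ↦ (φ.2.2 (f.1 x)).trans (f.2.2 x)⟩
      continuous_toFun :=
        ((ContinuousMap.continuous_postcomp φ.1).comp continuous_subtype_val).subtype_mk _ }

/-- The `G`-space `X × A`, where `G` acts on the factor `X` only. -/
def prodTop (X : IsvtTop G) (A : TopCat.{u}) : IsvtTop G :=
  letI : MulAction G (X.carrier × A) :=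
    { smul := fun g p ↦ (g • p.1, p.2)
      one_smul := fun p ↦ Prod.ext (one_smul G p.1) rfl
      mul_smul := fun g h p ↦ Prod.ext (mul_smul g h p.1) rfl }
  haveI : ContinuousConstSMul G (X.carrier × A) :=
    ⟨fun g ↦ Continuous.prodMk ((continuous_const_smul g).comp continuous_fst) continuous_snd⟩
  { carrier := X.carrier × A }

/-- The functor `X × -` from spaces to `G`-spaces and isovariant maps. -/
def prodFunctor (X : IsvtTop G) : TopCat.{u} ⥤ IsvtTop G where
  obj A := X.prodTop A
  map {A B} f := ⟨⟨fun p : X.carrier × A ↦ ((p.1, f p.2) : X.carrier × B),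
      continuous_fst.prodMk ((map_continuous f.hom).comp continuous_snd)⟩,
    fun _ _ ↦ rfl, fun p ↦ by
      ext g
      exact ⟨fun h ↦ Prod.ext (congrArg Prod.fst h :) rfl,
        fun h ↦ Prod.ext (congrArg Prod.fst h :) rfl⟩⟩

section LinkingSimplex

/-- For a chain `H_0 < ⋯ < H_n` of subgroups of `G`, the equivalence relation on `G × Δ^n` with
`(g, x) ∼ (g', x)` if, for some `0 ≤ k ≤ n`, `x = (t_0, …, t_{n-k}, 0, …, 0)` and
`g H_k = g' H_k`. -/
def linkSetoid (H : LTSeries (Subgroup G)) : Setoid (G × stdSimplex ℝ (Fin (H.length + 1))) where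
  r p q := p.2 = q.2 ∧ ∃ k : Fin (H.length + 1),
    (∀ i : Fin (H.length + 1), H.length < (i : ℕ) + k → p.2.1 i = 0) ∧
      (p.1 : G ⧸ H k) = (q.1 : G ⧸ H k)
  iseqv :=
    { refl := fun p ↦ ⟨rfl, 0, fun i hi ↦ absurd i.2 (by simp at hi; omega), rfl⟩
      symm := by
        rintro ⟨g, x⟩ ⟨g', x'⟩ ⟨rfl, k, hk, h⟩
        exact ⟨rfl, k, hk, h.symm⟩
      trans := by
        rintro ⟨g, x⟩ ⟨g', x'⟩ ⟨g'', x''⟩ ⟨rfl, k, hk, h⟩ ⟨rfl, l, hl, h'⟩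
        refine ⟨rfl, ?_⟩
        simp only [QuotientGroup.eq] at h h' ⊢
        rcases le_total k l with hkl | hkl
        · exact ⟨l, hl, by simpa [mul_assoc] using mul_mem (H.monotone hkl h) h'⟩
        · exact ⟨k, hk, by simpa [mul_assoc] using mul_mem h (H.monotone hkl h')⟩ }

/-- The underlying space of the linking simplex: the quotient of `G × Δ^n`, `G` being discrete. -/
def LinkingSimplex (H : LTSeries (Subgroup G)) : Type u :=
  Quotient (linkSetoid H)

instance (H : LTSeries (Subgroup G)) : TopologicalSpace (LinkingSimplex H) :=
  letI : TopologicalSpace G := ⊥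
  inferInstanceAs (TopologicalSpace (Quotient (linkSetoid H)))

/-- The left action `g' • [g, x] = [g' g, x]`. -/
instance (H : LTSeries (Subgroup G)) : MulAction G (LinkingSimplex H) where
  smul a := Quotient.map (fun p ↦ (a * p.1, p.2)) (by
    rintro ⟨g, x⟩ ⟨g', x'⟩ ⟨h, k, hk, h'⟩
    refine ⟨h, k, hk, ?_⟩
    simp only [QuotientGroup.eq] at h' ⊢
    simpa [mul_assoc] using h')
  one_smul := by
    rintro ⟨g, x⟩
    exact congrArg (Quotient.mk (linkSetoid H)) (Prod.ext (one_mul g) rfl)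
  mul_smul := by
    rintro a b ⟨g, x⟩
    exact congrArg (Quotient.mk (linkSetoid H)) (Prod.ext (mul_assoc a b g) rfl)

instance (H : LTSeries (Subgroup G)) : ContinuousConstSMul G (LinkingSimplex H) where
  continuous_const_smul a := by
    let _ : TopologicalSpace G := ⊥
    have : DiscreteTopology G := ⟨rfl⟩
    refine continuous_quot_lift _ (continuous_quot_mk.comp ?_)
    exact ((continuous_of_discreteTopology (f := fun g : G ↦ a * g)).comp continuous_fst).prodMk
      continuous_snd

/-- The linking simplex `Δ^H_G` as a `G`-space. -/
def linkingSimplex (H : LTSeries (Subgroup G)) : IsvtTop G where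
  carrier := LinkingSimplex H

end LinkingSimplex

variable (G) in
/-- The category of `G`-spaces and isovariant maps, completed by a formal terminal object. -/
abbrev Completed : Type (u + 1) :=
  WithTerminal (IsvtTop G)

/-- The functor `Δ^H_G × -` from spaces to the completed category. -/
def linkProd (H : LTSeries (Subgroup G)) : TopCat.{u} ⥤ Completed G :=
  (linkingSimplex H).prodFunctor ⋙ WithTerminal.incl

/-- The functor `Map_isvt(Δ^H_G, -)` on the completed category; it sends the formal terminal object
to the one-point space. -/
def linkMap (H : LTSeries (Subgroup G)) : Completed G ⥤ TopCat.{u} :=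
  WithTerminal.liftToTerminal (linkingSimplex H).mapIsvt TopCat.isTerminalPUnit

variable (G) in
/-- The maps `Δ^H_G × S^{n-1} ⟶ Δ^H_G × D^n`, for all chains `H` of subgroups of `G` and all
`n`. -/
def generatingCofibrations : MorphismProperty (Completed G) :=
  MorphismProperty.ofHoms (fun p : LTSeries (Subgroup G) × ℕ ↦
    (linkProd p.1).map (TopCat.diskBoundaryInclusion.{u} p.2))

variable (G) in
/-- The maps `Δ^H_G × D^n × {0} ⟶ Δ^H_G × D^n × [0,1]`, for all chains `H` of subgroups of `G` and
all `n`. -/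
def generatingAcyclicCofibrations : MorphismProperty (Completed G) :=
  MorphismProperty.ofHoms (fun p : LTSeries (Subgroup G) × ℕ ↦
    (linkProd p.1).map (diskCylinderInclusion.{u} p.2))

end IsvtTop

section CofibrantlyGenerated

variable {C : Type v} [Category.{u} C]

/-- `A` is small relative to a class `D` of morphisms if, for some regular cardinal `κ`,
`Hom(A, -)` commutes with the colimits of all sequences of morphisms of `D` indexed by a
`κ`-filtered limit ordinal. -/
def IsSmallRelativeTo (A : C) (D : MorphismProperty C) : Prop :=
  ∃ (κ : Cardinal.{u}) (_ : Fact κ.IsRegular),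
    ∀ (J : Type u) [LinearOrder J] [SuccOrder J] [OrderBot J] [WellFoundedLT J] [NoMaxOrder J]
      [IsCardinalFiltered J κ] (F : J ⥤ C) [F.IsWellOrderContinuous],
      (∀ j : J, D (F.map (homOfLE (Order.le_succ j)))) →
        PreservesColimit F (coyoneda.obj (Opposite.op A))

/-- The relative `I`-cell complexes: transfinite compositions of pushouts of elements of `I`. -/
def relativeCells (I : MorphismProperty C) : MorphismProperty C :=
  MorphismProperty.transfiniteCompositions.{u} I.pushouts

/-- A model structure (with `u`-small limits and colimits and functorial factorizations) is
cofibrantly generated, with generating cofibrations `I` and generating acyclic cofibrations `J`, if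
`I` and `J` are sets of morphisms, the domains of `I` (resp. `J`) are small relative to the relative
`I`-cell (resp. `J`-cell) complexes, the trivial fibrations are the maps with the right lifting
property with respect to `I`, and the fibrations are those with the right lifting property with
respect to `J`. -/
structure IsCofibrantlyGeneratedBy [ModelCategory C] (I J : MorphismProperty C) : Prop where
  hasLimits : HasLimits C
  hasColimits : HasColimits C
  factorization_cof : (cofibrations C).HasFunctorialFactorization (trivialFibrations C)
  factorization_fib : (trivialCofibrations C).HasFunctorialFactorization (fibrations C)
  isSmall_I : MorphismProperty.IsSmall.{u} I
  isSmall_J : MorphismProperty.IsSmall.{u} J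
  domains_I {A B : C} (i : A ⟶ B) (hi : I i) : IsSmallRelativeTo A (relativeCells I)
  domains_J {A B : C} (j : A ⟶ B) (hj : J j) : IsSmallRelativeTo A (relativeCells J)
  trivialFibrations_eq : trivialFibrations C = I.rlp
  fibrations_eq : fibrations C = J.rlp

end CofibrantlyGenerated

/-! The structure is transported from spaces through the functors `linkMap H`. As `linkProd H` is
left adjoint to `linkMap H`, lifting a map against the generators attached to `H` means lifting its
image under `linkMap H` against the corresponding inclusions of disks. The classical theorem
`rlp_diskBoundaryInclusion_iff`, proved below for spaces, then identifies the right lifting class of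
the generating cofibrations with the fibrations that are weak equivalences. The adjunction rests on
`isExponentiable_linkingSimplex`: for finite `G` a linking simplex is the quotient of a compact
Hausdorff space by a closed relation, so evaluation on it is continuous.

The other main point is `weakHomotopyEquivalences_linkMap_of_llp_rlp`: maps with the left lifting
property against all fibrations are weak equivalences. Every object is fibrant, and each `G`-space
has a path object, made of the paths of constant isotropy, whose map to the pairs of points with
equal isotropy is a fibration. Lifting against these two kinds of fibrations exhibits the given map
as the inclusion of a strong deformation retract, which every `linkMap H` respects. The small object
argument and the retract argument then give the model structure.

Smallness is handled by the family `embeddingTests`: a map to a `G`-space has the left lifting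
property against it exactly when it is an embedding. A left lifting class is closed under all cell
attachments, so cell complexes consist of embeddings, and a map to the colimit of a long enough
chain of embeddings factors through some stage.

A limit consists of the compatible families with common isotropy. A colimit is the usual one unless
isotropy would grow, in which case it is the formal terminal object. -/

set_option linter.unusedSectionVars false

/-! ### Relative lifting properties for balls, cylinders and their boundaries. -/

section CellPairs

open Metric Set Topology unitInterval

/-- `f` has the relative lifting property with respect to the pair `(P, S)`: a lift along `f` of a
map defined on `P` which is prescribed on the subset `S` extends to `P`. -/
def LiftsPair {P X Y : Type*} [TopologicalSpace P] [TopologicalSpace X] [TopologicalSpace Y]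
    (S : Set P) (f : C(X, Y)) : Prop :=
  ∀ (b : C(P, Y)) (a : P → X), ContinuousOn a S → (∀ p ∈ S, f (a p) = b p) →
    ∃ c : C(P, X), (∀ p, f (c p) = b p) ∧ EqOn c a S

section

variable {P P' X Y : Type*} [TopologicalSpace P] [TopologicalSpace P'] [TopologicalSpace X]
  [TopologicalSpace Y] {f : C(X, Y)}

/-- Relative lifting properties descend to retracts of pairs. -/
lemma LiftsPair.of_retract {S : Set P} {S' : Set P'} (h : LiftsPair S' f) (i : C(P, P'))
    (r : C(P', P)) (hri : ∀ p, r (i p) = p) (hi : MapsTo i S S') (hr : MapsTo r S' S) :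
    LiftsPair S f := by
  intro b a ha hab
  obtain ⟨c, hc, hc'⟩ := h (b.comp r) (a ∘ r) (ha.comp r.continuous.continuousOn hr)
    (fun p hp ↦ hab _ (hr hp))
  refine ⟨c.comp i, fun p ↦ by simp [hc, hri], fun p hp ↦ ?_⟩
  simp [hc' (hi hp), hri]

lemma LiftsPair.of_homeomorph {S : Set P} {S' : Set P'} (h : LiftsPair S' f) (e : P ≃ₜ P')
    (he : ∀ p, p ∈ S ↔ e p ∈ S') : LiftsPair S f :=
  h.of_retract (e : C(P, P')) (e.symm : C(P', P)) (by simp) (fun _ hp ↦ (he _).1 hp)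
    (fun p hp ↦ (he _).2 (by simpa using hp))

end

section Ball

variable (E : Type*) [NormedAddCommGroup E] [NormedSpace ℝ E]

/-- The closed unit ball of a normed space. -/
abbrev UnitBall : Type _ := closedBall (0 : E) 1

/-- The boundary sphere of the unit ball, as a subset of the unit ball. -/
def ballBoundary : Set (UnitBall E) := {q | ‖(q : E)‖ = 1}

/-- The subset `B × {0} ∪ S × I` of the cylinder `B × I` on the unit ball `B`, with boundary
sphere `S`. -/
def cylinderBox : Set (UnitBall E × I) := {p | p.2 = 0 ∨ ‖(p.1 : E)‖ = 1}

/-- The boundary `B × {0, 1} ∪ S × I` of the cylinder on the unit ball. -/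
def cylinderBoundary : Set (UnitBall E × I) := {p | p.2 = 0 ∨ p.2 = 1 ∨ ‖(p.1 : E)‖ = 1}

/-- The subset `B × {1} ∪ S × I` of the cylinder on the unit ball. -/
def cylinderLid : Set (UnitBall E × I) := {p | p.2 = 1 ∨ ‖(p.1 : E)‖ = 1}

variable {E}

lemma norm_unitBall_le (q : UnitBall E) : ‖(q : E)‖ ≤ 1 := mem_closedBall_zero_iff.1 q.2

lemma isClosed_ballBoundary : IsClosed (ballBoundary E) :=
  isClosed_eq (by fun_prop) continuous_const

lemma isClosed_cylinderBox : IsClosed (cylinderBox E) :=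
  (isClosed_eq continuous_snd continuous_const).union
    (isClosed_eq (by fun_prop) continuous_const)

lemma isClosed_cylinderBoundary : IsClosed (cylinderBoundary E) :=
  (isClosed_eq continuous_snd continuous_const).union
    ((isClosed_eq continuous_snd continuous_const).union
      (isClosed_eq (by fun_prop) continuous_const))

section Retraction

/-- The scaling factor of the projection of the cylinder from the point `(0, 2)`. -/
noncomputable def boxScale (p : UnitBall E × I) : ℝ := max ‖(p.1 : E)‖ ((2 - p.2) / 2)

lemma boxScale_pos (p : UnitBall E × I) : 0 < boxScale p :=
  lt_of_lt_of_le (by have := p.2.2.2; linarith) (le_max_right _ _)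

lemma boxScale_le_one (p : UnitBall E × I) : boxScale p ≤ 1 :=
  max_le (norm_unitBall_le _) (by have := p.2.2.1; linarith)

lemma continuous_boxScale : Continuous (boxScale : UnitBall E × I → ℝ) := by
  unfold boxScale; fun_prop

/-- The retraction of `B × I` onto `B × {0} ∪ S × I` by projection from the point `(0, 2)`. -/
noncomputable def boxRetraction : C(UnitBall E × I, UnitBall E × I) where
  toFun p := (⟨(boxScale p)⁻¹ • (p.1 : E), by
      have h := boxScale_pos p
      rw [mem_closedBall_zero_iff, norm_smul, norm_inv, Real.norm_of_nonneg h.le,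
        inv_mul_le_one₀ h]
      exact le_max_left _ _⟩,
    ⟨2 - (2 - p.2) * (boxScale p)⁻¹, by
      have h := boxScale_pos p
      have h1 := boxScale_le_one p
      have h2 : (2 - (p.2 : ℝ)) / 2 ≤ boxScale p := le_max_right _ _
      have h3 := p.2.2.2
      have h4 := p.2.2.1
      rw [← div_eq_mul_inv]
      constructor
      · have : (2 - (p.2 : ℝ)) / boxScale p ≤ 2 := by rw [div_le_iff₀ h]; linarith
        linarith
      · have : 1 ≤ (2 - (p.2 : ℝ)) / boxScale p := by rw [le_div_iff₀ h]; linarith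
        linarith⟩)
  continuous_toFun := by
    have h : Continuous fun p : UnitBall E × I ↦ (boxScale p)⁻¹ :=
      continuous_boxScale.inv₀ (fun p ↦ (boxScale_pos p).ne')
    fun_prop

/-- The larger of the two terms in `boxScale` decides whether the ray from `(0, 2)` meets the side
or the bottom. -/
lemma boxRetraction_mem (p : UnitBall E × I) : boxRetraction p ∈ cylinderBox E := by
  have h := boxScale_pos p
  rcases le_total ((2 - (p.2 : ℝ)) / 2) ‖(p.1 : E)‖ with h1 | h1
  · right
    have h2 : boxScale p = ‖(p.1 : E)‖ := max_eq_left h1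
    simp only [boxRetraction, ContinuousMap.coe_mk, norm_smul, norm_inv, h2, norm_norm]
    exact inv_mul_cancel₀ (by rw [← h2]; exact h.ne')
  · left
    have h2 : boxScale p = (2 - p.2) / 2 := max_eq_right h1
    have h3 : (2 - (p.2 : ℝ)) ≠ 0 := by have := p.2.2.2; intro h; linarith
    ext
    simp only [boxRetraction, ContinuousMap.coe_mk, h2, Icc.coe_zero]
    field_simp
    ring

lemma boxRetraction_eq (p : UnitBall E × I) (hp : p ∈ cylinderBox E) : boxRetraction p = p := by
  have h1 : boxScale p = 1 := by
    rcases hp with hp | hp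
    · rw [boxScale, hp]; simpa using norm_unitBall_le p.1
    · rw [boxScale, hp]; have := p.2.2.1; exact max_eq_left (by linarith)
  ext <;> simp [boxRetraction, h1]

end Retraction

/-- The homotopy extension property of the pair `(B, S)`. -/
lemma exists_extension_box {X : Type*} [TopologicalSpace X] (a : UnitBall E × I → X)
    (ha : ContinuousOn a (cylinderBox E)) :
    ∃ c : C(UnitBall E × I, X), EqOn c a (cylinderBox E) :=
  ⟨⟨a ∘ boxRetraction, ha.comp_continuous boxRetraction.continuous boxRetraction_mem⟩,
    fun p hp ↦ by simp [boxRetraction_eq p hp]⟩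

lemma continuousOn_cylinderBox {X : Type*} [TopologicalSpace X] {a : UnitBall E × I → X}
    (h0 : Continuous fun q ↦ a (q, 0))
    (h1 : ContinuousOn a {p | p.1 ∈ ballBoundary E}) : ContinuousOn a (cylinderBox E) := by
  refine ContinuousOn.union_of_isClosed (s := {p : UnitBall E × I | p.2 = 0}) ?_ h1
    (isClosed_eq continuous_snd continuous_const)
    (isClosed_ballBoundary.preimage continuous_fst)
  exact (h0.comp continuous_fst).continuousOn.congr (fun p hp ↦ by
    rw [Function.comp_apply, ← show p.2 = 0 from hp])

lemma continuousOn_cylinderBoundary {X : Type*} [TopologicalSpace X] {a : UnitBall E × I → X}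
    (h0 : Continuous fun q ↦ a (q, 0)) (h1 : Continuous fun q ↦ a (q, 1))
    (hs : ContinuousOn a {p | p.1 ∈ ballBoundary E}) : ContinuousOn a (cylinderBoundary E) := by
  have h2 : ContinuousOn a {p : UnitBall E × I | p.2 = 1} :=
    (h1.comp continuous_fst).continuousOn.congr (fun p hp ↦ by
      rw [Function.comp_apply, ← show p.2 = 1 from hp])
  refine ((continuousOn_cylinderBox h0 hs).union_of_isClosed h2 isClosed_cylinderBox
    (isClosed_eq continuous_snd continuous_const)).mono ?_
  rintro p (h | h | h)
  exacts [Or.inl (Or.inl h), Or.inr h, Or.inl (Or.inr h)]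

section Clip

variable {X Y : Type*} [TopologicalSpace X] [TopologicalSpace Y] {f : C(X, Y)}

/-- The vector `v`, shortened to the length `t` if it is longer. -/
noncomputable def clip (t : ℝ) (v : E) : E := (t / max t ‖v‖) • v

lemma clip_of_norm_le {t : ℝ} {v : E} (h : ‖v‖ = t) : clip t v = v := by
  rcases eq_or_ne t 0 with rfl | ht
  · simp [clip, norm_eq_zero.1 h]
  · simp [clip, h, div_self ht]

lemma clip_zero (v : E) : clip 0 v = 0 := by simp [clip]

/-- The factor `t / max t ‖v‖` has no limit at the origin; continuity there comes from the bound
`‖clip t v‖ ≤ ‖v‖`. -/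
lemma continuousOn_clip : ContinuousOn (fun p : ℝ × E ↦ clip p.1 p.2) {p | 0 ≤ p.1} := by
  rintro ⟨t, v⟩ ht
  by_cases hv : max t ‖v‖ = 0
  · have h1 : v = 0 := by
      have := (le_max_right t ‖v‖).trans hv.le
      simpa using this
    subst h1
    have h2 : clip t (0 : E) = 0 := by simp [clip]
    rw [ContinuousWithinAt, h2]
    refine squeeze_zero_norm' (a := fun p : ℝ × E ↦ ‖p.2‖) ?_ ?_
    · filter_upwards [self_mem_nhdsWithin] with p hp
      have hp' : 0 ≤ p.1 := hp
      rw [clip, norm_smul, Real.norm_of_nonneg (by positivity)]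
      exact mul_le_of_le_one_left (norm_nonneg _)
        (div_le_one_of_le₀ (le_max_left _ _) (hp'.trans (le_max_left _ _)))
    · exact (Continuous.tendsto' (by fun_prop) _ _ (by simp)).mono_left nhdsWithin_le_nhds
  · refine ContinuousAt.continuousWithinAt ?_
    unfold clip
    have : ContinuousAt (fun p : ℝ × E ↦ p.1 / max p.1 ‖p.2‖) (t, v) :=
      ContinuousAt.div (by fun_prop) (by fun_prop) hv
    exact this.smul (by fun_prop)

lemma norm_clip_factor {t : ℝ} (ht : 0 ≤ t) (v : E) : t / max t ‖v‖ ∈ Icc (0 : ℝ) 1 :=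
  ⟨by positivity, div_le_one_of_le₀ (le_max_left _ _) (ht.trans (le_max_left _ _))⟩

/-- If `f` has the homotopy lifting property for the unit ball, then it has the relative lifting
property with respect to the inclusions of the retracts of the unit ball. -/
lemma LiftsPair.of_ball_retraction (h : LiftsPair {p : UnitBall E × I | p.2 = 0} f)
    (r : C(UnitBall E, UnitBall E)) (K : Set (UnitBall E)) (hr : ∀ p, r p ∈ K)
    (hr' : ∀ p ∈ K, r p = p) : LiftsPair K f := by
  -- The map `ρ` travels from `r p` towards `p` and stops on arrival, at speed `2` because points of
  -- the ball are up to distance `2` apart. It is at `r p` at time `0` and at `p` at time `φ p`, so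
  -- a lift of `b ∘ ρ` restricted to the graph of `φ` is a lift of `b`.
  let φ : C(UnitBall E, I) :=
    ⟨fun p ↦ ⟨‖(p : E) - r p‖ / 2, by positivity, by
      have h1 := norm_sub_le (p : E) (r p)
      have h2 := norm_unitBall_le p
      have h3 := norm_unitBall_le (r p)
      linarith⟩, by fun_prop⟩
  let ρ : C(UnitBall E × I, UnitBall E) :=
    ⟨fun p ↦ ⟨r p.1 + clip (2 * p.2) ((p.1 : E) - r p.1),
      (convex_closedBall (0 : E) 1).add_smul_sub_mem (r p.1).2 p.1.2
        (norm_clip_factor (mul_nonneg zero_le_two p.2.2.1) _)⟩, by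
      refine Continuous.subtype_mk (Continuous.add (by fun_prop) ?_) _
      exact continuousOn_clip.comp_continuous (f := fun p : UnitBall E × I ↦
        (2 * (p.2 : ℝ), (p.1 : E) - r p.1)) (by fun_prop)
        (fun p ↦ mul_nonneg zero_le_two p.2.2.1)⟩
  intro b a ha hab
  obtain ⟨c, hc, hc'⟩ := h (b.comp ρ) (fun p ↦ a (r p.1))
    (ha.comp_continuous (f := fun p : UnitBall E × I ↦ r p.1) (by fun_prop)
      (fun p ↦ hr _)).continuousOn (fun p hp ↦ by
        rw [hab _ (hr _)]
        have hp' : p.2 = 0 := hp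
        refine congrArg b (Subtype.ext ?_)
        simp [ρ, hp', clip_zero])
  refine ⟨c.comp ((ContinuousMap.id _).prodMk φ), fun p ↦ ?_, fun p hp ↦ ?_⟩
  · refine (hc (p, φ p)).trans (congrArg b (Subtype.ext ?_))
    simp only [ρ, φ, ContinuousMap.coe_mk]
    rw [clip_of_norm_le (by ring)]
    abel
  · have h0 : φ p = 0 := by ext; simp [φ, hr' p hp]
    change c (p, φ p) = a p
    rw [h0, hc' (show (p, (0 : I)).2 = 0 from rfl)]
    exact congrArg a (hr' p hp)

end Clip

section Cylinder

variable (E) in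
/-- The cylinder on the unit ball of `E` is homeomorphic to the unit ball of `E × ℝ`. -/
noncomputable def cylinderHomeomorph : UnitBall E × I ≃ₜ UnitBall (E × ℝ) where
  toFun p := ⟨(p.1, 2 * p.2 - 1), by
    have h1 := p.2.2.1
    have h2 := p.2.2.2
    rw [mem_closedBall_zero_iff, Prod.norm_def, max_le_iff, Real.norm_eq_abs, abs_le]
    exact ⟨norm_unitBall_le _, by dsimp only; linarith, by dsimp only; linarith⟩⟩
  invFun q := (⟨q.1.1, mem_closedBall_zero_iff.2 ((norm_fst_le _).trans (norm_unitBall_le q))⟩,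
    ⟨(q.1.2 + 1) / 2, by
      have := (norm_snd_le _).trans (norm_unitBall_le q)
      rw [Real.norm_eq_abs, abs_le] at this
      constructor <;> linarith⟩)
  left_inv p := by ext <;> simp
  right_inv q := by
    ext
    · simp
    · simp only; ring
  continuous_toFun := by fun_prop
  continuous_invFun := by fun_prop

/-- The norm of `E × ℝ` is the maximum norm, so a cylinder is already a ball one dimension up; this
is the benefit of allowing arbitrary norms. -/
lemma cylinderHomeomorph_mem_ballBoundary (p : UnitBall E × I) :
    p ∈ cylinderBoundary E ↔ cylinderHomeomorph E p ∈ ballBoundary (E × ℝ) := by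
  have h1 := p.2.2.1
  have h2 := p.2.2.2
  have h3 := norm_unitBall_le p.1
  have h4 : |2 * (p.2 : ℝ) - 1| ≤ 1 := by rw [abs_le]; constructor <;> linarith
  have h5 : |2 * (p.2 : ℝ) - 1| = 1 ↔ p.2 = 0 ∨ p.2 = 1 := by
    rw [abs_eq zero_le_one, or_comm, Subtype.ext_iff, Subtype.ext_iff, Icc.coe_zero, Icc.coe_one]
    constructor <;> rintro (h | h)
    exacts [Or.inl (by linarith), Or.inr (by linarith), Or.inl (by linarith),
      Or.inr (by linarith)]
  change _ ↔ max ‖(p.1 : E)‖ |2 * (p.2 : ℝ) - 1| = 1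
  simp only [cylinderBoundary, mem_ofPred_eq]
  rw [← or_assoc, ← h5]
  constructor
  · rintro (h | h)
    · rw [h]; exact max_eq_right h3
    · rw [h]; exact max_eq_left h4
  · intro h
    rcases max_choice ‖(p.1 : E)‖ |2 * (p.2 : ℝ) - 1| with h' | h'
    · exact Or.inr (h'.symm.trans h)
    · exact Or.inl (h'.symm.trans h)

variable {X Y : Type*} [TopologicalSpace X] [TopologicalSpace Y] {f : C(X, Y)}

lemma LiftsPair.cylinderBoundary (h : LiftsPair (ballBoundary (E × ℝ)) f) :
    LiftsPair (cylinderBoundary E) f :=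
  h.of_homeomorph (cylinderHomeomorph E) cylinderHomeomorph_mem_ballBoundary

/-- The box is a retract of the cylinder, which is a ball of `E × ℝ`, so
`LiftsPair.of_ball_retraction` applies one dimension up. -/
lemma LiftsPair.cylinderBox (h : LiftsPair {p : UnitBall (E × ℝ) × I | p.2 = 0} f) :
    LiftsPair (cylinderBox E) f := by
  let e := cylinderHomeomorph E
  refine LiftsPair.of_homeomorph (S' := e.symm ⁻¹' (_root_.cylinderBox E)) ?_ e
    (fun p ↦ by simp)
  refine h.of_ball_retraction ((e : C(UnitBall E × I, UnitBall (E × ℝ))).comp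
    (boxRetraction.comp (e.symm : C(UnitBall (E × ℝ), UnitBall E × I)))) _
    (fun p ↦ ?_) (fun p hp ↦ ?_)
  · simpa using boxRetraction_mem _
  · simp [boxRetraction_eq _ hp]

/-- A map which has the relative lifting property with respect to the inclusions of the boundary
spheres of balls has the homotopy lifting property with respect to balls. -/
lemma LiftsPair.of_ballBoundary (h : LiftsPair (ballBoundary E) f)
    (h' : LiftsPair (ballBoundary (E × ℝ)) f) :
    LiftsPair {p : UnitBall E × I | p.2 = 0} f := by
  have hm (z : UnitBall E) : 0 < max ‖(z : E)‖ (1 / 2) := lt_max_of_lt_right (by norm_num)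
  have hm' (z : UnitBall E) : max ‖(z : E)‖ (1 / 2) ≤ 1 :=
    max_le (norm_unitBall_le z) (by norm_num)
  -- The map `τ` bends the ball onto the lid: the points of norm at most `1 / 2` cover the top and
  -- the outer shell covers the side. The boundary sphere goes to the rim at height `0`. On the lid,
  -- `ψ` is the inverse.
  let τ : C(UnitBall E, UnitBall E × I) :=
    ⟨fun z ↦ (⟨(max ‖(z : E)‖ (1 / 2))⁻¹ • (z : E), by
        rw [mem_closedBall_zero_iff, norm_smul, norm_inv, Real.norm_of_nonneg (hm z).le,
          inv_mul_le_one₀ (hm z)]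
        exact le_max_left _ _⟩,
      ⟨2 - 2 * max ‖(z : E)‖ (1 / 2), by
        have := hm' z
        have : 1 / 2 ≤ max ‖(z : E)‖ (1 / 2) := le_max_right _ _
        constructor <;> linarith⟩), by
      have : Continuous fun z : UnitBall E ↦ (max ‖(z : E)‖ (1 / 2))⁻¹ :=
        Continuous.inv₀ (by fun_prop) (fun z ↦ (hm z).ne')
      fun_prop⟩
  let ψ : C(UnitBall E × I, UnitBall E) :=
    ⟨fun p ↦ ⟨(1 - (p.2 : ℝ) / 2) • (p.1 : E), by
      have h1 := p.2.2.1
      have h2 := p.2.2.2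
      rw [mem_closedBall_zero_iff, norm_smul, Real.norm_of_nonneg (by linarith)]
      exact mul_le_one₀ (by linarith) (norm_nonneg _) (norm_unitBall_le _)⟩, by fun_prop⟩
  have hψ (p : UnitBall E × I) (hp : p ∈ cylinderLid E) :
      max ‖(ψ p : E)‖ (1 / 2) = 1 - (p.2 : ℝ) / 2 := by
    have h1 := p.2.2.1
    have h2 := p.2.2.2
    have h3 := norm_unitBall_le p.1
    simp only [ψ, ContinuousMap.coe_mk, norm_smul]
    rw [Real.norm_of_nonneg (by linarith)]
    rcases hp with hp | hp
    · rw [hp, Icc.coe_one]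
      rw [max_eq_right (by linarith)]
      norm_num
    · rw [hp, max_eq_left (by linarith), mul_one]
  have hτψ (p : UnitBall E × I) (hp : p ∈ cylinderLid E) : τ (ψ p) = p := by
    have h2 := p.2.2.2
    have h3 : 1 - (p.2 : ℝ) / 2 ≠ 0 := by intro h; linarith
    ext
    · simp only [τ, ContinuousMap.coe_mk, hψ p hp]
      simp [ψ, smul_smul, inv_mul_cancel₀ h3]
    · simp only [τ, ContinuousMap.coe_mk, hψ p hp]
      ring
  intro b a ha hab
  have ha0 : Continuous fun q ↦ a (q, 0) :=
    ha.comp_continuous (by fun_prop) (fun q ↦ rfl)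
  -- Two fillings suffice: the lid is a ball whose boundary is the rim at height `0`, and once a
  -- lift is chosen there it is prescribed on the whole boundary of the cylinder, itself a ball of
  -- `E × ℝ`.
  obtain ⟨c, hc, hc'⟩ := h (b.comp τ) (fun q ↦ a (q, 0)) ha0.continuousOn (fun q hq ↦ by
    have hq' : ‖(q : E)‖ = 1 := hq
    have : τ q = (q, 0) := by
      have h1 : max (1 : ℝ) (1 / 2) = 1 := max_eq_left (by norm_num)
      ext
      · simp only [τ, ContinuousMap.coe_mk, hq', h1, inv_one, one_smul]
      · simp only [τ, ContinuousMap.coe_mk, hq', h1, Icc.coe_zero]; norm_num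
    rw [ContinuousMap.comp_apply, this, hab _ rfl])
  classical
  have hc0 (q : UnitBall E) (hq : ‖(q : E)‖ = 1) : c (ψ (q, 0)) = a (q, 0) := by
    have : ψ (q, 0) = q := by ext; simp [ψ]
    rw [this]
    exact hc' hq
  let d : UnitBall E × I → X := fun p ↦ if p.2 = 0 then a (p.1, 0) else c (ψ p)
  have hd0 (q : UnitBall E) : d (q, 0) = a (q, 0) := by simp [d]
  have hd1 (p : UnitBall E × I) (hp : p ∈ cylinderLid E) : d p = c (ψ p) := by
    by_cases h0 : p.2 = 0
    · obtain ⟨q, t⟩ := p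
      obtain rfl : t = 0 := h0
      rw [hd0, hc0 q (by simpa [cylinderLid] using hp)]
    · simp [d, h0]
  obtain ⟨e, he, he'⟩ := h'.cylinderBoundary b d
    (continuousOn_cylinderBoundary (by simpa [hd0] using ha0)
      ((c.comp ψ).continuous.comp (by fun_prop : Continuous fun q : UnitBall E ↦ (q, (1 : I)))
        |>.congr fun q ↦ (hd1 (q, 1) (Or.inl rfl)).symm)
      ((c.comp ψ).continuous.continuousOn.congr fun p hp ↦ hd1 p (Or.inr hp)))
    (fun p hp ↦ by
      by_cases h0 : p ∈ cylinderLid E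
      · rw [hd1 p h0, hc, ContinuousMap.comp_apply, hτψ p h0]
      · have : p.2 = 0 := hp.resolve_right h0
        obtain ⟨q, t⟩ := p
        obtain rfl : t = 0 := this
        rw [hd0, hab _ rfl])
  refine ⟨e, he, fun p hp ↦ ?_⟩
  obtain ⟨q, t⟩ := p
  obtain rfl : t = 0 := hp
  rw [he' (Or.inl rfl), hd0]

end Cylinder

/-- The unit balls of two normed spaces of the same finite dimension are homeomorphic, by a
homeomorphism which preserves the boundary spheres. -/
lemma exists_unitBall_homeomorph {F : Type*} [NormedAddCommGroup F] [NormedSpace ℝ F]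
    [FiniteDimensional ℝ E] [FiniteDimensional ℝ F]
    (h : Module.finrank ℝ E = Module.finrank ℝ F) :
    ∃ e : UnitBall E ≃ₜ UnitBall F, ∀ p, p ∈ ballBoundary E ↔ e p ∈ ballBoundary F := by
  -- A linear isomorphism carries the ball of `E` to a bounded closed convex body with nonempty
  -- interior, and such a body is homeomorphic to the unit ball compatibly with the frontiers.
  let l : E ≃L[ℝ] F := ContinuousLinearEquiv.ofFinrankEq h
  let s : Set F := l '' closedBall (0 : E) 1
  have hs : Convex ℝ s := (convex_closedBall (0 : E) 1).linear_image l.toLinearMap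
  have hs' : IsClosed s := l.toHomeomorph.isClosedMap _ isClosed_closedBall
  have hsi : (interior s).Nonempty := by
    refine ⟨0, ?_⟩
    rw [show s = l.toHomeomorph '' closedBall (0 : E) 1 from rfl,
      ← l.toHomeomorph.image_interior]
    exact ⟨0, mem_interior_iff_mem_nhds.2 (closedBall_mem_nhds _ one_pos), map_zero l⟩
  have hsb : Bornology.IsBounded s :=
    l.lipschitz.isBounded_image isBounded_closedBall
  obtain ⟨e, -, h2, h3⟩ := exists_homeomorph_image_interior_closure_frontier_eq_unitBall hs hsi hsb
  rw [hs'.closure_eq] at h2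
  let e' : E ≃ₜ F := l.toHomeomorph.trans e
  have he : e' '' closedBall (0 : E) 1 = closedBall (0 : F) 1 := by
    rw [← h2, ← image_comp]; rfl
  have he' : e' '' frontier (closedBall (0 : E) 1) = sphere (0 : F) 1 := by
    rw [← h3, show s = l.toHomeomorph '' closedBall (0 : E) 1 from rfl,
      ← l.toHomeomorph.image_frontier, ← image_comp]; rfl
  rw [frontier_closedBall _ one_ne_zero] at he'
  have hmem (p : E) : p ∈ closedBall (0 : E) 1 ↔ e' p ∈ closedBall (0 : F) 1 := by
    rw [← he, e'.injective.mem_set_image]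
  refine ⟨e'.subtype hmem, fun p ↦ ?_⟩
  have : (p : E) ∈ sphere (0 : E) 1 ↔ e' p ∈ sphere (0 : F) 1 := by
    rw [← he', e'.injective.mem_set_image]
  simpa [ballBoundary] using this

end Ball

end CellPairs

/-! ### Homotopy lifting, and lifts obtained from bijections on homotopy classes. -/

section LiftingHomotopies

open Metric Set Topology unitInterval

variable {P X Y : Type*} [TopologicalSpace P] [TopologicalSpace X] [TopologicalSpace Y]

/-- The projection of the real line onto the unit interval. -/
noncomputable abbrev toUnit (t : ℝ) : I := projIcc 0 1 zero_le_one t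

lemma continuous_toUnit : Continuous toUnit := continuous_projIcc

lemma toUnit_of_one_le {t : ℝ} (h : 1 ≤ t) : toUnit t = 1 := projIcc_of_right_le zero_le_one h

lemma exists_glue {S₁ S₂ : Set P} (h₁ : IsClosed S₁) (h₂ : IsClosed S₂) {a₁ a₂ : P → X}
    (ha₁ : ContinuousOn a₁ S₁) (ha₂ : ContinuousOn a₂ S₂) (h : ∀ p ∈ S₁, p ∈ S₂ → a₁ p = a₂ p) :
    ∃ a : P → X, EqOn a a₁ S₁ ∧ EqOn a a₂ S₂ ∧ ContinuousOn a (S₁ ∪ S₂) := by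
  classical
  have e₁ : EqOn (S₁.piecewise a₁ a₂) a₁ S₁ := piecewise_eqOn _ _ _
  have e₂ : EqOn (S₁.piecewise a₁ a₂) a₂ S₂ := fun p hp ↦ by
    by_cases h' : p ∈ S₁
    · rw [e₁ h', h p h' hp]
    · exact piecewise_eq_of_notMem _ _ _ h'
  exact ⟨_, e₁, e₂, (ha₁.congr e₁).union_of_isClosed (ha₂.congr e₂) h₁ h₂⟩

/-- Prescribing a map on `P × {0} ∪ T × I`. -/
lemma exists_glue_box {T : Set P} (hT : IsClosed T) {g : P → X} {s : P × I → X}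
    (hg : Continuous g) (hs : ContinuousOn s {p | p.1 ∈ T}) (h : ∀ p ∈ T, g p = s (p, 0)) :
    ∃ a : P × I → X, (∀ p, a (p, 0) = g p) ∧ (∀ p ∈ T, ∀ t, a (p, t) = s (p, t)) ∧
      ContinuousOn a {p | p.2 = 0 ∨ p.1 ∈ T} := by
  obtain ⟨a, h₁, h₂, h₃⟩ := exists_glue (S₁ := {p : P × I | p.2 = 0})
    (isClosed_eq continuous_snd continuous_const) (hT.preimage continuous_fst)
    (hg.comp continuous_fst).continuousOn hs (by rintro ⟨p, t⟩ rfl hp; exact h p hp)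
  exact ⟨a, fun p ↦ h₁ (show (p, (0 : I)).2 = 0 from rfl), fun p hp t ↦ h₂ (x := (p, t)) hp, h₃⟩

/-- Prescribing a map on `P × {0, 1} ∪ T × I`. -/
lemma exists_glue_boundary {T : Set P} (hT : IsClosed T) {g₀ g₁ : P → X} {s : P × I → X}
    (hg₀ : Continuous g₀) (hg₁ : Continuous g₁) (hs : ContinuousOn s {p | p.1 ∈ T})
    (h₀ : ∀ p ∈ T, g₀ p = s (p, 0)) (h₁ : ∀ p ∈ T, g₁ p = s (p, 1)) :
    ∃ a : P × I → X, (∀ p, a (p, 0) = g₀ p) ∧ (∀ p, a (p, 1) = g₁ p) ∧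
      (∀ p ∈ T, ∀ t, a (p, t) = s (p, t)) ∧
      ContinuousOn a {p | p.2 = 0 ∨ p.2 = 1 ∨ p.1 ∈ T} := by
  obtain ⟨a, h₂, h₃, h₄⟩ := exists_glue_box hT hg₀ hs h₀
  obtain ⟨a', h₅, h₆, h₇⟩ := exists_glue
    ((isClosed_eq continuous_snd continuous_const).union (hT.preimage continuous_fst))
    (S₂ := {p : P × I | p.2 = 1}) (isClosed_eq continuous_snd continuous_const) h₄
    (hg₁.comp continuous_fst).continuousOn (by
      rintro ⟨p, t⟩ hp rfl
      have hp' : p ∈ T := hp.resolve_left (fun h ↦ one_ne_zero (α := I) h)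
      rw [h₃ p hp', ← h₁ p hp']; rfl)
  refine ⟨a', fun p ↦ ?_, fun p ↦ h₆ (show (p, (1 : I)).2 = 1 from rfl), fun p hp t ↦ ?_,
    h₇.mono ?_⟩
  · rw [h₅ (Or.inl rfl), h₂]
  · rw [h₅ (Or.inr hp), h₃ p hp]
  · rintro p (h | h | h)
    exacts [Or.inl (Or.inl h), Or.inr h, Or.inl (Or.inr h)]

/-- If `f` has the homotopy lifting property relative to `T`, a homotopy of lifting problems
along `f` can be lifted starting from a solution. -/
lemma LiftsPair.exists_lift_homotopy {T : Set P} {f : C(X, Y)}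
    (h : LiftsPair {p : P × I | p.2 = 0 ∨ p.1 ∈ T} f) (hT : IsClosed T) (b : P × I → Y)
    (hb : Continuous b)
    (a : P × I → X) (ha : ContinuousOn a {p | p.1 ∈ T}) (hab : ∀ p ∈ T, ∀ t, f (a (p, t)) = b (p, t))
    (c₀ : C(P, X)) (hc₀ : ∀ p, f (c₀ p) = b (p, 0)) (hac₀ : ∀ p ∈ T, c₀ p = a (p, 0)) :
    ∃ c : C(P × I, X), (∀ p t, f (c (p, t)) = b (p, t)) ∧ (∀ p, c (p, 0) = c₀ p) ∧
      ∀ p ∈ T, ∀ t, c (p, t) = a (p, t) := by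
  obtain ⟨a', h₁, h₂, h₃⟩ := exists_glue_box hT c₀.continuous ha hac₀
  obtain ⟨c, hc, hc'⟩ := h ⟨b, hb⟩ a' h₃ (by
    rintro ⟨p, t⟩ (hp | hp)
    · obtain rfl : t = 0 := hp
      rw [h₁, hc₀]; rfl
    · rw [h₂ p hp, hab p hp]; rfl)
  exact ⟨c, fun p t ↦ hc _, fun p ↦ by rw [hc' (Or.inl rfl), h₁],
    fun p hp t ↦ by rw [hc' (Or.inr hp), h₂ p hp]⟩

/-- There is a homotopy from `γ₀` to `γ₁` which is given on the subset `T` by the function `p` of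
the time. -/
def HomotopicAlong (T : Set P) (p : I → X) (γ₀ γ₁ : C(P, X)) : Prop :=
  ∃ H : C(P × I, X), (∀ q, H (q, 0) = γ₀ q) ∧ (∀ q, H (q, 1) = γ₁ q) ∧
    ∀ q ∈ T, ∀ t, H (q, t) = p t

lemma HomotopicAlong.symm {T : Set P} {p : I → X} {γ₀ γ₁ : C(P, X)}
    (h : HomotopicAlong T p γ₀ γ₁) : HomotopicAlong T (p ∘ unitInterval.symm) γ₁ γ₀ := by
  obtain ⟨H, h₀, h₁, h₂⟩ := h
  exact ⟨H.comp ⟨fun q ↦ (q.1, unitInterval.symm q.2), by fun_prop⟩, by simpa, by simpa,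
    fun q hq t ↦ h₂ q hq _⟩

lemma HomotopicAlong.map {T : Set P} {p : I → X} {γ₀ γ₁ : C(P, X)}
    (h : HomotopicAlong T p γ₀ γ₁) (f : C(X, Y)) :
    HomotopicAlong T (f ∘ p) (f.comp γ₀) (f.comp γ₁) := by
  obtain ⟨H, h₀, h₁, h₂⟩ := h
  exact ⟨f.comp H, by simp [h₀], by simp [h₁], fun q hq t ↦ by simp [h₂ q hq]⟩

/-- Surjectivity of the map induced by `f` on homotopy classes of maps from `P` which are constant
on `T`. -/
def PiSurjective (T : Set P) (f : C(X, Y)) (x : X) : Prop :=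
  ∀ γ : C(P, Y), (∀ q ∈ T, γ q = f x) → ∃ γ' : C(P, X), (∀ q ∈ T, γ' q = x) ∧
    HomotopicAlong T (fun _ ↦ f x) (f.comp γ') γ

/-- Injectivity of the map induced by `f` on homotopy classes of maps from `P` which are constant
on `T`. -/
def PiInjective (T : Set P) (f : C(X, Y)) (x : X) : Prop :=
  ∀ γ₀ γ₁ : C(P, X), (∀ q ∈ T, γ₀ q = x) → (∀ q ∈ T, γ₁ q = x) →
    HomotopicAlong T (fun _ ↦ f x) (f.comp γ₀) (f.comp γ₁) → HomotopicAlong T (fun _ ↦ x) γ₀ γ₁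

/-- A strict lift of `γ` exists, so the required homotopy can be constant. -/
lemma LiftsPair.piSurjective {T : Set P} {f : C(X, Y)} (h : LiftsPair T f) (x : X) :
    PiSurjective T f x := by
  intro γ hγ
  obtain ⟨c, hc, hc'⟩ := h γ (fun _ ↦ x) continuousOn_const (fun p hp ↦ (hγ p hp).symm)
  exact ⟨c, hc', ⟨γ.comp ⟨Prod.fst, by fun_prop⟩, fun q ↦ by simp [hc], fun q ↦ rfl,
    fun q hq t ↦ hγ q hq⟩⟩

/-- The homotopy in `Y` is a map on the cylinder, and `γ₀`, `γ₁` and the constant `x` prescribe a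
lift of it on the boundary. -/
lemma LiftsPair.piInjective {T : Set P} (hT : IsClosed T) {f : C(X, Y)}
    (h : LiftsPair {p : P × I | p.2 = 0 ∨ p.2 = 1 ∨ p.1 ∈ T} f) (x : X) :
    PiInjective T f x := by
  rintro γ₀ γ₁ hγ₀ hγ₁ ⟨H, h₀, h₁, h₂⟩
  obtain ⟨a, h₃, h₄, h₅, h₆⟩ := exists_glue_boundary hT (s := fun _ ↦ x) γ₀.continuous
    γ₁.continuous continuousOn_const hγ₀ hγ₁
  obtain ⟨c, -, hc⟩ := h H a h₆ (by
    rintro ⟨p, t⟩ (hp | hp | hp)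
    · obtain rfl : t = 0 := hp
      rw [h₃, h₀]; rfl
    · obtain rfl : t = 1 := hp
      rw [h₄, h₁]; rfl
    · rw [h₅ p hp, h₂ p hp])
  exact ⟨c, fun q ↦ by rw [hc (Or.inl rfl), h₃], fun q ↦ by rw [hc (Or.inr (Or.inl rfl)), h₄],
    fun q hq t ↦ by rw [hc (Or.inr (Or.inr hq)), h₅ q hq]⟩

section Ball

variable {E : Type*} [NormedAddCommGroup E] [NormedSpace ℝ E] {f : C(X, Y)}

section Acyclic

variable (h₁ : LiftsPair (cylinderBox E) f)
  (h₂ : LiftsPair {p : (UnitBall E × I) × I | p.2 = 0 ∨ p.1 ∈ cylinderBoundary E} f)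
  (hi : ∀ x, PiInjective (ballBoundary E) f x) (hs : ∀ x, PiSurjective (cylinderBoundary E) f x)

include h₂ hi hs in
/-- Spheres in a fibre are null-homotopic in this fibre. -/
lemma exists_nullhomotopy_fiber (x : X) (α : C(UnitBall E, X))
    (hα : ∀ q ∈ ballBoundary E, α q = x) (hα' : ∀ q, f (α q) = f x) :
    ∃ h : C(UnitBall E × I, X), (∀ q, h (q, 0) = x) ∧ (∀ q, h (q, 1) = α q) ∧
      (∀ q ∈ ballBoundary E, ∀ t, h (q, t) = x) ∧ ∀ p, f (h p) = f x := by
  -- Injectivity gives a null-homotopy `h` in `X`. Its image in `Y` represents a class one dimension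
  -- higher, which need not vanish.
  obtain ⟨h, h0, h1, hS⟩ := hi x (ContinuousMap.const _ x) α (fun _ _ ↦ rfl) hα
    ⟨ContinuousMap.const _ (f x), fun _ ↦ rfl, fun q ↦ (hα' q).symm, fun _ _ _ ↦ rfl⟩
  simp only [ContinuousMap.const_apply] at h0
  have hT (p : UnitBall E × I) (hp : p ∈ cylinderBoundary E) : f (h p) = f x := by
    obtain ⟨q, t⟩ := p
    rcases hp with hp | hp | hp
    · obtain rfl : t = 0 := hp
      rw [h0]
    · obtain rfl : t = 1 := hp
      rw [h1, hα']
    · rw [hS q hp]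
  -- Surjectivity one dimension up realizes this class by some `γ`, and `c` deforms `h` relative to
  -- the boundary until its image is exactly that of `γ`.
  obtain ⟨γ, hγ, H, H0, H1, HT⟩ := hs x (f.comp h) hT
  obtain ⟨c, hc, hc0, hcT⟩ := h₂.exists_lift_homotopy isClosed_cylinderBoundary
    (fun p ↦ H (p.1, unitInterval.symm p.2)) (by fun_prop) (fun p ↦ h p.1) (by fun_prop)
    (fun p hp t ↦ by rw [HT p hp, hT p hp]) h (fun p ↦ by simp [H1]) (fun _ _ ↦ rfl)
  have hc1 (p) : f (c (p, 1)) = f (γ p) := by simp [hc, H0]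
  have ct := continuous_toUnit
  -- Running `γ` backwards and then the deformed `h` still joins `x` to `α`, while the image in `Y`
  -- goes out and back along the image of `γ`.
  let w : C(UnitBall E × I, X) :=
    ⟨fun p ↦ if (p.2 : ℝ) ≤ 1 / 2 then γ (p.1, toUnit (1 - 2 * p.2))
      else c ((p.1, toUnit (2 * p.2 - 1)), 1), by
      refine Continuous.if_le (by fun_prop) (by fun_prop) (by fun_prop) (by fun_prop) ?_
      rintro ⟨q, t⟩ ht
      simp only at ht ⊢
      norm_num [ht]
      rw [hγ _ (Or.inl rfl), hcT _ (Or.inl rfl), h0]⟩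
  have hw (q t) : f (w (q, t)) = f (γ (q, toUnit |1 - 2 * (t : ℝ)|)) := by
    by_cases ht : (t : ℝ) ≤ 1 / 2
    · simp only [w, ContinuousMap.coe_mk, ht, if_true]
      rw [abs_of_nonneg (by linarith)]
    · simp only [w, ContinuousMap.coe_mk, ht, if_false]
      rw [hc1, abs_of_nonpos (by linarith)]
      congr 4; ring
  -- Replacing `|1 - 2 * t|` by its maximum with the new time contracts the image to `f x`. Lifting
  -- this contraction with the boundary held fixed moves `w` into the fibre.
  obtain ⟨c', hc', hc0', hcT'⟩ := h₂.exists_lift_homotopy isClosed_cylinderBoundary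
    (fun p ↦ f (γ (p.1.1, toUnit (max |1 - 2 * (p.1.2 : ℝ)| p.2)))) (by fun_prop)
    (fun p ↦ h p.1) (by fun_prop)
    (by
      rintro ⟨q, t⟩ hp s
      have hs := s.2.2
      rw [hT _ hp]
      dsimp only
      rw [hγ]
      rcases hp with hp | hp | hp
      · obtain rfl : t = 0 := hp
        right; left
        norm_num
      · obtain rfl : t = 1 := hp
        right; left
        norm_num
      · exact Or.inr (Or.inr hp)) w
    (by
      rintro ⟨q, t⟩
      rw [hw]
      simp)
    (by
      rintro ⟨q, t⟩ (hp | hp | hp)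
      · obtain rfl : t = 0 := hp
        simp [w, h0, hγ (q, 1) (Or.inr (Or.inl rfl))]
      · obtain rfl : t = 1 := hp
        simp only [w, ContinuousMap.coe_mk, Icc.coe_one]
        norm_num
        rw [hcT (q, 1) (Or.inr (Or.inl rfl))]
      · have hp' : q ∈ ballBoundary E := hp
        simp only [w, ContinuousMap.coe_mk]
        split_ifs
        · exact (hγ (q, _) (Or.inr (Or.inr hp'))).trans (hS q hp' t).symm
        · exact (hcT (q, _) (Or.inr (Or.inr hp')) _).trans ((hS q hp' _).trans (hS q hp' t).symm))
  refine ⟨c'.comp ⟨fun p ↦ (p, 1), by fun_prop⟩, fun q ↦ ?_, fun q ↦ ?_, fun q hq t ↦ ?_,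
    fun p ↦ ?_⟩
  · exact (hcT' (q, 0) (Or.inl rfl) 1).trans (h0 q)
  · exact (hcT' (q, 1) (Or.inr (Or.inl rfl)) 1).trans (h1 q)
  · exact (hcT' (q, t) (Or.inr (Or.inr hq)) 1).trans (hS q hq t)
  · refine (hc' p 1).trans ?_
    rw [hγ]
    right; left
    exact toUnit_of_one_le (le_max_right _ _)

/-- Scaling down the unit ball. -/
noncomputable def ballContraction : C(UnitBall E × I, UnitBall E) :=
  ⟨fun p ↦ ⟨(1 - (p.2 : ℝ)) • (p.1 : E), by
      have h1 := p.2.2.1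
      have h2 := p.2.2.2
      rw [mem_closedBall_zero_iff, norm_smul, Real.norm_of_nonneg (by linarith)]
      exact mul_le_one₀ (by linarith) (norm_nonneg _) (norm_unitBall_le _)⟩, by fun_prop⟩

@[simp] lemma ballContraction_zero (q : UnitBall E) : ballContraction (q, 0) = q := by
  ext; simp [ballContraction]

lemma ballContraction_one (q q' : UnitBall E) :
    ballContraction (q, 1) = ballContraction (q', 1) := by
  ext; simp [ballContraction]

include h₁ h₂ hi hs in
/-- Two lifts of the same map which agree on the boundary sphere are homotopic over this map. -/
lemma exists_homotopy_of_lifts (c₁ a₁ : C(UnitBall E, X)) (h : ∀ q ∈ ballBoundary E, a₁ q = c₁ q)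
    (hf : ∀ q, f (a₁ q) = f (c₁ q)) :
    ∃ H : C(UnitBall E × I, X), (∀ q, H (q, 0) = c₁ q) ∧ (∀ q, H (q, 1) = a₁ q) ∧
      (∀ q ∈ ballBoundary E, ∀ t, H (q, t) = c₁ q) ∧ ∀ q t, f (H (q, t)) = f (c₁ q) := by
  -- Shrinking `c₁` to its value `x` at the centre gives a homotopy in `Y`; lifted from `a₁`, it
  -- ends at a sphere in the fibre over `f x`, which the previous lemma contracts by `g`.
  let k : C(UnitBall E × I, X) := c₁.comp ballContraction
  have hk0 (q) : k (q, 0) = c₁ q := by simp [k]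
  obtain ⟨A, hA, hA0, hAS⟩ := LiftsPair.exists_lift_homotopy (T := ballBoundary E) h₁ isClosed_ballBoundary
    (fun p ↦ f (k p)) (by fun_prop) k (by fun_prop) (fun _ _ _ ↦ rfl) a₁
    (fun q ↦ by rw [hf, hk0]) (fun q hq ↦ by rw [h q hq, hk0])
  let x := k (0, 1)
  have hk1 (q) : k (q, 1) = x := congrArg c₁ (ballContraction_one _ _)
  obtain ⟨g, g0, g1, gS, gf⟩ := exists_nullhomotopy_fiber h₂ hi hs x
    (A.comp ⟨fun q ↦ (q, 1), by fun_prop⟩) (fun q hq ↦ (hAS q hq 1).trans (hk1 q))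
    (fun q ↦ (hA q 1).trans (by rw [hk1]))
  obtain ⟨a, ha, ha', hac⟩ := exists_glue
    (S₁ := {p : (UnitBall E × I) × I | p.1.2 = 1})
    (S₂ := {p : (UnitBall E × I) × I | p.1.2 = 0 ∨ p.1.1 ∈ ballBoundary E})
    (isClosed_eq (by fun_prop) continuous_const)
    ((isClosed_eq (by fun_prop) continuous_const).union
      (isClosed_ballBoundary.preimage (by fun_prop)))
    (a₁ := fun p ↦ A (p.1.1, unitInterval.symm p.2))
    (a₂ := fun p ↦ k (p.1.1, unitInterval.symm p.2)) (by fun_prop) (by fun_prop)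
    (by
      rintro ⟨⟨q, t⟩, s⟩ ht hp
      obtain rfl : t = 1 := ht
      exact hAS q (hp.resolve_left (one_ne_zero (α := I))) _)
  have ha1 (q s) : a ((q, 1), s) = A (q, unitInterval.symm s) :=
    ha (show ((q, (1 : I)), s).1.2 = 1 from rfl)
  have ha0 (q s) : a ((q, 0), s) = k (q, unitInterval.symm s) := ha' (Or.inl rfl)
  have haS (q : UnitBall E) (t s) (hq : q ∈ ballBoundary E) :
    a ((q, t), s) = k (q, unitInterval.symm s) := ha' (Or.inr hq)
  -- The shrinking is run backwards from `g`, with `A` prescribed at the end `1` and `k` on the rest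
  -- of the boundary. At the final time `g` has become a homotopy from `c₁` to `a₁` over `f ∘ c₁`.
  obtain ⟨c, hc, hc0, hcT⟩ := h₂.exists_lift_homotopy isClosed_cylinderBoundary
    (fun p ↦ f (k (p.1.1, unitInterval.symm p.2))) (by fun_prop) a
    (hac.mono (by
      rintro ⟨⟨q, t⟩, s⟩ (hp | hp | hp)
      exacts [Or.inr (Or.inl hp), Or.inl hp, Or.inr (Or.inr hp)]))
    (by
      rintro ⟨q, t⟩ (hp | hp | hp) s
      · obtain rfl : t = 0 := hp
        rw [ha0]
      · obtain rfl : t = 1 := hp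
        rw [ha1, hA]
      · rw [haS _ _ _ hp]) g
    (by rintro ⟨q, t⟩; simp [gf, hk1])
    (by
      rintro ⟨q, t⟩ (hp | hp | hp)
      · obtain rfl : t = 0 := hp
        rw [ha0, g0]; simp [hk1]
      · obtain rfl : t = 1 := hp
        rw [ha1, g1]; simp
      · rw [haS _ _ _ hp, gS _ hp]; simp [hk1])
  refine ⟨c.comp ⟨fun p ↦ (p, 1), by fun_prop⟩, fun q ↦ ?_, fun q ↦ ?_, fun q hq t ↦ ?_,
    fun q t ↦ ?_⟩
  · refine (hcT (q, 0) (Or.inl rfl) 1).trans ?_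
    rw [ha0]; simp [hk0]
  · refine (hcT (q, 1) (Or.inr (Or.inl rfl)) 1).trans ?_
    rw [ha1]; simp [hA0]
  · refine (hcT (q, t) (Or.inr (Or.inr hq)) 1).trans ?_
    rw [haS _ _ _ hq]; simp [hk0]
  · refine (hc (q, t) 1).trans ?_
    simp [hk0]

include h₁ h₂ hi hs in
/-- A fibration which induces bijections on homotopy groups has the right lifting property with
respect to the inclusions of boundary spheres. -/
lemma liftsPair_cylinderBoundary_of_piBijective : LiftsPair (cylinderBoundary E) f := by
  intro b a ha hab
  -- A lift `c` extending the values on the box may be wrong on the top. The homotopy `H` corrects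
  -- it there without changing the image in `Y`.
  obtain ⟨c, hc, hca⟩ := h₁ b a (ha.mono (by
    rintro p (hp | hp)
    exacts [Or.inl hp, Or.inr (Or.inr hp)])) (by
    rintro p (hp | hp)
    exacts [hab p (Or.inl hp), hab p (Or.inr (Or.inr hp))])
  have hcS (q t) (hq : q ∈ ballBoundary E) : c (q, t) = a (q, t) := hca (Or.inr hq)
  have ha1 : Continuous fun q ↦ a (q, 1) :=
    ha.comp_continuous (by fun_prop) (fun q ↦ Or.inr (Or.inl rfl))
  obtain ⟨H, H0, H1, HS, Hf⟩ := exists_homotopy_of_lifts h₁ h₂ hi hs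
    (c.comp ⟨fun q ↦ (q, 1), by fun_prop⟩) ⟨fun q ↦ a (q, 1), ha1⟩
    (fun q hq ↦ (hcS q 1 hq).symm) (fun q ↦ (hab _ (Or.inr (Or.inl rfl))).trans (hc _).symm)
  have ct := continuous_toUnit
  let w : C(UnitBall E × I, X) :=
    ⟨fun p ↦ if (p.2 : ℝ) ≤ 1 / 2 then c (p.1, toUnit (2 * p.2))
      else H (p.1, toUnit (2 * p.2 - 1)), by
      refine Continuous.if_le (by fun_prop) (by fun_prop) (by fun_prop) (by fun_prop) ?_
      rintro ⟨q, t⟩ ht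
      simp only at ht ⊢
      norm_num [ht, H0]⟩
  have hw (q t) : f (w (q, t)) = b (q, toUnit (2 * t)) := by
    by_cases ht : (t : ℝ) ≤ 1 / 2
    · simp only [w, ContinuousMap.coe_mk, ht, if_true, hc]
    · simp only [w, ContinuousMap.coe_mk, ht, if_false]
      rw [Hf, toUnit_of_one_le (by linarith)]
      exact hc _
  -- With `H` appended, `w` lies over `b` reparametrized by `min (2 * t) 1`; `θ` interpolates
  -- linearly from there to the identity and fixes both ends.
  let θ : C(I × I, I) :=
    ⟨fun p ↦ toUnit ((1 - p.2) * (toUnit (2 * p.1) : ℝ) + p.2 * p.1), by fun_prop⟩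
  have θ0 (s) : θ (0, s) = 0 := by simp [θ]
  have θ1 (s) : θ (1, s) = 1 := by
    simp only [θ, ContinuousMap.coe_mk, Icc.coe_one]
    rw [toUnit_of_one_le (t := 2 * 1) (by norm_num)]
    simp
  have θ0' (t) : θ (t, 0) = toUnit (2 * t) := by simp [θ]
  have θ1' (t) : θ (t, 1) = t := by simp [θ]
  obtain ⟨c', hc', hc0', hcT'⟩ := h₂.exists_lift_homotopy isClosed_cylinderBoundary
    (fun p ↦ b (p.1.1, θ (p.1.2, p.2))) (by fun_prop)
    (fun p ↦ a (p.1.1, θ (p.1.2, p.2)))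
    (ha.comp (Continuous.continuousOn (f := fun p : (UnitBall E × I) × I ↦
      (p.1.1, θ (p.1.2, p.2))) (by fun_prop)) (by
      rintro ⟨⟨q, t⟩, s⟩ (hp | hp | hp)
      · obtain rfl : t = 0 := hp
        exact Or.inl (θ0 _)
      · obtain rfl : t = 1 := hp
        exact Or.inr (Or.inl (θ1 _))
      · exact Or.inr (Or.inr hp)))
    (by
      rintro ⟨q, t⟩ hp s
      apply hab
      rcases hp with hp | hp | hp
      · obtain rfl : t = 0 := hp
        exact Or.inl (θ0 _)
      · obtain rfl : t = 1 := hp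
        exact Or.inr (Or.inl (θ1 _))
      · exact Or.inr (Or.inr hp)) w
    (by rintro ⟨q, t⟩; rw [hw]; simp [θ0'])
    (by
      rintro ⟨q, t⟩ (hp | hp | hp)
      · obtain rfl : t = 0 := hp
        have : c (q, 0) = a (q, 0) := hca (Or.inl rfl)
        simp [w, θ0, this]
      · obtain rfl : t = 1 := hp
        simp only [w, ContinuousMap.coe_mk, Icc.coe_one, θ1]
        norm_num
        rw [H1]; rfl
      · simp only [w, ContinuousMap.coe_mk, θ0']
        split_ifs with ht
        · rw [hcS _ _ hp]
        · rw [HS _ hp, toUnit_of_one_le (t := 2 * (t : ℝ)) (by linarith)]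
          exact hcS _ _ hp)
  refine ⟨c'.comp ⟨fun p ↦ (p, 1), by fun_prop⟩, fun p ↦ ?_, fun p hp ↦ ?_⟩
  · refine (hc' p 1).trans ?_
    simp [θ1']
  · refine (hcT' p hp 1).trans ?_
    simp [θ1']

end Acyclic

end Ball

end LiftingHomotopies

/-! ### Homotopy groups, change of base point and weak homotopy equivalences. -/

section WeakEquivalences

open Metric Set Topology unitInterval
open scoped Topology.Homotopy

section

variable {P P' X Y : Type*} [TopologicalSpace P] [TopologicalSpace P'] [TopologicalSpace X]
  [TopologicalSpace Y]

lemma HomotopicAlong.comp_right {T : Set P} {T' : Set P'} {p : I → X} {γ₀ γ₁ : C(P', X)}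
    (h : HomotopicAlong T' p γ₀ γ₁) (φ : C(P, P')) (hφ : MapsTo φ T T') :
    HomotopicAlong T p (γ₀.comp φ) (γ₁.comp φ) := by
  obtain ⟨H, h₀, h₁, h₂⟩ := h
  exact ⟨H.comp ⟨fun q ↦ (φ q.1, q.2), by fun_prop⟩, by simp [h₀], by simp [h₁],
    fun q hq t ↦ h₂ _ (hφ hq) t⟩

lemma PiSurjective.of_homeomorph {T : Set P} {T' : Set P'} {f : C(X, Y)} {x : X}
    (h : PiSurjective T' f x) (e : P ≃ₜ P') (he : ∀ p, p ∈ T ↔ e p ∈ T') :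
    PiSurjective T f x := by
  intro γ hγ
  obtain ⟨γ', hγ', H⟩ := h (γ.comp (e.symm : C(P', P))) (fun q hq ↦ hγ _ ((he _).2 (by simpa)))
  refine ⟨γ'.comp (e : C(P, P')), fun q hq ↦ hγ' _ ((he _).1 hq), ?_⟩
  convert! H.comp_right (e : C(P, P')) (fun p hp ↦ (he _).1 hp)
  ext; simp

lemma PiInjective.of_homeomorph {T : Set P} {T' : Set P'} {f : C(X, Y)} {x : X}
    (h : PiInjective T' f x) (e : P ≃ₜ P') (he : ∀ p, p ∈ T ↔ e p ∈ T') :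
    PiInjective T f x := by
  intro γ₀ γ₁ hγ₀ hγ₁ H
  have := h (γ₀.comp (e.symm : C(P', P))) (γ₁.comp (e.symm : C(P', P)))
    (fun q hq ↦ hγ₀ _ ((he _).2 (by simpa))) (fun q hq ↦ hγ₁ _ ((he _).2 (by simpa)))
    (H.comp_right (e.symm : C(P', P)) (fun q hq ↦ (he _).2 (by simpa)))
  convert! this.comp_right (e : C(P, P')) (fun p hp ↦ (he _).1 hp) <;> ext <;> simp

lemma homotopicAlong_const_iff {T : Set P} {x : X} {γ₀ γ₁ : C(P, X)}
    (h : ∀ q ∈ T, γ₀ q = x) :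
    HomotopicAlong T (fun _ ↦ x) γ₀ γ₁ ↔ γ₀.HomotopicRel γ₁ T := by
  constructor
  · rintro ⟨H, h₀, h₁, h₂⟩
    exact ⟨⟨⟨H.comp ⟨Prod.swap, by fun_prop⟩, h₀, h₁⟩, fun t q hq ↦ (h₂ q hq t).trans (h q hq).symm⟩⟩
  · rintro ⟨H⟩
    exact ⟨H.toContinuousMap.comp ⟨Prod.swap, by fun_prop⟩, fun q ↦ H.apply_zero q,
      fun q ↦ H.apply_one q, fun q hq t ↦ (H.eq_fst t hq).trans (h q hq)⟩

/-- A strong deformation retract induces bijections on homotopy classes. -/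
lemma PiInjective.of_retraction {T : Set P} {f : C(X, Y)} {r : C(Y, X)} (hr : ∀ x, r (f x) = x)
    (x : X) : PiInjective T f x := by
  intro γ₀ γ₁ _ _ H
  have := H.map r
  convert! this
  · simp [hr]
  · ext; simp [hr]
  · ext; simp [hr]

/-- The map `r ∘ γ` serves as preimage: the deformation run backwards joins its image to `γ`, and it
does not move the points of `f`. -/
lemma PiSurjective.of_deformationRetraction {T : Set P} {f : C(X, Y)} {r : C(Y, X)}
    (hr : ∀ x, r (f x) = x) {h : C(Y × I, Y)} (h0 : ∀ y, h (y, 0) = y)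
    (h1 : ∀ y, h (y, 1) = f (r y)) (hf : ∀ x t, h (f x, t) = f x) (x : X) :
    PiSurjective T f x := by
  intro γ hγ
  refine ⟨r.comp γ, fun q hq ↦ by simp [hγ q hq, hr],
    h.comp ⟨fun q ↦ (γ q.1, unitInterval.symm q.2), by fun_prop⟩, fun q ↦ by simp [h1],
    fun q ↦ by simp [h0], fun q hq t ↦ by simp [hγ q hq, hf]⟩

end

section BasePoint

variable {E : Type*} [NormedAddCommGroup E] [NormedSpace ℝ E]
  {X Y : Type*} [TopologicalSpace X] [TopologicalSpace Y]

/-- The homotopy extension property for the inclusion of the boundary of the cylinder. -/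
lemma exists_extension_cylinder (a : (UnitBall E × I) × I → X)
    (ha : ContinuousOn a {p | p.2 = 0 ∨ p.1 ∈ cylinderBoundary E}) :
    ∃ c : C((UnitBall E × I) × I, X), EqOn c a {p | p.2 = 0 ∨ p.1 ∈ cylinderBoundary E} := by
  let e := cylinderHomeomorph E
  have he (p : UnitBall (E × ℝ) × I) (hp : p ∈ cylinderBox (E × ℝ)) :
      (e.symm p.1, p.2) ∈ {p : (UnitBall E × I) × I | p.2 = 0 ∨ p.1 ∈ cylinderBoundary E} :=
    hp.imp id fun h ↦ (cylinderHomeomorph_mem_ballBoundary _).2 (by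
      rw [Homeomorph.apply_symm_apply]; exact h)
  obtain ⟨c, hc⟩ := exists_extension_box (E := E × ℝ) (fun p ↦ a (e.symm p.1, p.2))
    (ha.comp (by fun_prop) he)
  refine ⟨c.comp ⟨fun p ↦ (e p.1, p.2), by fun_prop⟩, fun p hp ↦ ?_⟩
  have : (e p.1, p.2) ∈ cylinderBox (E × ℝ) :=
    hp.imp id fun h ↦ (cylinderHomeomorph_mem_ballBoundary _).1 h
  exact (hc this).trans (by simp)

/-- Transport of a class along the path `p` of base points, by homotopy extension. -/
lemma exists_homotopicAlong {p : I → X} (hp : Continuous p) (γ : C(UnitBall E, X))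
    (hγ : ∀ q ∈ ballBoundary E, γ q = p 0) :
    ∃ γ' : C(UnitBall E, X), (∀ q ∈ ballBoundary E, γ' q = p 1) ∧
      HomotopicAlong (ballBoundary E) p γ γ' := by
  obtain ⟨a, h₁, h₂, h₃⟩ := exists_glue_box isClosed_ballBoundary (s := fun q ↦ p q.2)
    γ.continuous (by fun_prop) hγ
  obtain ⟨c, hc⟩ := exists_extension_box a h₃
  exact ⟨c.comp ⟨fun q ↦ (q, 1), by fun_prop⟩,
    fun q hq ↦ (hc (x := (q, 1)) (Or.inr hq)).trans (h₂ q hq 1),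
    c, fun q ↦ (hc (Or.inl rfl)).trans (h₁ q), fun q ↦ rfl,
    fun q hq t ↦ (hc (x := (q, t)) (Or.inr hq)).trans (h₂ q hq t)⟩

/-- Transport respects homotopy: the given homotopies are faces of a prism, and homotopy extension
fills it and produces the remaining face. -/
lemma HomotopicAlong.of_homotopic {p : I → X} (hp : Continuous p) {γ₀ γ₁ γ₀' γ₁' : C(UnitBall E, X)}
    (h : HomotopicAlong (ballBoundary E) p γ₀ γ₁) (h' : HomotopicAlong (ballBoundary E) p γ₀' γ₁')
    (h₀ : HomotopicAlong (ballBoundary E) (fun _ ↦ p 0) γ₀ γ₀') :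
    HomotopicAlong (ballBoundary E) (fun _ ↦ p 1) γ₁ γ₁' := by
  obtain ⟨H, H0, H1, HS⟩ := h
  obtain ⟨H', H0', H1', HS'⟩ := h'
  obtain ⟨G, G0, G1, GS⟩ := h₀
  obtain ⟨a', a0, a1, aS, ha'⟩ := exists_glue_boundary (P := UnitBall E × I)
    (T := {q | q.1 ∈ ballBoundary E}) (isClosed_ballBoundary.preimage continuous_fst)
    (s := fun q ↦ p q.1.2) H.continuous H'.continuous (by fun_prop)
    (fun q hq ↦ HS _ hq _) (fun q hq ↦ HS' _ hq _)
  -- In `a'` the middle coordinate runs along `p` and the last one separates the two transports;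
  -- they are exchanged here so that `G` becomes the bottom face.
  obtain ⟨a, h₁, h₂, h₃⟩ := exists_glue_box (isClosed_cylinderBoundary (E := E))
    (s := fun q ↦ a' ((q.1.1, q.2), q.1.2)) G.continuous
    (ha'.comp (Continuous.continuousOn (by fun_prop)) fun q hq ↦ hq) (by
      rintro ⟨q, s⟩ (hq | hq | hq)
      · obtain rfl : s = 0 := hq
        rw [a0, G0, H0]
      · obtain rfl : s = 1 := hq
        rw [a1, G1, H0']
      · exact (GS q hq s).trans (aS (q, 0) hq s).symm)
  obtain ⟨c, hc⟩ := exists_extension_cylinder a h₃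
  have hc' (q s) (hq : (q, s) ∈ cylinderBoundary E) : c ((q, s), 1) = a' ((q, 1), s) :=
    (hc (Or.inr hq)).trans (h₂ _ hq 1)
  refine ⟨c.comp ⟨fun q ↦ (q, 1), by fun_prop⟩, fun q ↦ ?_, fun q ↦ ?_, fun q hq t ↦ ?_⟩
  · exact (hc' q 0 (Or.inl rfl)).trans ((a0 _).trans (H1 q))
  · exact (hc' q 1 (Or.inr (Or.inl rfl))).trans ((a1 _).trans (H1' q))
  · exact (hc' q t (Or.inr (Or.inr hq))).trans (aS (q, 1) hq t)

variable {g : C(X, Y)} {p : I → X}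

/-- Both maps are moved back to `p 0`, where the hypothesis applies, and the homotopy found there is
moved forward again. The image under `g` of a transport along a path is a transport along the image
path. -/
lemma PiInjective.of_path (hp : Continuous p) (h : PiInjective (ballBoundary E) g (p 0)) :
    PiInjective (ballBoundary E) g (p 1) := by
  intro γ₀ γ₁ hγ₀ hγ₁ H
  have hp' : Continuous (p ∘ unitInterval.symm) := by fun_prop
  obtain ⟨β₀, hβ₀, A₀⟩ := exists_homotopicAlong hp' γ₀ (by simpa using hγ₀)
  obtain ⟨β₁, hβ₁, A₁⟩ := exists_homotopicAlong hp' γ₁ (by simpa using hγ₁)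
  have := (A₀.map g).of_homotopic (by fun_prop) (A₁.map g) (by simpa using H)
  have := h β₀ β₁ (by simpa using hβ₀) (by simpa using hβ₁) (by simpa using this)
  have hpp : (p ∘ unitInterval.symm) ∘ unitInterval.symm = p := by ext; simp
  have B₀ := A₀.symm
  have B₁ := A₁.symm
  rw [hpp] at B₀ B₁
  exact B₀.of_homotopic hp B₁ this

lemma PiSurjective.of_path (hp : Continuous p) (h : PiSurjective (ballBoundary E) g (p 0)) :
    PiSurjective (ballBoundary E) g (p 1) := by
  intro γ hγ
  have hp' : Continuous ((g ∘ p) ∘ unitInterval.symm) := by fun_prop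
  obtain ⟨δ, hδ, A⟩ := exists_homotopicAlong hp' γ (by simpa using hγ)
  obtain ⟨γ', hγ', H⟩ := h δ (by simpa using hδ)
  obtain ⟨β, hβ, B⟩ := exists_homotopicAlong hp γ' hγ'
  have hpp : ((g ∘ p) ∘ unitInterval.symm) ∘ unitInterval.symm = g ∘ p := by ext; simp
  have A' := A.symm
  rw [hpp] at A'
  exact ⟨β, hβ, (B.map g).of_homotopic (by fun_prop) A' H⟩

end BasePoint

section HomotopyGroups

/-- The standard cube is homeomorphic to the unit ball for the sup norm. -/
noncomputable def cubeHomeomorph (n : ℕ) : (Fin n → I) ≃ₜ UnitBall (Fin n → ℝ) where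
  toFun q := ⟨fun i ↦ 2 * q i - 1, by
    rw [mem_closedBall_zero_iff, pi_norm_le_iff_of_nonneg zero_le_one]
    intro i
    have h1 := (q i).2.1
    have h2 := (q i).2.2
    rw [Real.norm_eq_abs, abs_le]
    constructor <;> linarith⟩
  invFun q i := ⟨(q.1 i + 1) / 2, by
    have := (norm_le_pi_norm _ i).trans (norm_unitBall_le q)
    rw [Real.norm_eq_abs, abs_le] at this
    constructor <;> linarith⟩
  left_inv q := by ext; simp
  right_inv q := by ext; simp only; ring
  continuous_toFun := by fun_prop
  continuous_invFun := continuous_pi fun i ↦ Continuous.subtype_mk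
    ((((continuous_apply i).comp continuous_subtype_val).add continuous_const).div_const _) _

lemma cubeHomeomorph_mem_ballBoundary (n : ℕ) (q : Fin n → I) :
    q ∈ Cube.boundary (Fin n) ↔ cubeHomeomorph n q ∈ ballBoundary (Fin n → ℝ) := by
  have h (i : Fin n) : ‖(2 : ℝ) * q i - 1‖ = 1 ↔ q i = 0 ∨ q i = 1 := by
    rw [Real.norm_eq_abs, abs_eq zero_le_one, or_comm, Subtype.ext_iff, Subtype.ext_iff,
      Icc.coe_zero, Icc.coe_one]
    constructor <;> rintro (h | h)
    exacts [Or.inl (by linarith), Or.inr (by linarith), Or.inl (by linarith),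
      Or.inr (by linarith)]
  constructor
  · rintro ⟨i, hi⟩
    exact le_antisymm (norm_unitBall_le _) (((h i).2 hi).symm.le.trans
      (norm_le_pi_norm (cubeHomeomorph n q : Fin n → ℝ) i))
  · intro hq
    by_contra hq'
    have : ‖(cubeHomeomorph n q : Fin n → ℝ)‖ < 1 := by
      rw [pi_norm_lt_iff zero_lt_one]
      intro i
      refine lt_of_le_of_ne ((norm_le_pi_norm _ i).trans (norm_unitBall_le _)) fun hi ↦ hq' ?_
      exact ⟨i, (h i).1 hi⟩
    exact this.ne hq

variable {X Y : Type u} [TopologicalSpace X] [TopologicalSpace Y] (f : C(X, Y))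

lemma bijective_homotopyGroupMap_iff (n : ℕ) (x : X) :
    Function.Bijective (homotopyGroupMap f n x) ↔
      PiInjective (ballBoundary (Fin n → ℝ)) f x ∧
        PiSurjective (ballBoundary (Fin n → ℝ)) f x := by
  have h₁ : Function.Injective (homotopyGroupMap f n x) ↔
      PiInjective (Cube.boundary (Fin n)) f x := by
    constructor
    · intro h γ₀ γ₁ hγ₀ hγ₁ H
      rw [homotopicAlong_const_iff (γ₀ := f.comp γ₀) (fun q hq ↦ congrArg f (hγ₀ q hq))] at H
      rw [homotopicAlong_const_iff hγ₀]
      exact Quotient.exact (h (a₁ := Quotient.mk _ ⟨γ₀, hγ₀⟩) (a₂ := Quotient.mk _ ⟨γ₁, hγ₁⟩)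
        (Quotient.sound H))
    · rintro h ⟨γ₀, hγ₀⟩ ⟨γ₁, hγ₁⟩ H
      have H' : (f.comp γ₀).HomotopicRel (f.comp γ₁) (Cube.boundary (Fin n)) := Quotient.exact H
      rw [← homotopicAlong_const_iff (γ₀ := f.comp γ₀) (fun q hq ↦ congrArg f (hγ₀ q hq))] at H'
      exact Quotient.sound ((homotopicAlong_const_iff hγ₀).1 (h _ _ hγ₀ hγ₁ H'))
  have h₂ : Function.Surjective (homotopyGroupMap f n x) ↔
      PiSurjective (Cube.boundary (Fin n)) f x := by
    constructor
    · intro h γ hγ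
      obtain ⟨⟨γ', hγ'⟩, H⟩ := h (Quotient.mk _ ⟨γ, hγ⟩)
      have H' : (f.comp γ').HomotopicRel γ (Cube.boundary (Fin n)) := Quotient.exact H
      exact ⟨γ', hγ', (homotopicAlong_const_iff (γ₀ := f.comp γ') (fun q hq ↦ congrArg f (hγ' q hq))).2 H'⟩
    · rintro h ⟨γ, hγ⟩
      obtain ⟨γ', hγ', H⟩ := h γ hγ
      refine ⟨Quotient.mk _ ⟨γ', hγ'⟩, Quotient.sound ?_⟩
      exact (homotopicAlong_const_iff (γ₀ := f.comp γ') (fun q hq ↦ congrArg f (hγ' q hq))).1 H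
  have he (p) : p ∈ ballBoundary (Fin n → ℝ) ↔
      (cubeHomeomorph n).symm p ∈ Cube.boundary (Fin n) := by
    rw [cubeHomeomorph_mem_ballBoundary]; simp
  rw [Function.Bijective, h₁, h₂]
  exact and_congr ⟨fun h ↦ h.of_homeomorph (cubeHomeomorph n).symm he,
    fun h ↦ h.of_homeomorph _ (cubeHomeomorph_mem_ballBoundary n)⟩
    ⟨fun h ↦ h.of_homeomorph (cubeHomeomorph n).symm he,
    fun h ↦ h.of_homeomorph _ (cubeHomeomorph_mem_ballBoundary n)⟩

lemma surjective_zerothHomotopyMap_iff :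
    Function.Surjective (zerothHomotopyMap f) ↔ ∀ y, ∃ x, Joined (f x) y := by
  constructor
  · intro h y
    obtain ⟨⟨x⟩, hx⟩ := h (Quotient.mk _ y)
    exact ⟨x, Quotient.exact hx⟩
  · rintro h ⟨y⟩
    obtain ⟨x, hx⟩ := h y
    exact ⟨Quotient.mk _ x, Quotient.sound hx⟩

lemma injective_zerothHomotopyMap_iff :
    Function.Injective (zerothHomotopyMap f) ↔ ∀ x x', Joined (f x) (f x') → Joined x x' := by
  constructor
  · intro h x x' hx
    exact Quotient.exact (h (a₁ := Quotient.mk _ x) (a₂ := Quotient.mk _ x') (Quotient.sound hx))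
  · rintro h ⟨x⟩ ⟨x'⟩ hx
    exact Quotient.sound (h x x' (Quotient.exact hx))

lemma notMem_ballBoundary_zero (q : UnitBall (Fin 0 → ℝ)) : q ∉ ballBoundary (Fin 0 → ℝ) := fun hq ↦ by
  have h : ‖(q : Fin 0 → ℝ)‖ = 1 := hq
  rw [Subsingleton.elim (q : Fin 0 → ℝ) 0, norm_zero] at h
  exact zero_ne_one h

lemma joined_iff_homotopicAlong {Z : Type*} [TopologicalSpace Z] (γ₀ γ₁ : C(UnitBall (Fin 0 → ℝ), Z))
    (p : I → Z) :
    HomotopicAlong (ballBoundary (Fin 0 → ℝ)) p γ₀ γ₁ ↔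
      Joined (γ₀ ⟨0, by simp⟩) (γ₁ ⟨0, by simp⟩) := by
  constructor
  · rintro ⟨H, h₀, h₁, -⟩
    exact ⟨⟨⟨fun t ↦ H (⟨0, by simp⟩, t), by fun_prop⟩, h₀ _, h₁ _⟩⟩
  · rintro ⟨c⟩
    have (q : UnitBall (Fin 0 → ℝ)) : q = ⟨0, by simp⟩ := Subtype.ext (Subsingleton.elim _ _)
    refine ⟨⟨fun q ↦ c q.2, by fun_prop⟩, fun q ↦ ?_, fun q ↦ ?_, fun q hq ↦ ?_⟩
    · rw [this q]; exact c.source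
    · rw [this q]; exact c.target
    · exact (notMem_ballBoundary_zero q hq).elim

/-- In degree `0` the ball is a point with empty boundary, so the base point plays no role. -/
lemma piInjective_zero_iff :
    (∀ x, PiInjective (ballBoundary (Fin 0 → ℝ)) f x) ↔
      ∀ x x', Joined (f x) (f x') → Joined x x' := by
  constructor
  · intro h x x' hx
    exact (joined_iff_homotopicAlong _ _ _).1 (h x (ContinuousMap.const _ x)
      (ContinuousMap.const _ x') (fun q hq ↦ (notMem_ballBoundary_zero q hq).elim) (fun q hq ↦ (notMem_ballBoundary_zero q hq).elim)
      ((joined_iff_homotopicAlong _ _ _).2 hx))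
  · intro h x γ₀ γ₁ _ _ H
    exact (joined_iff_homotopicAlong _ _ _).2 (h _ _ ((joined_iff_homotopicAlong _ _ _).1 H))

/-- The conditions are regrouped: injectivity in degree `n` goes with surjectivity in degree `n +
1`, the pair that is needed for lifting against the boundary of the disk of dimension `n + 1`. -/
lemma weakHomotopyEquivalences_iff {X Y : TopCat.{u}} (f : X ⟶ Y) :
    weakHomotopyEquivalences f ↔ (∀ y, ∃ x, Joined (f.hom x) y) ∧
      ∀ (n : ℕ) (x : X), PiInjective (ballBoundary (Fin n → ℝ)) f.hom x ∧
        PiSurjective (ballBoundary (Fin (n + 1) → ℝ)) f.hom x := by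
  simp only [weakHomotopyEquivalences, Function.Bijective.eq_1 (zerothHomotopyMap f.hom),
    surjective_zerothHomotopyMap_iff, injective_zerothHomotopyMap_iff,
    bijective_homotopyGroupMap_iff, ← piInjective_zero_iff]
  constructor
  · rintro ⟨⟨h₀, h₁⟩, h₂⟩
    refine ⟨h₁, fun n x ↦ ⟨?_, (h₂ n x).2⟩⟩
    rcases n with _ | n
    exacts [h₀ x, (h₂ n x).1]
  · rintro ⟨h₁, h₂⟩
    exact ⟨⟨fun x ↦ (h₂ 0 x).1, h₁⟩, fun n x ↦ ⟨(h₂ (n + 1) x).1, (h₂ n x).2⟩⟩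

end HomotopyGroups

end WeakEquivalences

/-! ### Two-out-of-three, Serre fibrations and the lifting property of acyclic fibrations. -/

section SerreFibrations

open Metric Set Topology unitInterval

lemma homotopyGroupMap_comp {X Y Z : Type u} [TopologicalSpace X] [TopologicalSpace Y]
    [TopologicalSpace Z] (f : C(X, Y)) (g : C(Y, Z)) (n : ℕ) (x : X) :
    homotopyGroupMap (g.comp f) n x = homotopyGroupMap g n (f x) ∘ homotopyGroupMap f n x := by
  ext ⟨γ⟩; rfl

lemma zerothHomotopyMap_comp {X Y Z : Type u} [TopologicalSpace X] [TopologicalSpace Y]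
    [TopologicalSpace Z] (f : C(X, Y)) (g : C(Y, Z)) :
    zerothHomotopyMap (g.comp f) = zerothHomotopyMap g ∘ zerothHomotopyMap f := by
  ext ⟨γ⟩; rfl

lemma bijective_homotopyGroupMap_of_joined {X Y : Type u} [TopologicalSpace X] [TopologicalSpace Y]
    (g : C(X, Y)) (n : ℕ) {x x' : X} (h : Joined x x')
    (hx : Function.Bijective (homotopyGroupMap g n x)) :
    Function.Bijective (homotopyGroupMap g n x') := by
  obtain ⟨p⟩ := h
  rw [bijective_homotopyGroupMap_iff] at hx ⊢
  have h₁ := PiInjective.of_path (g := g) p.continuous (by simpa using hx.1)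
  have h₂ := PiSurjective.of_path (g := g) p.continuous (by simpa using hx.2)
  simp only [p.target] at h₁ h₂
  exact ⟨h₁, h₂⟩

instance : weakHomotopyEquivalences.{u}.HasTwoOutOfThreeProperty where
  comp_mem f g hf hg := by
    refine ⟨?_, fun n x ↦ ?_⟩
    · rw [TopCat.hom_comp, zerothHomotopyMap_comp]
      exact hg.1.comp hf.1
    · rw [TopCat.hom_comp, homotopyGroupMap_comp]
      exact (hg.2 _ _).comp (hf.2 _ _)
  of_postcomp f g hg hfg := by
    refine ⟨?_, fun n x ↦ ?_⟩
    · have := hfg.1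
      rw [TopCat.hom_comp, zerothHomotopyMap_comp] at this
      exact (Function.Bijective.of_comp_iff' hg.1 _).1 this
    · have := hfg.2 n x
      rw [TopCat.hom_comp, homotopyGroupMap_comp] at this
      exact (Function.Bijective.of_comp_iff' (hg.2 n _) _).1 this
  of_precomp f g hf hfg := by
    refine ⟨?_, fun n y ↦ ?_⟩
    · have := hfg.1
      rw [TopCat.hom_comp, zerothHomotopyMap_comp] at this
      exact (Function.Bijective.of_comp_iff _ hf.1).1 this
    · obtain ⟨x, hx⟩ := (surjective_zerothHomotopyMap_iff _).1 hf.1.2 y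
      refine bijective_homotopyGroupMap_of_joined _ _ hx ?_
      have := hfg.2 n x
      rw [TopCat.hom_comp, homotopyGroupMap_comp] at this
      exact (Function.Bijective.of_comp_iff _ (hf.2 n x)).1 this

/-- Inclusions of strong deformation retracts are weak homotopy equivalences. -/
lemma weakHomotopyEquivalences_of_deformationRetraction {X Y : TopCat.{u}} (f : X ⟶ Y) (r : Y ⟶ X)
    (hr : f ≫ r = 𝟙 X) (h : C(Y × I, Y)) (h0 : ∀ y, h (y, 0) = y)
    (h1 : ∀ y, h (y, 1) = f (r y)) (hf : ∀ x t, h (f x, t) = f x) :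
    weakHomotopyEquivalences f := by
  have hr' (x : X) : r.hom (f.hom x) = x := congr($hr x)
  refine (weakHomotopyEquivalences_iff f).2 ⟨fun y ↦ ⟨r y, ?_⟩, fun n x ↦
    ⟨PiInjective.of_retraction hr' x, PiSurjective.of_deformationRetraction hr' h0 h1 hf x⟩⟩
  exact Joined.symm ⟨⟨⟨fun t ↦ h (y, t), by fun_prop⟩, h0 y, h1 y⟩⟩

section

variable {X Y : TopCat.{u}} (f : X ⟶ Y)

lemma liftsPair_of_hasLiftingProperty {A B : TopCat.{u}} {i : A ⟶ B} (hi : IsEmbedding i)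
    (h : HasLiftingProperty i f) : LiftsPair (range i) f.hom := by
  intro b a ha hab
  have sq : CommSq (TopCat.ofHom ⟨a ∘ i, ha.comp_continuous hi.continuous mem_range_self⟩) i f
    (TopCat.ofHom b) := ⟨by ext x; exact hab _ (mem_range_self x)⟩
  refine ⟨sq.lift.hom, fun p ↦ congr($(sq.fac_right) p), ?_⟩
  rintro _ ⟨x, rfl⟩
  exact congr($(sq.fac_left) x)

lemma LiftsPair.hasLiftingProperty {A B : TopCat.{u}} [Nonempty A] {i : A ⟶ B} (hi : IsEmbedding i)
    (h : LiftsPair (range i) f.hom) : HasLiftingProperty i f := by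
  refine ⟨fun {t b} sq ↦ ?_⟩
  classical
  -- The values off the image are irrelevant; nonemptiness of `A` provides some.
  let a : B → X := Function.extend i t (fun _ ↦ t (Classical.arbitrary A))
  have hai (p : A) : a (i p) = t p := hi.injective.extend_apply _ _ _
  obtain ⟨c, hc, hc'⟩ := h b.hom a (by
    rw [continuousOn_iff_continuous_domRestrict]
    have : (range i).domRestrict a ∘ (hi.toHomeomorph) = t := by
      ext p; exact hai p
    rw [← hi.toHomeomorph.comp_continuous_iff', this]
    exact t.hom.continuous) (by
    rintro _ ⟨p, rfl⟩
    rw [hai]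
    exact congr($(sq.w) p))
  exact ⟨⟨{ l := TopCat.ofHom c
            fac_left := by ext p; exact (hc' (mem_range_self p)).trans (hai p)
            fac_right := by ext p; exact hc p }⟩⟩

/-- The homeomorphism between the disk and the unit ball of the euclidean space. -/
def diskHomeomorph (n : ℕ) : TopCat.disk.{u} n ≃ₜ UnitBall (EuclideanSpace ℝ (Fin n)) :=
  Homeomorph.ulift

lemma isEmbedding_diskBoundaryInclusion (n : ℕ) :
    IsEmbedding (TopCat.diskBoundaryInclusion.{u} n) := by
  have h : IsEmbedding (diskHomeomorph.{u} n ∘ TopCat.diskBoundaryInclusion.{u} n) :=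
    (IsEmbedding.inclusion sphere_subset_closedBall).comp Homeomorph.ulift.isEmbedding
  exact (diskHomeomorph n).isEmbedding.of_comp_iff.1 h

lemma isEmbedding_diskCylinderInclusion (n : ℕ) :
    IsEmbedding (diskCylinderInclusion.{u} n) :=
  IsEmbedding.id.prodMap IsEmbedding.subtypeVal

lemma mem_range_diskBoundaryInclusion (n : ℕ) (p : TopCat.disk.{u} n) :
    p ∈ range (TopCat.diskBoundaryInclusion.{u} n) ↔
      diskHomeomorph n p ∈ ballBoundary (EuclideanSpace ℝ (Fin n)) := by
  constructor
  · rintro ⟨⟨⟨q, hq⟩⟩, rfl⟩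
    exact mem_sphere_zero_iff_norm.1 hq
  · intro hp
    exact ⟨⟨⟨(diskHomeomorph n p).1, mem_sphere_zero_iff_norm.2 hp⟩⟩, rfl⟩

lemma mem_range_diskCylinderInclusion (n : ℕ) (p : TopCat.disk.{u} n × I) :
    p ∈ range (diskCylinderInclusion.{u} n) ↔ p.2 = 0 := by
  constructor
  · rintro ⟨⟨q, t, ht⟩, rfl⟩
    exact ht
  · rintro hp
    exact ⟨(p.1, ⟨p.2, hp⟩), rfl⟩

lemma isEmpty_diskBoundary_zero : IsEmpty (TopCat.diskBoundary.{u} 0) :=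
  ⟨fun ⟨q, hq⟩ ↦ by
    rw [Subsingleton.elim q 0, mem_sphere_zero_iff_norm, norm_zero] at hq
    exact zero_ne_one hq⟩

instance (n : ℕ) : Nonempty (TopCat.diskBoundary.{u} (n + 1)) :=
  ⟨⟨EuclideanSpace.single 0 1, by simp⟩⟩

instance (n : ℕ) : Inhabited (TopCat.disk.{u} n) := ⟨⟨⟨0, by simp⟩⟩⟩

/-- The boundary of the disk of dimension `0` is empty, so a lifting problem is just a point of `Y`.
-/
lemma surjective_of_hasLiftingProperty
    (h : HasLiftingProperty (TopCat.diskBoundaryInclusion.{u} 0) f) : Function.Surjective f := by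
  intro y
  have : IsEmpty _ := isEmpty_diskBoundary_zero.{u}
  let t : TopCat.diskBoundary.{u} 0 ⟶ X :=
    TopCat.ofHom ⟨fun p ↦ isEmptyElim p, continuous_of_const fun p ↦ isEmptyElim p⟩
  let b : TopCat.disk.{u} 0 ⟶ Y := TopCat.ofHom (ContinuousMap.const _ y)
  have sq : CommSq t (TopCat.diskBoundaryInclusion.{u} 0) f b := ⟨by ext p; exact isEmptyElim p⟩
  exact ⟨sq.lift default, congr($(sq.fac_right) default)⟩

lemma hasLiftingProperty_of_surjective (h : Function.Surjective f) :
    HasLiftingProperty (TopCat.diskBoundaryInclusion.{u} 0) f := by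
  have : IsEmpty _ := isEmpty_diskBoundary_zero.{u}
  refine ⟨fun {t b} sq ↦ ?_⟩
  obtain ⟨x, hx⟩ := h (b default)
  exact ⟨⟨{ l := TopCat.ofHom (ContinuousMap.const _ x)
            fac_left := by ext p; exact isEmptyElim p
            fac_right := by
              ext p
              refine hx.trans (congrArg b ?_)
              exact (diskHomeomorph 0).injective (Subtype.ext (Subsingleton.elim _ _)) }⟩⟩

lemma serreFibrations_iff : serreFibrations f ↔
    ∀ n, LiftsPair {p : UnitBall (EuclideanSpace ℝ (Fin n)) × I | p.2 = 0} f.hom := by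
  have he (n : ℕ) (p : TopCat.disk.{u} n × I) : p ∈ range (diskCylinderInclusion.{u} n) ↔
    (diskHomeomorph.{u} n).prodCongr (Homeomorph.refl I) p ∈
      {p : UnitBall (EuclideanSpace ℝ (Fin n)) × I | p.2 = 0} :=
    mem_range_diskCylinderInclusion n p
  constructor
  · intro h n
    exact (liftsPair_of_hasLiftingProperty f (isEmbedding_diskCylinderInclusion n) (h _ ⟨n⟩)).of_homeomorph
      ((diskHomeomorph.{u} n).prodCongr (Homeomorph.refl I)).symm
      (fun p ↦ by rw [he]; simp)
  · rintro h _ _ _ ⟨n⟩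
    have : Nonempty (TopCat.of (TopCat.disk.{u} n × ({0} : Set I))) := ⟨(default, ⟨0, rfl⟩)⟩
    exact ((h n).of_homeomorph _ (he n)).hasLiftingProperty f (isEmbedding_diskCylinderInclusion n)

variable {f}

/-- In finite dimension the choice of norm does not matter, so the Euclidean disks control all
balls, including those of `E × ℝ`. -/
lemma liftsPair_ballBoundary
    (h : (MorphismProperty.ofHoms (fun n ↦ TopCat.diskBoundaryInclusion.{u} n)).rlp f)
    (E : Type*) [NormedAddCommGroup E] [NormedSpace ℝ E] [FiniteDimensional ℝ E] :
    LiftsPair (ballBoundary E) f.hom := by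
  let n := Module.finrank ℝ E
  obtain ⟨e, he⟩ := exists_unitBall_homeomorph (E := E) (F := EuclideanSpace ℝ (Fin n)) (by simp [n])
  have h' := liftsPair_of_hasLiftingProperty f (isEmbedding_diskBoundaryInclusion n) (h _ ⟨n⟩)
  exact (h'.of_homeomorph (diskHomeomorph.{u} n).symm
    (fun p ↦ by rw [mem_range_diskBoundaryInclusion]; simp)).of_homeomorph e he

lemma serreFibrations.liftsPair (h : serreFibrations f)
    (E : Type*) [NormedAddCommGroup E] [NormedSpace ℝ E] [FiniteDimensional ℝ E] :
    LiftsPair {p : UnitBall E × I | p.2 = 0} f.hom := by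
  let n := Module.finrank ℝ E
  obtain ⟨e, he⟩ := exists_unitBall_homeomorph (E := E) (F := EuclideanSpace ℝ (Fin n)) (by simp [n])
  exact ((serreFibrations_iff f).1 h n).of_homeomorph (e.prodCongr (Homeomorph.refl I))
    (fun p ↦ Iff.rfl)

/-- The maps having the right lifting property with respect to the inclusions of spheres in disks
are the Serre fibrations that are weak homotopy equivalences. -/
theorem rlp_diskBoundaryInclusion_iff :
    (MorphismProperty.ofHoms (fun n ↦ TopCat.diskBoundaryInclusion.{u} n)).rlp f ↔
      weakHomotopyEquivalences f ∧ serreFibrations f := by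
  constructor
  · intro h
    have hL (E : Type) [NormedAddCommGroup E] [NormedSpace ℝ E] [FiniteDimensional ℝ E] :=
      liftsPair_ballBoundary h E
    refine ⟨(weakHomotopyEquivalences_iff f).2 ⟨fun y ↦ ?_, fun n x ↦ ⟨?_, ?_⟩⟩,
      (serreFibrations_iff f).2 fun n ↦ (hL _).of_ballBoundary (hL _)⟩
    · obtain ⟨x, rfl⟩ := surjective_of_hasLiftingProperty f (h _ ⟨0⟩) y
      exact ⟨x, Joined.refl _⟩
    · exact (hL _).cylinderBoundary.piInjective isClosed_ballBoundary x
    · exact (hL _).piSurjective x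
  · rintro ⟨hw, hf⟩ _ _ _ ⟨_ | n⟩
    · refine hasLiftingProperty_of_surjective f fun y ↦ ?_
      -- Weak equivalence reaches `y` only up to a path; lifting this path from `x` ends at a point
      -- over `y` itself.
      obtain ⟨x, ⟨c⟩⟩ := ((weakHomotopyEquivalences_iff f).1 hw).1 y
      obtain ⟨l, hl, -⟩ := hf.liftsPair ℝ (c.toContinuousMap.comp ⟨Prod.snd, by fun_prop⟩)
        (fun _ ↦ x) continuousOn_const (by
          rintro ⟨q, t⟩ ht
          obtain rfl : t = 0 := ht
          exact c.source.symm)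
      exact ⟨l (⟨0, by simp⟩, 1), (hl _).trans c.target⟩
    · have hbox (E : Type) [NormedAddCommGroup E] [NormedSpace ℝ E] [FiniteDimensional ℝ E] :
          LiftsPair (cylinderBox E) f.hom := (hf.liftsPair (E × ℝ)).cylinderBox
      obtain ⟨e, he⟩ := exists_unitBall_homeomorph (E := (Fin n → ℝ) × ℝ)
        (F := Fin (n + 1) → ℝ) (by simp)
      obtain ⟨e', he'⟩ := exists_unitBall_homeomorph (E := EuclideanSpace ℝ (Fin (n + 1)))
        (F := (Fin n → ℝ) × ℝ) (by simp)
      have hw' := ((weakHomotopyEquivalences_iff f).1 hw).2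
      -- The disk of dimension `n + 1` is treated as the cylinder on a ball of dimension `n`.
      have key : LiftsPair (cylinderBoundary (Fin n → ℝ)) f.hom := by
        refine liftsPair_cylinderBoundary_of_piBijective (hbox _) ?_ (fun x ↦ (hw' n x).1)
          (fun x ↦ ?_)
        · exact (hbox ((Fin n → ℝ) × ℝ)).of_homeomorph
            ((cylinderHomeomorph _).prodCongr (Homeomorph.refl I))
            (fun p ↦ or_congr Iff.rfl (cylinderHomeomorph_mem_ballBoundary _))
        · exact ((hw' n x).2.of_homeomorph e he).of_homeomorph (cylinderHomeomorph _)
            cylinderHomeomorph_mem_ballBoundary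
      refine LiftsPair.hasLiftingProperty f (isEmbedding_diskBoundaryInclusion (n + 1)) ?_
      refine LiftsPair.of_homeomorph ?_ (diskHomeomorph.{u} (n + 1))
        (mem_range_diskBoundaryInclusion (n + 1))
      refine LiftsPair.of_homeomorph ?_ e' he'
      exact key.of_homeomorph (cylinderHomeomorph _).symm
        (fun p ↦ by rw [cylinderHomeomorph_mem_ballBoundary]; simp)

end

end SerreFibrations

/-! ### The adjunction for linking simplices. -/

namespace IsvtTop

section Adjunction

open Topology

variable {G : Type u} [Group G]

/-- The morphism of `G`-spaces given by an isovariant map. -/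
def ofMap {X Y : IsvtTop G} (f : C(X.carrier, Y.carrier)) (hf : IsIsovariant f) : X ⟶ Y := ⟨f, hf⟩

/-- The continuous map underlying a morphism of `G`-spaces. -/
def toMap {X Y : IsvtTop G} (f : X ⟶ Y) : C(X.carrier, Y.carrier) := f.1

lemma hom_ext' {X Y : IsvtTop G} {f g : X ⟶ Y} (h : ∀ x, toMap f x = toMap g x) : f = g :=
  Subtype.ext (ContinuousMap.ext h)

lemma isIsovariant_toMap {X Y : IsvtTop G} (f : X ⟶ Y) : IsIsovariant (toMap f) := f.2

/-- A sufficient condition for a continuous map of `G`-spaces to be isovariant. -/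
lemma IsIsovariant.mk' {X Y : IsvtTop G} {f : C(X.carrier, Y.carrier)}
    (h : ∀ (g : G) (x : X.carrier), f (g • x) = g • f x)
    (h' : ∀ (g : G) (x : X.carrier), g • f x = f x → g • x = x) : IsIsovariant f :=
  ⟨h, fun x ↦ le_antisymm (fun g hg ↦ h' g x hg) (fun g hg ↦ by
    rw [MulAction.mem_stabilizer_iff] at hg ⊢
    rw [← h, hg])⟩

lemma IsIsovariant.smul_eq_iff {X Y : IsvtTop G} {f : C(X.carrier, Y.carrier)}
    (h : IsIsovariant f) (g : G) (x : X.carrier) : g • f x = f x ↔ g • x = x := by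
  rw [← MulAction.mem_stabilizer_iff, h.2, MulAction.mem_stabilizer_iff]

/-- The topological condition on `X` which implies that `X × -` is left adjoint to
`Map_isvt(X, -)`. -/
def IsExponentiable (X : Type u) [TopologicalSpace X] : Prop :=
  ∀ (A Y : Type u) [TopologicalSpace A] [TopologicalSpace Y] (φ : C(A, C(X, Y))),
    Continuous fun p : X × A ↦ φ p.2 p.1

/-- The correspondence between isovariant maps `X × A → Y` and continuous maps
`A → Map_isvt(X, Y)`. -/
def prodHomEquiv {X : IsvtTop G} (hX : IsExponentiable X.carrier) (A : TopCat.{u}) (Y : IsvtTop G) :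
    (X.prodTop A ⟶ Y) ≃ (A ⟶ X.mapIsvt.obj Y) where
  toFun f := TopCat.ofHom
    ⟨fun a ↦ ⟨⟨fun x ↦ toMap f (x, a), by
        exact (toMap f).continuous.comp (by fun_prop : Continuous fun x : X.carrier ↦ (x, a))⟩,
      .mk' (fun g x ↦ (isIsovariant_toMap f).1 g (x, a))
        fun g x h ↦ congrArg Prod.fst (((isIsovariant_toMap f).smul_eq_iff g (x, a)).1 h)⟩,
      Continuous.subtype_mk (ContinuousMap.curry
        ⟨fun p : A × X.carrier ↦ toMap f (p.2, p.1),
          (toMap f).continuous.comp continuous_swap⟩).continuous _⟩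
  invFun φ := ofMap ⟨fun p ↦ (φ p.2).1 p.1, by
      exact hX A Y.carrier ⟨fun a ↦ (φ a).1, continuous_subtype_val.comp φ.hom.continuous⟩⟩
    (.mk' (fun g p ↦ (φ p.2).2.1 g p.1) fun g p h ↦
      Prod.ext ((IsIsovariant.smul_eq_iff (φ p.2).2 g p.1).1 h) rfl)
  left_inv f := rfl
  right_inv φ := rfl

/-- The underlying correspondence of the adjunction between `Δ^H_G × -` and
`Map_isvt(Δ^H_G, -)`. -/
def linkHomEquiv (H : LTSeries (Subgroup G)) (hX : IsExponentiable (linkingSimplex H).carrier)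
    (A : TopCat.{u}) : ∀ (Y : Completed G),
    ((linkProd H).obj A ⟶ Y) ≃ (A ⟶ (linkMap H).obj Y)
  | .of Y => prodHomEquiv hX A Y
  | .star =>
    { toFun _ := TopCat.isTerminalPUnit.from A
      invFun _ := WithTerminal.starTerminal.from _
      left_inv _ := WithTerminal.starTerminal.hom_ext _ _
      right_inv _ := TopCat.isTerminalPUnit.hom_ext _ _ }

/-- Each index `k` gives a closed condition and there are finitely many of them. Closedness of the
relation is what makes the quotient map proper. -/
lemma isClosed_linkSetoid [Finite G] (H : LTSeries (Subgroup G)) :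
    let _ : TopologicalSpace G := ⊥
    IsClosed {p : (G × stdSimplex ℝ (Fin (H.length + 1))) × (G × stdSimplex ℝ (Fin (H.length + 1))) |
      linkSetoid H p.1 p.2} := by
  let _ : TopologicalSpace G := ⊥
  have : DiscreteTopology G := ⟨rfl⟩
  have h : {p : (G × stdSimplex ℝ (Fin (H.length + 1))) × (G × stdSimplex ℝ (Fin (H.length + 1))) |
      linkSetoid H p.1 p.2} = {p | p.1.2 = p.2.2} ∩ ⋃ k : Fin (H.length + 1),
        (⋂ i : Fin (H.length + 1), ⋂ _ : H.length < (i : ℕ) + k, {p | p.1.2.1 i = 0}) ∩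
        (fun p ↦ (p.1.1, p.2.1)) ⁻¹' {q : G × G | (q.1 : G ⧸ H k) = (q.2 : G ⧸ H k)} := by
    ext p
    simp only [Set.mem_inter_iff, Set.mem_iUnion, Set.mem_iInter, Set.mem_preimage]
    rfl
  rw [h]
  refine (isClosed_eq (by fun_prop) (by fun_prop)).inter (isClosed_iUnion_of_finite fun k ↦
    (isClosed_iInter fun i ↦ isClosed_iInter fun _ ↦ isClosed_eq ?_ continuous_const).inter
      ((isClosed_discrete _).preimage (by fun_prop)))
  exact (continuous_apply i).comp (continuous_subtype_val.comp (by fun_prop))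

/-- Evaluation is continuous on the compact Hausdorff space `G × Δ^n`. It descends because the
quotient map is proper and so remains a quotient map after taking the product with any `A`. -/
lemma isExponentiable_linkingSimplex [Finite G] (H : LTSeries (Subgroup G)) :
    IsExponentiable (linkingSimplex H).carrier := by
  intro A Y _ _ φ
  let _ : TopologicalSpace G := ⊥
  have : DiscreteTopology G := ⟨rfl⟩
  let K := G × stdSimplex ℝ (Fin (H.length + 1))
  have : CompactSpace K := inferInstance
  let q : C(K, (linkingSimplex H).carrier) := ⟨Quotient.mk (linkSetoid H), continuous_quot_mk⟩
  have hq : Topology.IsQuotientMap q := isQuotientMap_quot_mk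
  -- The saturation of a closed set is the projection of a closed set along a compact factor.
  have hsat (C : Set K) (hC : IsClosed C) : IsClosed (q ⁻¹' (q '' C)) := by
    have h : q ⁻¹' (q '' C) = Prod.fst '' ({p : K × K | linkSetoid H p.1 p.2} ∩ Prod.snd ⁻¹' C) := by
      ext x
      constructor
      · rintro ⟨y, hy, hxy⟩
        exact ⟨(x, y), ⟨(linkSetoid H).symm (Quotient.exact hxy), hy⟩, rfl⟩
      · rintro ⟨⟨x, y⟩, ⟨hxy, hy⟩, rfl⟩
        exact ⟨y, hy, (Quotient.sound hxy).symm⟩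
    rw [h]
    exact isClosedMap_fst_of_compactSpace _
      ((isClosed_linkSetoid H).inter (hC.preimage continuous_snd))
  have hqc : IsClosedMap q := fun C hC ↦ hq.isClosed_preimage.1 (hsat C hC)
  have hqp : IsProperMap q := by
    refine isProperMap_iff_isClosedMap_and_compact_fibers.2 ⟨q.continuous, hqc, fun y ↦ ?_⟩
    obtain ⟨x, rfl⟩ := hq.surjective y
    rw [← Set.image_singleton]
    exact (hsat _ isClosed_singleton).isCompact
  have hqA : Topology.IsQuotientMap (Prod.map q (id : A → A)) :=
    (hqp.prodMap (Homeomorph.refl A).isProperMap).isClosedMap.isQuotientMap (by fun_prop)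
      (hq.surjective.prodMap Function.surjective_id)
  rw [hqA.continuous_iff]
  let ψ : C(A, C(K, Y)) := ⟨fun a ↦ (φ a).comp q, (ContinuousMap.continuous_precomp q).comp φ.continuous⟩
  exact (ContinuousMap.continuous_uncurry_of_continuous ψ).comp continuous_swap

/-- The adjunction between `Δ^H_G × -` and `Map_isvt(Δ^H_G, -)`. -/
noncomputable def linkAdjunction [Finite G] (H : LTSeries (Subgroup G)) :
    linkProd H ⊣ (linkMap H : Completed G ⥤ TopCat.{u}) :=
  Adjunction.mkOfHomEquiv
    { homEquiv := linkHomEquiv H (isExponentiable_linkingSimplex H)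
      homEquiv_naturality_left_symm := by
        rintro A B (Y | _) f g
        · rfl
        · exact Subsingleton.elim _ _
      homEquiv_naturality_right := by
        rintro A (Y | _) (Z | _) f g
        · rfl
        · exact TopCat.isTerminalPUnit.hom_ext _ _
        · exact g.elim
        · exact TopCat.isTerminalPUnit.hom_ext _ _ }

end Adjunction

end IsvtTop

/-! ### The completed category in terms of underlying `G`-spaces. -/

namespace IsvtTop

variable {G : Type u} [Group G]

section Underlying

variable (G) in
/-- The one-point `G`-space. -/
def point : IsvtTop G where
  carrier := PUnit

/-- The `G`-space underlying an object of the completed category, where the formal terminal object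
is sent to the one-point space. -/
def underlying : Completed G → IsvtTop G
  | .of X => X
  | .star => point G

/-- The points of the `G`-space underlying an object of the completed category. -/
abbrev Pt (X : Completed G) : Type u := (underlying X).carrier

/-- The map underlying a morphism of the completed category. -/
def underMap : ∀ {X Y : Completed G}, (X ⟶ Y) → C(Pt X, Pt Y)
  | .of _, .of _, f => toMap (WithTerminal.down f)
  | _, .star, _ => ContinuousMap.const _ PUnit.unit
  | .star, .of _, f => (WithTerminal.false_of_from_star f).elim

lemma underMap_id (X : Completed G) (x : Pt X) : underMap (𝟙 X) x = x := by
  cases X <;> rfl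

lemma underMap_comp {X Y Z : Completed G} (f : X ⟶ Y) (g : Y ⟶ Z) (x : Pt X) :
    underMap (f ≫ g) x = underMap g (underMap f x) := by
  rcases X with X | _ <;> rcases Y with Y | _ <;> rcases Z with Z | _ <;>
    first
    | rfl
    | exact (WithTerminal.false_of_from_star f).elim
    | exact (WithTerminal.false_of_from_star g).elim

lemma ne_star_of_hom {X Y : Completed G} (f : X ⟶ Y) (hY : Y ≠ .star) : X ≠ .star := by
  rintro rfl
  rcases Y with Y | _
  · exact WithTerminal.false_of_from_star f
  · exact hY rfl

lemma isIsovariant_underMap {X Y : Completed G} (f : X ⟶ Y) (hY : Y ≠ .star) :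
    IsIsovariant (underMap f) := by
  rcases X with X | _ <;> rcases Y with Y | _
  · exact isIsovariant_toMap _
  · exact (hY rfl).elim
  · exact (WithTerminal.false_of_from_star f).elim
  · exact (hY rfl).elim

lemma underMap_smul {X Y : Completed G} (f : X ⟶ Y) (g : G) (x : Pt X) :
    underMap f (g • x) = g • underMap f x := by
  by_cases hY : Y = .star
  · subst hY; rfl
  · exact (isIsovariant_underMap f hY).1 g x

lemma smul_eq_of_underMap {X Y : Completed G} (f : X ⟶ Y) (hY : Y ≠ .star) (g : G) (x : Pt X)
    (h : g • underMap f x = underMap f x) : g • x = x :=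
  ((isIsovariant_underMap f hY).smul_eq_iff g x).1 h

lemma hom_ext_underMap {X Y : Completed G} {f f' : X ⟶ Y} (h : ∀ x, underMap f x = underMap f' x) :
    f = f' := by
  rcases X with X | _ <;> rcases Y with Y | _
  · exact hom_ext' (f := WithTerminal.down f) (g := WithTerminal.down f') h
  · exact WithTerminal.starTerminal.hom_ext _ _
  · exact (WithTerminal.false_of_from_star f).elim
  · exact WithTerminal.starTerminal.hom_ext _ _

/-- Constructor for morphisms in the completed category. -/
def homMk : ∀ {X Y : Completed G} (φ : C(Pt X, Pt Y))
    (_ : Y ≠ .star → X ≠ .star ∧ IsIsovariant φ), X ⟶ Y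
  | .of _, .of _, φ, h => WithTerminal.incl.map (ofMap φ (h (by simp)).2)
  | _, .star, _, _ => WithTerminal.starTerminal.from _
  | .star, .of _, _, h => ((h (by simp)).1 rfl).elim

@[simp] lemma underMap_homMk {X Y : Completed G} (φ : C(Pt X, Pt Y))
    (h : Y ≠ .star → X ≠ .star ∧ IsIsovariant φ) (x : Pt X) : underMap (homMk φ h) x = φ x := by
  rcases X with X | _ <;> rcases Y with Y | _
  · rfl
  · rfl
  · exact ((h (by simp)).1 rfl).elim
  · rfl

lemma of_ne_star (X : IsvtTop G) : (.of X : Completed G) ≠ .star := by simp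

end Underlying

/-! ### Limits in the completed category. -/

section Limits

variable {J : Type u} [Category.{u} J] (F : J ⥤ Completed G)

/-- The points of the limit of a diagram of `G`-spaces: the compatible families of points which all
have the same isotropy group. -/
def LimitPt : Type u :=
  {x : ∀ j, Pt (F.obj j) // (∀ ⦃j k⦄ (f : j ⟶ k), underMap (F.map f) (x j) = x k) ∧
    -- The formal terminal object is represented by a point with full isotropy, which must not
    -- constrain the other coordinates.
    ∀ (j k) (g : G), F.obj j ≠ .star → g • x j = x j → g • x k = x k}

instance : TopologicalSpace (LimitPt F) := inferInstanceAs (TopologicalSpace (Subtype _))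

instance : MulAction G (LimitPt F) where
  smul g x := ⟨fun j ↦ g • x.1 j, fun j k f ↦ by rw [underMap_smul, x.2.1], fun j k h hj hg ↦ by
    have := x.2.2 j k (g⁻¹ * h * g) hj (by rw [mul_smul, mul_smul, hg, inv_smul_smul])
    rwa [mul_smul, mul_smul, inv_smul_eq_iff] at this⟩
  one_smul x := Subtype.ext (funext fun j ↦ one_smul G _)
  mul_smul g h x := Subtype.ext (funext fun j ↦ mul_smul g h _)

instance : ContinuousConstSMul G (LimitPt F) where
  continuous_const_smul g := Continuous.subtype_mk (continuous_pi fun j ↦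
    ((continuous_apply j).comp continuous_subtype_val).const_smul g) _

/-- The limit of a diagram of `G`-spaces and isovariant maps. -/
def limitSpace : IsvtTop G where
  carrier := LimitPt F

variable {F}

/-- The map to the limit which is induced by a cone. -/
def limitLift (s : Cone F) : C(Pt s.pt, LimitPt F) :=
  ⟨fun x ↦ ⟨fun j ↦ underMap (s.π.app j) x, fun j k f ↦ by rw [← underMap_comp, s.w],
      fun j k g hj h ↦ by rw [← underMap_smul, smul_eq_of_underMap _ hj _ _ h]⟩,
    Continuous.subtype_mk (continuous_pi fun j ↦ (underMap (s.π.app j)).continuous) _⟩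

variable (F)

/-- The projections from the limit. -/
def limitπ (j : J) : C(LimitPt F, Pt (F.obj j)) :=
  ⟨fun x ↦ x.1 j, (continuous_apply j).comp continuous_subtype_val⟩

/-- The projections from the limit, as morphisms of the completed category. -/
def limitπHom (j : J) : (.of (limitSpace F) : Completed G) ⟶ F.obj j :=
  homMk (limitπ F j) fun hj ↦ ⟨of_ne_star _, .mk' (fun _ _ ↦ rfl) fun g (x : LimitPt F) hx ↦
    Subtype.ext (funext fun k ↦ x.2.2 j k g hj hx)⟩

lemma underMap_limitπHom (j : J) (x : LimitPt F) : underMap (limitπHom F j) x = x.1 j :=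
  underMap_homMk (X := .of (limitSpace F)) _ _ _

/-- The limit cone of a diagram in the completed category where not all objects are the formal
terminal object. -/
def limitCone : Cone F where
  pt := .of (limitSpace F)
  π :=
    { app := limitπHom F
      naturality j k f := hom_ext_underMap fun (x : LimitPt F) ↦ by
        refine (underMap_comp _ _ _).trans ((underMap_limitπHom F k _).trans ?_)
        refine Eq.trans ?_ ((underMap_comp _ _ _).trans
          (congrArg (underMap (F.map f)) (underMap_limitπHom F j x))).symm
        exact (congrArg (fun y : LimitPt F ↦ y.1 k) (underMap_id _ _)).trans (x.2.1 f).symm }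

/-- `limitCone` is a limit cone. -/
def isLimitLimitCone {j₀ : J} (h₀ : F.obj j₀ ≠ .star) : IsLimit (limitCone F) where
  lift s := homMk (Y := .of (limitSpace F)) (limitLift s)
    fun _ ↦ ⟨ne_star_of_hom (s.π.app j₀) h₀, .mk'
      (fun g x ↦ Subtype.ext (funext fun j ↦ underMap_smul _ _ _))
      fun g x h ↦ smul_eq_of_underMap (s.π.app j₀) h₀ g x
        (congr_fun (congrArg Subtype.val h) j₀)⟩
  fac s j := hom_ext_underMap fun x ↦ by
    refine (underMap_comp _ _ _).trans ((underMap_limitπHom F j _).trans ?_)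
    exact congrArg (fun y : LimitPt F ↦ y.1 j)
      (underMap_homMk (Y := .of (limitSpace F)) (limitLift s) _ x)
  uniq s m hm := hom_ext_underMap fun x ↦ by
    refine Eq.trans ?_ (underMap_homMk (Y := .of (limitSpace F)) (limitLift s) _ x).symm
    refine Subtype.ext (funext fun j ↦ ?_)
    refine Eq.trans ?_ (congrArg (fun f ↦ underMap f x) (hm j))
    exact ((underMap_comp _ _ _).trans (underMap_limitπHom F j _)).symm

/-- Constructor for morphisms from the formal terminal object. -/
def fromStar {Y : Completed G} (h : Y = .star) : .star ⟶ Y := eqToHom h.symm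

lemma hom_ext_star {X Y : Completed G} (h : Y = .star) (f f' : X ⟶ Y) : f = f' := by
  subst h
  exact WithTerminal.starTerminal.hom_ext _ _

instance : HasLimits (Completed G) where
  has_limits_of_shape J _ :=
    { has_limit F := by
        by_cases h : ∃ j, F.obj j ≠ .star
        · obtain ⟨j, hj⟩ := h
          exact ⟨⟨⟨_, isLimitLimitCone F hj⟩⟩⟩
        · push Not at h
          exact ⟨⟨⟨{ pt := .star
                     π := { app j := fromStar (h j)
                            naturality _ _ _ := hom_ext_star (h _) _ _ } },
            { lift s := WithTerminal.starTerminal.from _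
              fac _ j := hom_ext_star (h j) _ _
              uniq _ _ _ := WithTerminal.starTerminal.hom_ext _ _ }⟩⟩⟩ }

end Limits

/-! ### Colimits in the completed category. -/

section Colimits

variable {J : Type u} [Category.{u} J] (F : J ⥤ Completed G)

/-- The relation on the disjoint union of the spaces of a diagram which defines its colimit. -/
def ColimitRel (p q : Σ j, Pt (F.obj j)) : Prop :=
  ∃ f : p.1 ⟶ q.1, underMap (F.map f) p.2 = q.2

/-- The points of the colimit of the spaces underlying a diagram in the completed category. -/
def ColimitPt : Type u := Quot (ColimitRel F)

instance : TopologicalSpace (ColimitPt F) := inferInstanceAs (TopologicalSpace (Quot _))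

instance : MulAction G (ColimitPt F) where
  smul g := Quot.map (fun p ↦ ⟨p.1, g • p.2⟩) (fun p q ⟨f, hf⟩ ↦ ⟨f, by rw [underMap_smul, hf]⟩)
  one_smul := by
    rintro ⟨j, x⟩
    exact congrArg (fun y ↦ Quot.mk (ColimitRel F) ⟨j, y⟩) (one_smul G x)
  mul_smul g h := by
    rintro ⟨j, x⟩
    exact congrArg (fun y ↦ Quot.mk (ColimitRel F) ⟨j, y⟩) (mul_smul g h x)

instance : ContinuousConstSMul G (ColimitPt F) where
  continuous_const_smul g := continuous_quot_lift _ (continuous_quot_mk.comp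
    (continuous_sigma fun _ ↦ continuous_sigmaMk.comp (continuous_const_smul g)))

/-- The colimit of the `G`-spaces underlying a diagram in the completed category. -/
def colimitSpace : IsvtTop G where
  carrier := ColimitPt F

/-- The inclusion of a space in the colimit. -/
def colimitι (j : J) : C(Pt (F.obj j), ColimitPt F) :=
  ⟨fun x ↦ Quot.mk _ ⟨j, x⟩, continuous_quot_mk.comp continuous_sigmaMk⟩

/-- The condition that the colimit of the spaces underlying a diagram is a colimit in the category
of isovariant maps. -/
def HasIsovariantColimit : Prop :=
  ∀ j, F.obj j ≠ .star ∧ ∀ (g : G) (x : Pt (F.obj j)), g • colimitι F j x = colimitι F j x → g • x = x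

variable {F}

/-- The map from the colimit which is induced by a cocone. -/
def colimitDesc (s : Cocone F) : C(ColimitPt F, Pt s.pt) :=
  ⟨Quot.lift (fun p ↦ underMap (s.ι.app p.1) p.2) (by
    rintro p q ⟨f, hf⟩
    rw [← hf, ← underMap_comp, s.w]), continuous_quot_lift _
      (continuous_sigma fun j ↦ (underMap (s.ι.app j)).continuous)⟩

lemma colimitDesc_ι (s : Cocone F) (j : J) (x : Pt (F.obj j)) :
    colimitDesc s (colimitι F j x) = underMap (s.ι.app j) x := rfl

lemma colimitDesc_smul (s : Cocone F) (g : G) (z : ColimitPt F) :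
    colimitDesc s (g • z) = g • colimitDesc s z := by
  obtain ⟨j, x⟩ := z
  exact underMap_smul (s.ι.app j) g x

/-- The inclusion of a space in the colimit, as a morphism of the completed category. -/
def colimitιHom (h : HasIsovariantColimit F) (j : J) :
    F.obj j ⟶ (.of (colimitSpace F) : Completed G) :=
  homMk (colimitι F j) fun _ ↦ ⟨(h j).1, .mk' (fun _ _ ↦ rfl) (h j).2⟩

lemma underMap_colimitιHom (h : HasIsovariantColimit F) (j : J) (x : Pt (F.obj j)) :
    underMap (colimitιHom h j) x = colimitι F j x :=
  underMap_homMk (Y := .of (colimitSpace F)) _ _ _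

/-- The colimit cocone, when the colimit of the underlying spaces is isovariant. -/
def colimitCocone (h : HasIsovariantColimit F) : Cocone F where
  pt := .of (colimitSpace F)
  ι :=
    { app := colimitιHom h
      naturality j k f := hom_ext_underMap fun x ↦ by
        refine ((underMap_comp _ _ _).trans (underMap_colimitιHom h k _)).trans ?_
        refine Eq.trans ?_ ((underMap_comp _ _ _).trans (underMap_id _ _)).symm
        exact Eq.trans (Quot.sound ⟨f, rfl⟩ : colimitι F j x = colimitι F k _).symm
          (underMap_colimitιHom h j x).symm }

/-- `colimitCocone` is a colimit cocone. -/
def isColimitColimitCocone (h : HasIsovariantColimit F) : IsColimit (colimitCocone h) where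
  desc s := homMk (X := .of (colimitSpace F)) (colimitDesc s) fun hs ↦ ⟨of_ne_star _, .mk'
    (fun g z ↦ colimitDesc_smul s g z) (by
      rintro g ⟨j, x⟩ hx
      exact congrArg (colimitι F j) (smul_eq_of_underMap (s.ι.app j) hs g x hx))⟩
  fac s j := hom_ext_underMap fun x ↦ by
    refine (underMap_comp _ _ _).trans ?_
    refine (underMap_homMk (X := .of (colimitSpace F)) (colimitDesc s) _ _).trans ?_
    exact congrArg (colimitDesc s) (underMap_colimitιHom h j x)
  uniq s m hm := hom_ext_underMap (X := .of (colimitSpace F)) (by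
    rintro ⟨j, x⟩
    refine Eq.trans ?_ (underMap_homMk (X := .of (colimitSpace F)) (colimitDesc s) _ _).symm
    refine Eq.trans ?_ (congrArg (fun f ↦ underMap f x) (hm j))
    exact ((underMap_comp _ _ _).trans
      (congrArg (underMap m) (underMap_colimitιHom h j x))).symm)

/-- An element that fixes a point of the colimit fixes its image in the vertex, and hence, the legs
of the cocone being isovariant, already the point at stage `j`. -/
lemma HasIsovariantColimit.of_cocone (s : Cocone F) (hs : s.pt ≠ .star) :
    HasIsovariantColimit F := fun j ↦
  ⟨ne_star_of_hom (s.ι.app j) hs, fun g x hx ↦ smul_eq_of_underMap (s.ι.app j) hs g x (by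
    have := congrArg (colimitDesc s) hx
    rwa [colimitDesc_smul, colimitDesc_ι] at this)⟩

/-- If some isotropy group grows in the colimit, or some object is the formal one, then no cocone
ends at a `G`-space and the formal terminal object is the colimit. This is what adjoining it
achieves. -/
instance : HasColimits (Completed G) where
  has_colimits_of_shape J _ :=
    { has_colimit F := by
        by_cases h : HasIsovariantColimit F
        · exact ⟨⟨⟨_, isColimitColimitCocone h⟩⟩⟩
        · have hs (s : Cocone F) : s.pt = .star := by
            by_contra hs
            exact h (.of_cocone s hs)
          exact ⟨⟨⟨{ pt := .star
                     ι := { app j := WithTerminal.starTerminal.from _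
                            naturality _ _ _ := WithTerminal.starTerminal.hom_ext _ _ } },
            { desc s := fromStar (hs s)
              fac s j := hom_ext_star (hs s) _ _
              uniq s _ _ := hom_ext_star (hs s) _ _ }⟩⟩⟩ }

end Colimits

end IsvtTop

/-! ### Embeddings as a left lifting class. -/

namespace IsvtTop

variable {G : Type u} [Group G]

section Embeddings

/-- The two-point space with the indiscrete topology. -/
def IndiscreteProp : Type := Prop

instance : TopologicalSpace IndiscreteProp := ⊤

/-- The space of pairs of a point `y : Y` and of a map `G → S` which is fixed by the isotropy group
of `y`. -/
def TestPt (Y : IsvtTop G) (S : Type) : Type u :=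
  {p : Y.carrier × (G → S) // ∀ g : G, g • p.1 = p.1 → ∀ h : G, p.2 (h * g) = p.2 h}

section

variable (Y : IsvtTop G) (S : Type) [TopologicalSpace S]

instance : TopologicalSpace (TestPt Y S) := inferInstanceAs (TopologicalSpace (Subtype _))

instance : MulAction G (TestPt Y S) where
  smul g p := ⟨(g • p.1.1, fun h ↦ p.1.2 (h * g)), fun k hk h ↦ by
    have := p.2 (g⁻¹ * k * g) (by
      change k • g • p.1.1 = g • p.1.1 at hk
      rw [mul_smul, mul_smul, hk, inv_smul_smul]) (h * g)
    simpa [mul_assoc] using this⟩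
  one_smul p := Subtype.ext (Prod.ext (one_smul G p.1.1)
    (funext fun h ↦ congrArg p.1.2 (mul_one h)))
  mul_smul g k p := Subtype.ext (Prod.ext (mul_smul g k p.1.1)
    (funext fun h ↦ congrArg p.1.2 (mul_assoc h g k).symm))

instance : ContinuousConstSMul G (TestPt Y S) where
  continuous_const_smul g := by
    have h₁ : Continuous fun p : TestPt Y S ↦ p.1 := continuous_subtype_val
    exact Continuous.subtype_mk (Continuous.prodMk ((continuous_fst.comp h₁).const_smul g)
      (continuous_pi fun h ↦ (continuous_apply (h * g)).comp (continuous_snd.comp h₁))) _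

/-- The `G`-space `TestPt Y S`. -/
def testSpace : IsvtTop G where
  carrier := TestPt Y S

/-- The projection `TestPt Y S → Y`. -/
def testMap : testSpace Y S ⟶ Y :=
  ofMap ⟨fun p : TestPt Y S ↦ p.1.1, continuous_fst.comp continuous_subtype_val⟩
    (.mk' (fun _ _ ↦ rfl) fun g (p : TestPt Y S) hp ↦
      Subtype.ext (Prod.ext hp (funext fun h ↦ p.2 g hp h)))

end

variable (G) in
/-- The set of subsets of `G`, with the indiscrete topology and the action by left
multiplication. -/
def setSpace : IsvtTop G :=
  letI : TopologicalSpace (G → Prop) := ⊤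
  letI : MulAction G (G → Prop) :=
    { smul g s := fun h ↦ s (g⁻¹ * h)
      one_smul s := funext fun h ↦ by
        change s (1⁻¹ * h) = s h
        simp
      mul_smul g k s := funext fun h ↦ by
        change s ((g * k)⁻¹ * h) = s (k⁻¹ * (g⁻¹ * h))
        simp [mul_assoc] }
  { carrier := G → Prop
    cont := ⟨fun _ ↦ continuous_top⟩ }

/-- The set of all `g` such that `g • x = y`. -/
def transporter {X : IsvtTop G} (x y : X.carrier) : (setSpace G).carrier :=
  fun g : G ↦ g • x = y

lemma smul_transporter {X : IsvtTop G} (x y : X.carrier) (g : G) :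
    g • transporter x y = transporter x (g • y) := by
  change (fun h : G ↦ (g⁻¹ * h) • x = y) = fun h : G ↦ h • x = g • y
  funext h
  rw [mul_smul, inv_smul_eq_iff]

lemma eq_of_transporter_eq {X : IsvtTop G} {x y z : X.carrier} (h : ∃ g : G, g • x = y)
    (h' : transporter x y = transporter x z) : y = z := by
  obtain ⟨g, hg⟩ := h
  exact hg.symm.trans ((iff_of_eq (congr_fun h' g)).1 hg)

lemma continuous_setSpace {X : Type*} [TopologicalSpace X] (f : X → (setSpace G).carrier) :
    Continuous f :=
  continuous_top

/-- Isovariant maps to `setSpace G` extend along injective isovariant maps. -/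
lemma exists_extension_setSpace {A B : IsvtTop G} (f : C(A.carrier, B.carrier))
    (hf : IsIsovariant f) (hf' : Function.Injective f) (u : C(A.carrier, (setSpace G).carrier))
    (hu : IsIsovariant u) :
    ∃ v : C(B.carrier, (setSpace G).carrier), IsIsovariant v ∧ ∀ a, v (f a) = u a := by
  classical
  let o : Setoid B.carrier := MulAction.orbitRel G B.carrier
  let r (b : B.carrier) : B.carrier := Quotient.out (Quotient.mk o b)
  have hr (b : B.carrier) : ∃ g : G, g • r b = b :=
    MulAction.orbitRel_apply.1 (Setoid.symm (Quotient.mk_out b))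
  have hr' (g : G) (b : B.carrier) : r (g • b) = r b :=
    congrArg Quotient.out (Quotient.sound (MulAction.orbitRel_apply.2 ⟨g, rfl⟩ : g • b ≈ b))
  -- Off the invariant image of `f`, a point `b` goes to the set of elements that carry a chosen
  -- representative of its orbit to `b`. The isotropy group of this set under left multiplication is
  -- that of `b`.
  let v (b : B.carrier) : (setSpace G).carrier :=
    if h : ∃ a, f a = b then u h.choose else transporter (r b) b
  have hv (a : A.carrier) : v (f a) = u a := by
    have h : ∃ a', f a' = f a := ⟨a, rfl⟩
    exact (dif_pos h).trans (congrArg u (hf' h.choose_spec))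
  have hv' (b : B.carrier) (h : ¬ ∃ a, f a = b) : v b = transporter (r b) b := dif_neg h
  have hgb (g : G) (b : B.carrier) (h : ¬ ∃ a, f a = b) : ¬ ∃ a, f a = g • b := by
    rintro ⟨a, ha⟩
    exact h ⟨g⁻¹ • a, by rw [hf.1, ha, inv_smul_smul]⟩
  refine ⟨⟨v, continuous_setSpace v⟩, .mk' (fun g b ↦ ?_) (fun g b hb ↦ ?_), hv⟩
  · change v (g • b) = g • v b
    by_cases h : ∃ a, f a = b
    · obtain ⟨a, rfl⟩ := h
      rw [← hf.1, hv, hv, hu.1]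
    · rw [hv' b h, hv' _ (hgb g b h), smul_transporter, hr']
  · change g • v b = v b at hb
    by_cases h : ∃ a, f a = b
    · obtain ⟨a, rfl⟩ := h
      rw [hv] at hb
      rw [← hf.1, (hu.smul_eq_iff g a).1 hb]
    · rw [hv' b h, smul_transporter] at hb
      exact (eq_of_transporter_eq (hr b) hb.symm).symm

/-- Every `G`-space admits an isovariant map to `setSpace G`. -/
lemma nonempty_hom_setSpace (B : IsvtTop G) :
    ∃ v : C(B.carrier, (setSpace G).carrier), IsIsovariant v := by
  let _ : MulAction G PEmpty.{u + 1} :=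
    { smul _ := id
      one_smul := by rintro ⟨⟩
      mul_smul _ _ := by rintro ⟨⟩ }
  let A : IsvtTop G :=
    { carrier := PEmpty.{u + 1}
      cont := ⟨fun _ ↦ continuous_of_const (by rintro ⟨⟩)⟩ }
  have h {Y : IsvtTop G} (f : C(A.carrier, Y.carrier)) : IsIsovariant f :=
    .mk' (by rintro _ ⟨⟩) (by rintro _ ⟨⟩)
  obtain ⟨v, hv, -⟩ := exists_extension_setSpace (A := A) (B := B)
    ⟨PEmpty.elim, continuous_of_const (by rintro ⟨⟩)⟩ (h _) (by rintro ⟨⟩)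
    ⟨PEmpty.elim, continuous_of_const (by rintro ⟨⟩)⟩ (h _)
  exact ⟨v, hv⟩

/-- Lifts against `testMap` from extensions of maps to `S`. -/
lemma hasLiftingProperty_testMap {A B : Completed G} (f : A ⟶ B) (hB : B ≠ .star) (S : Type)
    [TopologicalSpace S]
    (h : ∀ u : C(Pt A, S), ∃ v : C(Pt B, S), ∀ a, v (underMap f a) = u a) (Y : IsvtTop G) :
    HasLiftingProperty f (WithTerminal.incl.map (testMap Y S)) where
  sq_hasLift {s t} sq := by
    -- A map to `TestPt Y S` over `Y` amounts to a continuous map to `S`: it is read off at `1 : G`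
    -- and recovered by translation. Isovariance comes from the first coordinate alone.
    obtain ⟨v, hv⟩ := h ⟨fun a ↦ (underMap s a : TestPt Y S).1.2 1, (continuous_apply _).comp
      (continuous_snd.comp (continuous_subtype_val.comp (underMap s).continuous))⟩
    have ht := isIsovariant_underMap t (of_ne_star Y)
    let φ : C(Pt B, TestPt Y S) := ⟨fun b ↦ ⟨(underMap t b, fun g ↦ v (g • b)), fun g hg k ↦ by
        have : g • b = b := (ht.smul_eq_iff g b).1 hg
        change v ((k * g) • b) = v (k • b)
        rw [mul_smul, this]⟩, Continuous.subtype_mk ((underMap t).continuous.prodMk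
          (continuous_pi fun g ↦ v.continuous.comp (continuous_const_smul g))) _⟩
    have hφ : IsIsovariant (X := underlying B) (Y := testSpace Y S) φ := .mk'
      (fun g b ↦ Subtype.ext (Prod.ext (ht.1 g b) (funext fun k ↦ by
        change v (k • g • b) = v ((k * g) • b)
        rw [mul_smul])))
      fun g b hb ↦ (ht.smul_eq_iff g b).1 (congrArg (fun p : TestPt Y S ↦ p.1.1) hb)
    have hl (b : Pt B) : underMap (homMk (Y := .of (testSpace Y S)) φ fun _ ↦ ⟨hB, hφ⟩) b = φ b :=
      underMap_homMk (Y := .of (testSpace Y S)) _ _ b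
    have hw (a : Pt A) : (underMap s a : TestPt Y S).1.1 = underMap t (underMap f a) := by
      have := congrArg (fun f ↦ underMap f a) sq.w
      exact (underMap_comp s _ a).symm.trans (this.trans (underMap_comp f t a))
    refine ⟨⟨⟨homMk (Y := .of (testSpace Y S)) φ fun _ ↦ ⟨hB, hφ⟩, ?_, ?_⟩⟩⟩
    · refine hom_ext_underMap fun a ↦ (underMap_comp _ _ _).trans ((hl _).trans ?_)
      refine Subtype.ext (Prod.ext (hw a).symm (funext fun g ↦ ?_))
      change v (g • underMap f a) = _
      rw [← underMap_smul, hv]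
      change (underMap s (g • a) : TestPt Y S).1.2 1 = _
      refine (congrArg (fun p : TestPt Y S ↦ p.1.2 1) (underMap_smul s g a)).trans ?_
      exact congrArg (underMap s a : TestPt Y S).1.2 (one_mul g)
    · exact hom_ext_underMap fun b ↦ (underMap_comp _ _ _).trans
        (congrArg (fun p : TestPt Y S ↦ p.1.1) (hl b))

/-- Extensions of maps to `S` from lifts against `testMap`. -/
lemma exists_extension_of_hasLiftingProperty {A : Completed G} {Y : IsvtTop G} (f : A ⟶ .of Y)
    (S : Type) [TopologicalSpace S] [HasLiftingProperty f (WithTerminal.incl.map (testMap Y S))]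
    (u : C(Pt A, S)) : ∃ v : C(Y.carrier, S), ∀ a, v (underMap f a) = u a := by
  have hf := isIsovariant_underMap f (of_ne_star Y)
  let φ : C(Pt A, TestPt Y S) := ⟨fun a ↦ ⟨(underMap f a, fun g ↦ u (g • a)), fun g hg k ↦ by
      have : g • a = a := (hf.smul_eq_iff g a).1 hg
      change u ((k * g) • a) = u (k • a)
      rw [mul_smul, this]⟩, Continuous.subtype_mk ((underMap f).continuous.prodMk
        (continuous_pi fun g ↦ u.continuous.comp (continuous_const_smul g))) _⟩
  have hφ : IsIsovariant (X := underlying A) (Y := testSpace Y S) φ := .mk'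
    (fun g b ↦ Subtype.ext (Prod.ext (hf.1 g b) (funext fun k ↦ by
      change u (k • g • b) = u ((k * g) • b)
      rw [mul_smul])))
    fun g b hb ↦ (hf.smul_eq_iff g b).1 (congrArg (fun p : TestPt Y S ↦ p.1.1) hb)
  let s : A ⟶ .of (testSpace Y S) := homMk φ fun _ ↦ ⟨ne_star_of_hom f (of_ne_star Y), hφ⟩
  have hs (a : Pt A) : underMap s a = φ a := underMap_homMk (Y := .of (testSpace Y S)) _ _ a
  have sq : CommSq s f (WithTerminal.incl.map (testMap Y S)) (𝟙 _) := ⟨by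
    refine hom_ext_underMap fun a ↦ (underMap_comp _ _ _).trans ?_
    refine (congrArg (fun p : TestPt Y S ↦ p.1.1) (hs a)).trans ?_
    exact congrArg (fun f ↦ underMap f a) (Category.comp_id f).symm⟩
  have : sq.HasLift :=
    ‹HasLiftingProperty f (WithTerminal.incl.map (testMap Y S))›.sq_hasLift sq
  refine ⟨⟨fun y ↦ (underMap sq.lift y : TestPt Y S).1.2 1, (continuous_apply _).comp
    (continuous_snd.comp (continuous_subtype_val.comp (underMap sq.lift).continuous))⟩, fun a ↦ ?_⟩
  have h := (underMap_comp f sq.lift a).symm.trans (congrArg (fun f ↦ underMap f a) sq.fac_left)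
  refine (congrArg (fun p : TestPt Y S ↦ p.1.2 1) (h.trans (hs a))).trans ?_
  exact congrArg u (one_smul G a)

variable (G) in
/-- A class of morphisms such that the morphisms which have the left lifting property with respect
to it are embeddings. -/
def embeddingTests : MorphismProperty (Completed G) :=
  MorphismProperty.ofHoms (fun Y : IsvtTop G ↦ WithTerminal.incl.map (testMap Y Prop)) ⊔
    MorphismProperty.ofHoms (fun Y : IsvtTop G ↦ WithTerminal.incl.map (testMap Y IndiscreteProp)) ⊔
      MorphismProperty.ofHoms (fun _ : Unit ↦
        WithTerminal.starTerminal.from (.of (setSpace G) : Completed G))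

/-- Every `G`-space maps to `setSpace G`, and a lift of the resulting square would be a morphism
from the formal terminal object to a `G`-space. -/
lemma ne_star_of_llp_embeddingTests {A B : Completed G} {f : A ⟶ B}
    (hf : (embeddingTests G).llp f) (hA : A ≠ .star) : B ≠ .star := by
  rintro rfl
  have := hf _ (.inr ⟨()⟩)
  obtain ⟨v, hv⟩ := nonempty_hom_setSpace (underlying A)
  have sq : CommSq (homMk (Y := .of (setSpace G)) v fun _ ↦ ⟨hA, hv⟩) f
    (WithTerminal.starTerminal.from (.of (setSpace G) : Completed G)) (𝟙 _) :=
      ⟨WithTerminal.starTerminal.hom_ext _ _⟩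
  exact WithTerminal.false_of_from_star sq.lift

/-- Extending maps to the Sierpinski space `Prop` makes every open set of the source come from the
target; extending maps to `IndiscreteProp` separates points. -/
lemma isEmbedding_of_llp_embeddingTests {A B : Completed G} {f : A ⟶ B}
    (hf : (embeddingTests G).llp f) (hB : B ≠ .star) : Topology.IsEmbedding (underMap f) := by
  rcases B with Y | _
  · have := hf _ (.inl (.inl ⟨Y⟩))
    have := hf _ (.inl (.inr ⟨Y⟩))
    refine ⟨⟨le_antisymm (underMap f).continuous.le_induced fun U hU ↦ ?_⟩, fun a a' h ↦ ?_⟩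
    · have hU' : Continuous (fun a : Pt A ↦ a ∈ U) := continuous_Prop.2 hU
      obtain ⟨v, hv⟩ := exists_extension_of_hasLiftingProperty f Prop ⟨_, hU'⟩
      exact ⟨{y | v y}, continuous_Prop.1 v.continuous, Set.ext fun a ↦ iff_of_eq (hv a)⟩
    · obtain ⟨v, hv⟩ := exists_extension_of_hasLiftingProperty f IndiscreteProp
        ⟨fun x ↦ (x = a : Prop), continuous_top⟩
      have := (hv a').symm.trans ((congrArg v h.symm).trans (hv a))
      exact ((iff_of_eq this).2 rfl).symm
  · exact (hB rfl).elim

lemma llp_embeddingTests_of_isEmbedding {A B : Completed G} {f : A ⟶ B} (hB : B ≠ .star)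
    (hf : Topology.IsEmbedding (underMap f)) : (embeddingTests G).llp f := by
  rintro _ _ _ ((⟨⟨Y⟩⟩ | ⟨⟨Y⟩⟩) | ⟨⟨⟩⟩)
  · refine hasLiftingProperty_testMap f hB Prop (fun u ↦ ?_) Y
    obtain ⟨V, hV, hV'⟩ := hf.isInducing.isOpen_iff.1 (continuous_Prop.1 u.continuous)
    exact ⟨⟨fun b ↦ b ∈ V, continuous_Prop.2 hV⟩, fun a ↦
      propext (iff_of_eq (congrArg (a ∈ ·) hV'))⟩
  · refine hasLiftingProperty_testMap f hB IndiscreteProp (fun u ↦ ?_) Y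
    refine ⟨⟨fun b ↦ (∃ a, underMap f a = b ∧ u a : Prop), continuous_top⟩, fun a ↦
      propext ⟨fun ⟨a', h, h'⟩ ↦ ?_, fun h ↦ ⟨a, rfl, h⟩⟩⟩
    rwa [← hf.injective h]
  · constructor
    intro s t sq
    obtain ⟨v, hv, hv'⟩ := exists_extension_setSpace (underMap f) (isIsovariant_underMap f hB)
      hf.injective (underMap s) (isIsovariant_underMap s (of_ne_star _))
    refine ⟨⟨⟨homMk (Y := .of (setSpace G)) v fun _ ↦ ⟨hB, hv⟩, ?_,
      WithTerminal.starTerminal.hom_ext _ _⟩⟩⟩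
    refine hom_ext_underMap fun a ↦ (underMap_comp _ _ _).trans ?_
    exact (underMap_homMk (Y := .of (setSpace G)) _ _ _).trans (hv' a)

lemma llp_embeddingTests_linkProd_map (H : LTSeries (Subgroup G)) {A B : TopCat.{u}} {i : A ⟶ B}
    (hi : Topology.IsEmbedding i) : (embeddingTests G).llp ((linkProd H).map i) :=
  llp_embeddingTests_of_isEmbedding (of_ne_star _)
    (Topology.IsEmbedding.id.prodMap hi :
      Topology.IsEmbedding (Prod.map (id : LinkingSimplex H → LinkingSimplex H) i))

lemma generatingCofibrations_le_llp_embeddingTests :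
    generatingCofibrations G ≤ (embeddingTests G).llp := by
  rintro _ _ _ ⟨p⟩
  exact llp_embeddingTests_linkProd_map _ (isEmbedding_diskBoundaryInclusion _)

lemma generatingAcyclicCofibrations_le_llp_embeddingTests :
    generatingAcyclicCofibrations G ≤ (embeddingTests G).llp := by
  rintro _ _ _ ⟨p⟩
  exact llp_embeddingTests_linkProd_map _ (isEmbedding_diskCylinderInclusion _)

end Embeddings

/-! ### Smallness and the small object argument. -/

section Smallness

/-- An arbitrary colimit cocone is compared with the explicit one, where representatives exist by
construction. -/
lemma exists_of_isColimit {J : Type u} [Category.{u} J] {F : J ⥤ Completed G} {t : Cocone F}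
    (ht : IsColimit t) (h : t.pt ≠ .star) (p : Pt t.pt) : ∃ j x, underMap (t.ι.app j) x = p := by
  have hF : HasIsovariantColimit F := .of_cocone t h
  obtain ⟨⟨j, x⟩, hx⟩ := Quot.exists_rep
    (underMap (ht.desc (colimitCocone hF)) p : ColimitPt F)
  refine ⟨j, x, ?_⟩
  have h₁ : underMap ((isColimitColimitCocone hF).desc t)
      (underMap (ht.desc (colimitCocone hF)) p) = p := by
    rw [← underMap_comp]
    refine Eq.trans (congrArg (fun f ↦ underMap f p) ?_) (underMap_id _ p)
    exact ht.hom_ext fun j ↦ by simp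
  refine Eq.trans ?_ h₁
  have h₂ := congrArg (fun f ↦ underMap f x) ((isColimitColimitCocone hF).fac t j)
  refine h₂.symm.trans ((underMap_comp _ _ _).trans (congrArg (underMap _) ?_))
  exact (underMap_colimitιHom hF j x).trans hx

/-- Morphisms to the colimit of a sequence of embeddings factor through some stage if the length of
the sequence is large enough. -/
lemma preservesColimit_coyoneda {A : Completed G} {κ : Cardinal.{u}} [Fact κ.IsRegular]
    (hA : HasCardinalLT (Pt A) κ) {J : Type u} [LinearOrder J] [SuccOrder J] [OrderBot J]
    [WellFoundedLT J] [IsCardinalFiltered J κ] (F : J ⥤ Completed G) [F.IsWellOrderContinuous]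
    (hF : ∀ j : J, ¬ IsMax j → (embeddingTests G).llp (F.map (homOfLE (Order.le_succ j)))) :
    PreservesColimit F (coyoneda.obj (Opposite.op A)) where
  preserves {t} ht := by
    have := isFiltered_of_isCardinalFiltered J κ
    -- Left lifting classes are closed under transfinite composition, so each map from a stage to
    -- the colimit is again in the class.
    let c : (embeddingTests G).llp.TransfiniteCompositionOfShape J (t.ι.app ⊥) :=
      { F := F
        isoBot := Iso.refl _
        incl := t.ι
        isColimit := ht
        fac := Category.id_comp _
        map_mem := hF }
    have hι (j : J) : (embeddingTests G).llp (t.ι.app j) := c.mem_incl_app j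
    refine ⟨Types.FilteredColimit.isColimitOf' _ _ (fun (φ : A ⟶ t.pt) ↦ ?_)
      fun j (x : A ⟶ F.obj j) (y : A ⟶ F.obj j) (h : x ≫ t.ι.app j = y ≫ t.ι.app j) ↦
        ⟨j, 𝟙 j, congrArg (fun f : A ⟶ F.obj j ↦ f ≫ F.map (𝟙 j)) ?_⟩⟩
    · by_cases hpt : t.pt = .star
      · have h : F.obj ⊥ = .star := by
          by_contra h
          exact ne_star_of_llp_embeddingTests (hι ⊥) h hpt
        exact ⟨⊥, WithTerminal.starTerminal.from A ≫ fromStar h, hom_ext_star hpt _ _⟩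
      -- Each point of the image comes from some stage. There are fewer than `κ` of them, so a
      -- single stage `k` suffices; as it embeds in the colimit, the factorization is continuous and
      -- isovariant.
      · choose j x hx using fun a ↦ exists_of_isColimit ht hpt (underMap φ a)
        let k := IsCardinalFiltered.max j hA
        have hemb := isEmbedding_of_llp_embeddingTests (hι k) hpt
        have hφ := isIsovariant_underMap φ hpt
        have hk (a : Pt A) : ∃ y, underMap (t.ι.app k) y = underMap φ a :=
          ⟨underMap (F.map (IsCardinalFiltered.toMax j hA a)) (x a), by
            rw [← underMap_comp, t.w, hx]⟩
        choose y hy using hk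
        have hyc : Continuous y := by
          rw [hemb.continuous_iff]
          exact (underMap φ).continuous.congr fun a ↦ (hy a).symm
        have hyi : IsIsovariant (⟨y, hyc⟩ : C(Pt A, Pt (F.obj k))) := .mk'
          (fun g a ↦ hemb.injective (by
            change underMap (t.ι.app k) (y (g • a)) = underMap (t.ι.app k) (g • y a)
            rw [underMap_smul, hy, hy, underMap_smul]))
          fun g a h ↦ (hφ.smul_eq_iff g a).1 (by
            change g • y a = y a at h
            rw [← hy, ← underMap_smul, h])
        refine ⟨k, homMk ⟨y, hyc⟩ fun _ ↦ ⟨ne_star_of_hom φ hpt, hyi⟩, ?_⟩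
        refine hom_ext_underMap fun a ↦ ?_
        refine Eq.trans ?_ (underMap_comp _ _ _).symm
        rw [underMap_homMk]
        exact (hy a).symm
    · by_cases hpt : t.pt = .star
      · have h : F.obj j = .star := by
          by_contra h
          exact ne_star_of_llp_embeddingTests (hι j) h hpt
        exact hom_ext_star h _ _
      · refine hom_ext_underMap fun a ↦
          (isEmbedding_of_llp_embeddingTests (hι j) hpt).injective ?_
        rw [← underMap_comp, ← underMap_comp, h]

lemma hasCardinalLT_succ {T : Type u} {c : Cardinal.{u}} (h : Cardinal.mk T ≤ c) :
    HasCardinalLT T (Order.succ c) := by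
  rw [hasCardinalLT_iff_cardinal_mk_lt]
  exact Order.lt_succ_of_le h

/-- The left lifting class contains all relative cell complexes on `I`, and any regular cardinal
larger than the number of points of `A` is large enough. -/
lemma isSmallRelativeTo_relativeCells {I : MorphismProperty (Completed G)}
    (hI : I ≤ (embeddingTests G).llp) (A : Completed G) : IsSmallRelativeTo A (relativeCells I) := by
  let c : Cardinal.{u} := max Cardinal.aleph0 (Cardinal.mk (Pt A))
  have : Fact (Order.succ c).IsRegular := ⟨Cardinal.isRegular_succ (le_max_left _ _)⟩
  have hA : HasCardinalLT (Pt A) (Order.succ c) := hasCardinalLT_succ (le_max_right _ _)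
  refine ⟨_, this, fun J _ _ _ _ _ _ F _ hF ↦ preservesColimit_coyoneda hA F fun j _ ↦ ?_⟩
  have h : relativeCells I ≤ (embeddingTests G).llp := by
    rw [relativeCells, MorphismProperty.transfiniteCompositions_le_iff]
    exact (MorphismProperty.pushouts_monotone hI).trans (MorphismProperty.pushouts_le)
  exact h _ (hF j)

/-- One cardinal must serve all domains at once: the successor of the sum of their cardinalities (or
of `ℵ₀`), which exists because `I` is small. -/
lemma hasSmallObjectArgument_of_le_llp_embeddingTests {I : MorphismProperty (Completed G)}
    [MorphismProperty.IsSmall.{u} I] (hI : I ≤ (embeddingTests G).llp) :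
    MorphismProperty.HasSmallObjectArgument.{u} I := by
  let e := equivShrink.{u} I.toSet
  let c : Cardinal.{u} := max Cardinal.aleph0
    (Cardinal.sum fun s : Shrink.{u} I.toSet ↦ Cardinal.mk (Pt (e.symm s).1.left))
  have : Fact (Order.succ c).IsRegular := ⟨Cardinal.isRegular_succ (le_max_left _ _)⟩
  have : Nonempty (Order.succ c).ord.ToType :=
    IsCardinalFiltered.nonempty _ (Order.succ c)
  let _ : OrderBot (Order.succ c).ord.ToType := WellFoundedLT.toOrderBot (α := _)
  have : MorphismProperty.IsCardinalForSmallObjectArgument I (Order.succ c) :=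
    { preservesColimit := fun {A B X Y} i hi f hf ↦ by
        have hA : Cardinal.mk (Pt A) ≤ c := by
          have := Cardinal.le_sum (fun s : Shrink.{u} I.toSet ↦ Cardinal.mk (Pt (e.symm s).1.left))
            (e ⟨Arrow.mk i, hi⟩)
          simp only [Equiv.symm_apply_apply] at this
          exact this.trans (le_max_right _ _)
        have := hf.isWellOrderContinuous
        refine preservesColimit_coyoneda (hasCardinalLT_succ hA) hf.F fun j hj ↦ ?_
        have h : (MorphismProperty.coproducts.{u} (MorphismProperty.ofHoms I.homFamily)).pushouts ≤
            (embeddingTests G).llp := by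
          rw [I.ofHoms_homFamily]
          refine (MorphismProperty.pushouts_monotone ?_).trans (MorphismProperty.pushouts_le)
          exact (MorphismProperty.coproducts_monotone hI).trans (MorphismProperty.coproducts_le _)
        exact h _ (hf.transfiniteCompositionOfShape.map_mem j hj) }
  exact ⟨_, inferInstance, inferInstance, this⟩

end Smallness

end IsvtTop

/-! ### Lifting against the generators, read through `linkMap`. -/

namespace IsvtTop

variable {G : Type u} [Group G]

open scoped unitInterval

section Lifting

variable [Finite G]

/-- Lifting problems transpose along `linkAdjunction`, one chain at a time. -/
lemma rlp_ofHoms_linkProd_iff {A B : ℕ → TopCat.{u}} (i : ∀ n, A n ⟶ B n) {X Y : Completed G}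
    (f : X ⟶ Y) :
    (MorphismProperty.ofHoms fun p : LTSeries (Subgroup G) × ℕ ↦ (linkProd p.1).map (i p.2)).rlp f ↔
      ∀ H, (MorphismProperty.ofHoms i).rlp ((linkMap H).map f) := by
  constructor
  · rintro h H _ _ _ ⟨n⟩
    exact ((linkAdjunction H).hasLiftingProperty_iff _ _).1 (h _ ⟨(H, n)⟩)
  · rintro h _ _ _ ⟨p⟩
    exact ((linkAdjunction p.1).hasLiftingProperty_iff _ _).2 (h p.1 _ ⟨p.2⟩)

lemma rlp_generatingAcyclicCofibrations_iff {X Y : Completed G} (f : X ⟶ Y) :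
    (generatingAcyclicCofibrations G).rlp f ↔ ∀ H, serreFibrations ((linkMap H).map f) :=
  rlp_ofHoms_linkProd_iff _ f

lemma rlp_generatingCofibrations_iff {X Y : Completed G} (f : X ⟶ Y) :
    (generatingCofibrations G).rlp f ↔ ∀ H, weakHomotopyEquivalences ((linkMap H).map f) ∧
      serreFibrations ((linkMap H).map f) :=
  (rlp_ofHoms_linkProd_iff _ f).trans (forall_congr' fun _ ↦ rlp_diskBoundaryInclusion_iff)

end Lifting

/-! ### Isovariant path objects. -/

section PathSpace

variable (Y : IsvtTop G)

/-- The space of paths along which the isotropy group is constant. -/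
def PathPt : Type u :=
  {p : C(I, Y.carrier) // ∀ (s t : I) (g : G), g • p s = p s → g • p t = p t}

instance : TopologicalSpace (PathPt Y) := inferInstanceAs (TopologicalSpace (Subtype _))

instance : MulAction G (PathPt Y) where
  smul g p := ⟨⟨fun t ↦ g • p.1 t, p.1.continuous.const_smul g⟩, fun s t k hk ↦ by
    have := p.2 s t (g⁻¹ * k * g) (by
      change k • g • p.1 s = g • p.1 s at hk
      rw [mul_smul, mul_smul, hk, inv_smul_smul])
    rwa [mul_smul, mul_smul, inv_smul_eq_iff] at this⟩
  one_smul p := Subtype.ext (ContinuousMap.ext fun t ↦ one_smul G (p.1 t))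
  mul_smul g k p := Subtype.ext (ContinuousMap.ext fun t ↦ mul_smul g k (p.1 t))

instance : ContinuousConstSMul G (PathPt Y) where
  continuous_const_smul g :=
    Continuous.subtype_mk ((ContinuousMap.continuous_postcomp
      (⟨fun y ↦ g • y, continuous_const_smul g⟩ : C(Y.carrier, Y.carrier))).comp
        continuous_subtype_val) _

/-- The `G`-space `PathPt Y`. -/
def pathSpace : IsvtTop G where
  carrier := PathPt Y

/-- The space of pairs of points with the same isotropy group. -/
def PairPt : Type u :=
  {p : Y.carrier × Y.carrier // ∀ g : G, g • p.1 = p.1 ↔ g • p.2 = p.2}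

instance : TopologicalSpace (PairPt Y) := inferInstanceAs (TopologicalSpace (Subtype _))

instance : MulAction G (PairPt Y) where
  smul g p := ⟨(g • p.1.1, g • p.1.2), fun k ↦ by
    have := p.2 (g⁻¹ * k * g)
    rwa [mul_smul, mul_smul, mul_smul, mul_smul, inv_smul_eq_iff, inv_smul_eq_iff] at this⟩
  one_smul p := Subtype.ext (Prod.ext (one_smul G p.1.1) (one_smul G p.1.2))
  mul_smul g k p := Subtype.ext (Prod.ext (mul_smul g k p.1.1) (mul_smul g k p.1.2))

instance : ContinuousConstSMul G (PairPt Y) where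
  continuous_const_smul g := by
    have h₁ : Continuous fun p : PairPt Y ↦ p.1 := continuous_subtype_val
    exact Continuous.subtype_mk (((continuous_fst.comp h₁).const_smul g).prodMk
      ((continuous_snd.comp h₁).const_smul g)) _

/-- The `G`-space `PairPt Y`. -/
def pairSpace : IsvtTop G where
  carrier := PairPt Y

/-- The map which sends a path to its endpoints. -/
def endpoints : pathSpace Y ⟶ pairSpace Y :=
  ofMap ⟨fun p : PathPt Y ↦ (⟨(p.1 0, p.1 1), fun g ↦ ⟨p.2 0 1 g, p.2 1 0 g⟩⟩ : PairPt Y),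
    Continuous.subtype_mk (((continuous_eval_const (0 : I)).comp
      continuous_subtype_val).prodMk ((continuous_eval_const (1 : I)).comp
      continuous_subtype_val)) _⟩
    (.mk' (fun _ _ ↦ rfl) fun g (p : PathPt Y) hp ↦ Subtype.ext (ContinuousMap.ext fun t ↦
      p.2 0 t g (congrArg (fun q : PairPt Y ↦ q.1.1) hp)))

variable {Y}

lemma PathPt.smul_eq_iff (p : PathPt Y) (t : I) (g : G) : g • p = p ↔ g • p.1 t = p.1 t :=
  ⟨fun h ↦ congrArg (fun q : PathPt Y ↦ q.1 t) h, fun h ↦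
    Subtype.ext (ContinuousMap.ext fun s ↦ p.2 t s g h)⟩

lemma PairPt.smul_eq_iff₁ (p : PairPt Y) (g : G) : g • p = p ↔ g • p.1.1 = p.1.1 :=
  ⟨fun h ↦ congrArg (fun q : PairPt Y ↦ q.1.1) h, fun h ↦
    Subtype.ext (Prod.ext h ((p.2 g).1 h))⟩

lemma PairPt.smul_eq_iff₂ (p : PairPt Y) (g : G) : g • p = p ↔ g • p.1.2 = p.1.2 :=
  (p.smul_eq_iff₁ g).trans (p.2 g)

lemma PathPt.continuous_eval : Continuous fun q : PathPt Y × I ↦ q.1.1 q.2 := by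
  have h₁ : Continuous fun q : PathPt Y × I ↦ q.1.1 := continuous_subtype_val.comp continuous_fst
  fun_prop

/-- Extension of a path `p` along paths `a` and `b` in `Y` which start at the endpoints of `p`. -/
noncomputable def extendPath (p a b : I → Y.carrier) (t s : I) : Y.carrier :=
  -- As `s` goes from `0` to `1`, `τ` runs from `-t` to `1 + t`: first `a` backwards, then `p` on
  -- `[0, 1]`, then `b`.
  let τ : ℝ := s * (1 + 2 * t) - t
  if τ ≤ 0 then a (Set.projIcc 0 1 zero_le_one (-τ)) else
    if τ ≤ 1 then p (Set.projIcc 0 1 zero_le_one τ) else b (Set.projIcc 0 1 zero_le_one (τ - 1))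

lemma continuous_extendPath {T : Type*} [TopologicalSpace T] {p a b : T → I → Y.carrier}
    (hp : Continuous fun x : T × I ↦ p x.1 x.2) (ha : Continuous fun x : T × I ↦ a x.1 x.2)
    (hb : Continuous fun x : T × I ↦ b x.1 x.2) (h₀ : ∀ x, a x 0 = p x 0)
    (h₁ : ∀ x, b x 0 = p x 1) :
    Continuous fun x : T × I × I ↦ extendPath (p x.1) (a x.1) (b x.1) x.2.1 x.2.2 := by
  have hτ : Continuous fun x : T × I × I ↦ ((x.2.2 : ℝ) * (1 + 2 * x.2.1) - x.2.1 : ℝ) := by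
    fun_prop
  have hc {F : T → I → Y.carrier} (hF : Continuous fun x : T × I ↦ F x.1 x.2)
      {ρ : T × I × I → ℝ} (hρ : Continuous ρ) :
      Continuous fun x ↦ F x.1 (Set.projIcc (0 : ℝ) 1 zero_le_one (ρ x)) :=
    hF.comp (continuous_fst.prodMk ((continuous_projIcc (h := zero_le_one' ℝ)).comp hρ))
  refine Continuous.if_le (hc ha hτ.neg) (Continuous.if_le (hc hp hτ)
    (hc hb (hτ.sub continuous_const)) hτ continuous_const fun x hx ↦ ?_) hτ continuous_const
    fun x hx ↦ ?_
  · rw [hx, sub_self, Set.projIcc_left, Set.projIcc_right]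
    exact (h₁ _).symm
  · rw [hx, neg_zero, if_pos zero_le_one, Set.projIcc_left]
    exact h₀ _

lemma extendPath_zero_left (p a b : I → Y.carrier) (h₀ : a 0 = p 0) (s : I) :
    extendPath p a b 0 s = p s := by
  have h : (s : ℝ) * (1 + 2 * (0 : I)) - (0 : I) = s := by simp
  rw [extendPath, h]
  split_ifs with h₁ h₂
  · obtain rfl : s = 0 := le_antisymm h₁ s.2.1
    simpa using h₀
  · rw [Set.projIcc_val]
  · exact (h₂ s.2.2).elim

lemma extendPath_zero_right (p a b : I → Y.carrier) (t : I) : extendPath p a b t 0 = a t := by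
  have h : ((0 : I) : ℝ) * (1 + 2 * t) - t = -t := by simp
  rw [extendPath, h, if_pos (neg_nonpos.2 t.2.1), neg_neg, Set.projIcc_val]

lemma extendPath_one_right (p a b : I → Y.carrier) (h₁ : b 0 = p 1) (t : I) :
    extendPath p a b t 1 = b t := by
  have h : ((1 : I) : ℝ) * (1 + 2 * t) - t = 1 + t := by simp; ring
  have ht := t.2.1
  rw [extendPath, h, if_neg (by linarith)]
  split_ifs with h₂
  · obtain rfl : t = 0 := le_antisymm (by linarith : (t : ℝ) ≤ 0) t.2.1
    simpa using h₁.symm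
  · rw [add_sub_cancel_left, Set.projIcc_val]

lemma extendPath_mem (p a b : I → Y.carrier) (P : Y.carrier → Prop) (hp : ∀ s, P (p s))
    (ha : ∀ s, P (a s)) (hb : ∀ s, P (b s)) (t s : I) : P (extendPath p a b t s) := by
  rw [extendPath]
  split_ifs
  exacts [ha _, hp _, hb _]

lemma smul_extendPath (p a b : I → Y.carrier) (t s : I) (g : G) :
    extendPath (fun s ↦ g • p s) (fun s ↦ g • a s) (fun s ↦ g • b s) t s =
      g • extendPath p a b t s := by
  rw [extendPath, extendPath]
  split_ifs <;> rfl

/-- The lift of `endpoints` along a cylinder inclusion. -/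
lemma hasLiftingProperty_endpoints (X : IsvtTop G) (n : ℕ) (Y : IsvtTop G) :
    HasLiftingProperty (X.prodFunctor.map (diskCylinderInclusion.{u} n)) (endpoints Y) where
  sq_hasLift {u v} sq := by
    let D : Type u := TopCat.disk.{u} n
    let u' : C(X.carrier × (D × ({0} : Set I)), PathPt Y) := toMap u
    let v' : C(X.carrier × (D × I), PairPt Y) := toMap v
    have hu (x : X.carrier) (d : D × ({0} : Set I)) (t : I) (g : G) :
        g • (u' (x, d)).1 t = (u' (x, d)).1 t ↔ g • x = x := by
      rw [← PathPt.smul_eq_iff]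
      refine ((isIsovariant_toMap u).smul_eq_iff g (x, d)).trans ?_
      exact ⟨fun h ↦ congrArg Prod.fst h, fun h ↦ Prod.ext h rfl⟩
    have hv (x : X.carrier) (d : D × I) (g : G) : g • v' (x, d) = v' (x, d) ↔ g • x = x := by
      refine ((isIsovariant_toMap v).smul_eq_iff g (x, d)).trans ?_
      exact ⟨fun h ↦ congrArg Prod.fst h, fun h ↦ Prod.ext h rfl⟩
    have huv (x : X.carrier) (d : D) :
        (v' (x, (d, 0))).1 = ((u' (x, (d, ⟨0, rfl⟩))).1 0, (u' (x, (d, ⟨0, rfl⟩))).1 1) := by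
      have h := congrArg (fun f ↦ toMap f (x, (d, ⟨0, rfl⟩))) sq.w
      exact (congrArg Subtype.val h).symm
    -- The prescribed endpoints trace two paths `a` and `b` that issue from the ends of `p`;
    -- prolonging `p` along them up to time `t` is the lift.
    let p (y : X.carrier × D) (s : I) : Y.carrier := (u' (y.1, (y.2, ⟨0, rfl⟩))).1 s
    let a (y : X.carrier × D) (s : I) : Y.carrier := (v' (y.1, (y.2, s))).1.1
    let b (y : X.carrier × D) (s : I) : Y.carrier := (v' (y.1, (y.2, s))).1.2
    have hp : Continuous fun y : (X.carrier × D) × I ↦ p y.1 y.2 :=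
      PathPt.continuous_eval.comp (Continuous.prodMk (u'.continuous.comp (by fun_prop))
        continuous_snd)
    have hv' : Continuous fun y : (X.carrier × D) × I ↦ (v' (y.1.1, (y.1.2, y.2))).1 :=
      continuous_subtype_val.comp (v'.continuous.comp (by fun_prop))
    have ha : Continuous fun y : (X.carrier × D) × I ↦ a y.1 y.2 := continuous_fst.comp hv'
    have hb : Continuous fun y : (X.carrier × D) × I ↦ b y.1 y.2 := continuous_snd.comp hv'
    have h₀ (y) : a y 0 = p y 0 := congrArg Prod.fst (huv y.1 y.2)
    have h₁ (y) : b y 0 = p y 1 := congrArg Prod.snd (huv y.1 y.2)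
    have hw := continuous_extendPath hp ha hb h₀ h₁
    -- All three pieces over `y` have the isotropy of `y.1`, so the prolonged path has constant
    -- isotropy.
    have hst (y : X.carrier × D) (t s : I) (g : G) :
        g • extendPath (p y) (a y) (b y) t s = extendPath (p y) (a y) (b y) t s ↔
          g • y.1 = y.1 :=
      extendPath_mem (p y) (a y) (b y) (fun z ↦ g • z = z ↔ g • y.1 = y.1)
        (fun _ ↦ hu _ _ _ g) (fun _ ↦ (PairPt.smul_eq_iff₁ _ g).symm.trans (hv _ _ g))
        (fun _ ↦ (PairPt.smul_eq_iff₂ _ g).symm.trans (hv _ _ g)) t s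
    let w : C(X.carrier × (D × I), C(I, Y.carrier)) := ContinuousMap.curry
      ⟨fun z ↦ extendPath (p (z.1.1, z.1.2.1)) (a (z.1.1, z.1.2.1)) (b (z.1.1, z.1.2.1)) z.1.2.2 z.2,
        hw.comp (f := fun z : (X.carrier × (D × I)) × I ↦ ((z.1.1, z.1.2.1), (z.1.2.2, z.2)))
          (by fun_prop)⟩
    let w' : C(X.carrier × (D × I), PathPt Y) := ⟨fun z ↦ ⟨w z, fun s t g h ↦
      (hst (z.1, z.2.1) _ _ g).2 ((hst (z.1, z.2.1) _ _ g).1 h)⟩,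
        w.continuous.subtype_mk _⟩
    have hw' : IsIsovariant (X := X.prodTop (TopCat.of (D × I))) (Y := pathSpace Y) w' := by
      refine .mk' (fun g z ↦ Subtype.ext (ContinuousMap.ext fun s ↦ ?_)) fun g z h ↦ ?_
      · refine Eq.trans ?_ (smul_extendPath (p (z.1, z.2.1)) (a (z.1, z.2.1)) (b (z.1, z.2.1))
          z.2.2 s g)
        have e₁ (s : I) : p (g • z.1, z.2.1) s = g • p (z.1, z.2.1) s :=
          congrArg (fun q : PathPt Y ↦ q.1 s) ((isIsovariant_toMap u).1 g (z.1, (z.2.1, ⟨0, rfl⟩)))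
        have e₂ (s : I) : a (g • z.1, z.2.1) s = g • a (z.1, z.2.1) s :=
          congrArg (fun q : PairPt Y ↦ q.1.1) ((isIsovariant_toMap v).1 g (z.1, (z.2.1, s)))
        have e₃ (s : I) : b (g • z.1, z.2.1) s = g • b (z.1, z.2.1) s :=
          congrArg (fun q : PairPt Y ↦ q.1.2) ((isIsovariant_toMap v).1 g (z.1, (z.2.1, s)))
        rw [← funext e₁, ← funext e₂, ← funext e₃]
        rfl
      · exact Prod.ext ((hst (z.1, z.2.1) z.2.2 0 g).1
          (congrArg (fun q : PathPt Y ↦ q.1 0) h)) rfl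
    refine ⟨⟨⟨ofMap w' hw', ?_, ?_⟩⟩⟩
    · refine hom_ext' ?_
      rintro ⟨x, d, ⟨_, rfl⟩⟩
      exact Subtype.ext (ContinuousMap.ext fun s ↦ extendPath_zero_left _ _ _ (h₀ (x, d)) s)
    · refine hom_ext' fun z ↦ Subtype.ext (Prod.ext ?_ ?_)
      · exact extendPath_zero_right (p (z.1, z.2.1)) (a (z.1, z.2.1)) (b (z.1, z.2.1)) z.2.2
      · exact extendPath_one_right (p (z.1, z.2.1)) (a (z.1, z.2.1)) _ (h₁ (z.1, z.2.1)) z.2.2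

end PathSpace

/-! ### Acyclic cofibrations as strong deformation retracts. -/

section AcyclicCofibrations

/-- The retraction of the cylinder of a disk on its base. -/
noncomputable def diskCylinderRetraction (n : ℕ) :
    TopCat.of (TopCat.disk.{u} n × I) ⟶ TopCat.of (TopCat.disk.{u} n × ({0} : Set I)) :=
  TopCat.ofHom ⟨fun p ↦ (p.1, ⟨0, rfl⟩), by fun_prop⟩

lemma diskCylinderInclusion_retraction (n : ℕ) :
    diskCylinderInclusion.{u} n ≫ diskCylinderRetraction n = 𝟙 _ := by
  refine TopCat.hom_ext (ContinuousMap.ext ?_)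
  rintro ⟨x, ⟨_, rfl⟩⟩
  rfl

/-- Every object is fibrant: a map on the base of the cylinder extends by precomposition with the
retraction. -/
lemma generatingAcyclicCofibrations_rlp_from_star {X : Completed G} (f : X ⟶ .star) :
    (generatingAcyclicCofibrations G).rlp f := by
  rintro _ _ _ ⟨p⟩
  refine ⟨fun {s t} _ ↦ ⟨⟨⟨(linkProd p.1).map (diskCylinderRetraction p.2) ≫ s, ?_,
    WithTerminal.starTerminal.hom_ext _ _⟩⟩⟩⟩
  rw [← Category.assoc, ← Functor.map_comp, diskCylinderInclusion_retraction, CategoryTheory.Functor.map_id,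
    Category.id_comp]

lemma generatingAcyclicCofibrations_rlp_endpoints (Z : IsvtTop G) :
    (generatingAcyclicCofibrations G).rlp (WithTerminal.incl.map (endpoints Z)) := by
  rintro _ _ _ ⟨p⟩
  refine ⟨fun {s t} sq ↦ ?_⟩
  have := hasLiftingProperty_endpoints (linkingSimplex p.1) p.2 Z
  have sq' : CommSq (WithTerminal.down s)
    ((linkingSimplex p.1).prodFunctor.map (diskCylinderInclusion.{u} p.2)) (endpoints Z)
    (WithTerminal.down t) := ⟨sq.w⟩
  exact ⟨⟨⟨WithTerminal.incl.map sq'.lift, sq'.fac_left, sq'.fac_right⟩⟩⟩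

/-- The constant paths. -/
def constPath (Y : IsvtTop G) : Y ⟶ pathSpace Y :=
  ofMap (X := Y) (Y := pathSpace Y) ⟨fun y ↦ (⟨ContinuousMap.const I y, fun _ _ _ h ↦ h⟩ : PathPt Y),
    ContinuousMap.const'.continuous.subtype_mk _⟩
    (.mk' (fun _ _ ↦ rfl) fun _ _ h ↦ congrArg (fun q : PathPt Y ↦ q.1 0) h)

/-- The pair of morphisms. -/
def pairMk {X Y : IsvtTop G} (f g : X ⟶ Y) : X ⟶ pairSpace Y :=
  ofMap (X := X) (Y := pairSpace Y)
    ⟨fun x ↦ (⟨(toMap f x, toMap g x), fun k ↦ ((isIsovariant_toMap f).smul_eq_iff k x).trans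
      ((isIsovariant_toMap g).smul_eq_iff k x).symm⟩ : PairPt Y),
      ((toMap f).continuous.prodMk (toMap g).continuous).subtype_mk _⟩
    (.mk' (fun k x ↦ Subtype.ext (Prod.ext ((isIsovariant_toMap f).1 k x)
      ((isIsovariant_toMap g).1 k x))) fun k x h ↦
        ((isIsovariant_toMap f).smul_eq_iff k x).1 (congrArg (fun q : PairPt Y ↦ q.1.1) h))

/-- Maps from an exponentiable `G`-space to a path space induce homotopies. -/
lemma continuous_mapIsvt_pathSpace {X : IsvtTop G} (hX : IsExponentiable X.carrier)
    (Y : IsvtTop G) :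
    ∃ h : C((X.mapIsvt.obj (pathSpace Y)) × I, X.mapIsvt.obj Y),
      ∀ φ t x, (h (φ, t)).1 x = (φ.1 x : PathPt Y).1 t := by
  let M := X.mapIsvt.obj (pathSpace Y)
  have h₁ : Continuous fun p : X.carrier × M ↦ (p.2.1 p.1 : PathPt Y) :=
    hX M (pathSpace Y).carrier ⟨fun φ ↦ φ.1, continuous_subtype_val⟩
  have h₂ : Continuous fun p : (M × I) × X.carrier ↦ (p.1.1.1 p.2 : PathPt Y).1 p.1.2 :=
    PathPt.continuous_eval.comp ((h₁.comp (f := fun p : (M × I) × X.carrier ↦ (p.2, p.1.1))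
      (by fun_prop)).prodMk (by fun_prop : Continuous fun p : (M × I) × X.carrier ↦ p.1.2))
  refine ⟨⟨fun p ↦ ⟨ContinuousMap.curry ⟨_, h₂⟩ p, .mk' (fun g x ↦ ?_) fun g x h ↦ ?_⟩,
    (ContinuousMap.curry ⟨_, h₂⟩).continuous.subtype_mk _⟩, fun φ t x ↦ rfl⟩
  · exact congrArg (fun q : PathPt Y ↦ q.1 p.2) (p.1.2.1 g x)
  · refine (IsIsovariant.smul_eq_iff p.1.2 g x).1 ?_
    exact (PathPt.smul_eq_iff (p.1.1 x) p.2 g).2 h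

/-- The path object argument: fibrancy of the source yields a retraction `r`, the path fibration of
the target yields a homotopy from the identity to `r ≫ i₀`, and `linkMap H` turns both into a strong
deformation retraction of mapping spaces. -/
lemma weakHomotopyEquivalences_linkMap_of_llp_rlp [Finite G] {A B : Completed G} {i : A ⟶ B}
    (hi : (generatingAcyclicCofibrations G).rlp.llp i) (H : LTSeries (Subgroup G)) :
    weakHomotopyEquivalences ((linkMap H).map i) := by
  have hi' : (embeddingTests G).llp i :=
    MorphismProperty.antitone_llp ((MorphismProperty.le_llp_iff_le_rlp _ _).1
      generatingAcyclicCofibrations_le_llp_embeddingTests) _ hi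
  rcases B with Y | _
  · rcases A with X | _
    · have := hi _ (generatingAcyclicCofibrations_rlp_from_star
        (WithTerminal.starTerminal.from (.of X : Completed G)))
      have sq₁ : CommSq (𝟙 (.of X : Completed G)) i
          (WithTerminal.starTerminal.from (.of X : Completed G))
          (WithTerminal.starTerminal.from (.of Y : Completed G)) :=
        ⟨WithTerminal.starTerminal.hom_ext _ _⟩
      let i₀ : X ⟶ Y := WithTerminal.down i
      let r : Y ⟶ X := WithTerminal.down sq₁.lift
      have hir : i₀ ≫ r = 𝟙 X := sq₁.fac_left
      -- A lift in the next square is a homotopy through paths of constant isotropy that does not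
      -- move the image of `X`.
      have hl := hi _ (generatingAcyclicCofibrations_rlp_endpoints Y)
      have sq₂ : CommSq (WithTerminal.incl.map (i₀ ≫ constPath Y)) i
          (WithTerminal.incl.map (endpoints Y)) (WithTerminal.incl.map (pairMk (𝟙 Y) (r ≫ i₀))) := by
        refine ⟨?_⟩
        change WithTerminal.incl.map ((i₀ ≫ constPath Y) ≫ endpoints Y) =
          WithTerminal.incl.map (i₀ ≫ pairMk (𝟙 Y) (r ≫ i₀))
        refine congrArg _ (hom_ext' fun x ↦ Subtype.ext (Prod.ext rfl ?_))
        exact (congrArg (fun f ↦ toMap i₀ (toMap f x)) hir).symm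
      have : sq₂.HasLift := hl.sq_hasLift sq₂
      let k : Y ⟶ pathSpace Y := WithTerminal.down sq₂.lift
      have hk₁ : i₀ ≫ k = i₀ ≫ constPath Y := sq₂.fac_left
      have hk₂ : k ≫ endpoints Y = pairMk (𝟙 Y) (r ≫ i₀) := sq₂.fac_right
      have hk₁' (x) : (toMap k (toMap i₀ x) : PathPt Y) = toMap (constPath Y) (toMap i₀ x) :=
        congrArg (fun f ↦ toMap f x) hk₁
      have hk₂' (y) : ((toMap k y : PathPt Y).1 0, (toMap k y : PathPt Y).1 1) =
          (y, toMap i₀ (toMap r y)) :=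
        congrArg (fun f ↦ (toMap f y : PairPt Y).1) hk₂
      let S := linkingSimplex H
      obtain ⟨h, hh⟩ := continuous_mapIsvt_pathSpace (isExponentiable_linkingSimplex H) Y
      let K := S.mapIsvt.map k
      refine weakHomotopyEquivalences_of_deformationRetraction (S.mapIsvt.map i₀) (S.mapIsvt.map r)
        ?_ (h.comp ⟨fun p ↦ (K p.1, p.2), by fun_prop⟩) ?_ ?_ ?_
      · rw [← Functor.map_comp, hir, CategoryTheory.Functor.map_id]
      · exact fun φ ↦ Subtype.ext (ContinuousMap.ext fun x ↦ (hh _ _ x).trans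
          (congrArg Prod.fst (hk₂' (φ.1 x))))
      · exact fun φ ↦ Subtype.ext (ContinuousMap.ext fun x ↦ (hh _ _ x).trans
          (congrArg Prod.snd (hk₂' (φ.1 x))))
      · exact fun φ t ↦ Subtype.ext (ContinuousMap.ext fun x ↦ (hh _ _ x).trans
          (congrArg (fun q : PathPt Y ↦ q.1 t) (hk₁' (φ.1 x))))
    · exact (WithTerminal.false_of_from_star i).elim
  -- The embedding tests exclude a `G`-space as source here, so `i` is an identity.
  · obtain rfl : A = .star := by
      by_contra h
      exact ne_star_of_llp_embeddingTests hi' h rfl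
    obtain rfl : i = 𝟙 _ := WithTerminal.starTerminal.hom_ext _ _
    rw [CategoryTheory.Functor.map_id]
    exact weakHomotopyEquivalences_of_deformationRetraction (𝟙 _) (𝟙 _) (Category.comp_id _)
      ⟨Prod.fst, continuous_fst⟩ (fun _ ↦ rfl) (fun _ ↦ rfl) fun _ _ ↦ rfl

end AcyclicCofibrations

end IsvtTop

/-! ### The model structure. -/

namespace IsvtTop

section ModelStructure

variable (G : Type u) [Group G]

instance : MorphismProperty.IsSmall.{u} (generatingCofibrations G) := by
  unfold generatingCofibrations
  infer_instance

instance : MorphismProperty.IsSmall.{u} (generatingAcyclicCofibrations G) := by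
  unfold generatingAcyclicCofibrations
  infer_instance

instance : MorphismProperty.HasSmallObjectArgument.{u} (generatingCofibrations G) :=
  hasSmallObjectArgument_of_le_llp_embeddingTests generatingCofibrations_le_llp_embeddingTests

instance : MorphismProperty.HasSmallObjectArgument.{u} (generatingAcyclicCofibrations G) :=
  hasSmallObjectArgument_of_le_llp_embeddingTests
    generatingAcyclicCofibrations_le_llp_embeddingTests

/-- The isovariant fibrations. -/
abbrev categoryWithFibrations : CategoryWithFibrations (Completed G) where
  fibrations := (generatingAcyclicCofibrations G).rlp

/-- The isovariant cofibrations. -/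
abbrev categoryWithCofibrations : CategoryWithCofibrations (Completed G) where
  cofibrations := (generatingCofibrations G).rlp.llp

/-- The isovariant weak equivalences. -/
abbrev categoryWithWeakEquivalences : CategoryWithWeakEquivalences (Completed G) where
  weakEquivalences _ _ f := ∀ H, weakHomotopyEquivalences ((linkMap H).map f)

attribute [local instance] categoryWithFibrations categoryWithCofibrations
  categoryWithWeakEquivalences

instance : (weakEquivalences (Completed G)).HasTwoOutOfThreeProperty where
  comp_mem f g hf hg H := by
    rw [CategoryTheory.Functor.map_comp]
    exact weakHomotopyEquivalences.comp_mem _ _ (hf H) (hg H)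
  of_postcomp f g hg hfg H := weakHomotopyEquivalences.of_postcomp _ _ (hg H) (by
    rw [← CategoryTheory.Functor.map_comp]
    exact hfg H)
  of_precomp f g hf hfg H := weakHomotopyEquivalences.of_precomp _ _ (hf H) (by
    rw [← CategoryTheory.Functor.map_comp]
    exact hfg H)

variable [Finite G]

lemma trivialFibrations_eq_rlp :
    trivialFibrations (Completed G) = (generatingCofibrations G).rlp := by
  ext X Y f
  rw [rlp_generatingCofibrations_iff, forall_and, ← rlp_generatingAcyclicCofibrations_iff]
  exact and_comm

lemma llp_rlp_le_trivialCofibrations :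
    (generatingAcyclicCofibrations G).rlp.llp ≤ trivialCofibrations (Completed G) := by
  intro A B i hi
  refine ⟨?_, fun H ↦ weakHomotopyEquivalences_linkMap_of_llp_rlp hi H⟩
  refine MorphismProperty.antitone_llp (fun X Y f hf ↦ ?_) _ hi
  rw [← trivialFibrations_eq_rlp] at hf
  exact hf.1

/-- The retract argument: factor `i` through the left class followed by a fibration `d.p`. By
two-out-of-three `d.p` is acyclic, so `i` lifts against it and is a retract of `d.i`. -/
lemma trivialCofibrations_eq_llp :
    trivialCofibrations (Completed G) = (generatingAcyclicCofibrations G).rlp.llp := by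
  refine le_antisymm (fun A B i hi ↦ ?_) (llp_rlp_le_trivialCofibrations G)
  have d := MorphismProperty.factorizationData (generatingAcyclicCofibrations G).rlp.llp
    (generatingAcyclicCofibrations G).rlp i
  have hp : (generatingCofibrations G).rlp d.p := by
    rw [← trivialFibrations_eq_rlp]
    refine ⟨d.hp, MorphismProperty.of_precomp _ d.i d.p
      (llp_rlp_le_trivialCofibrations G _ d.hi).2 ?_⟩
    rw [d.fac]
    exact hi.2
  have := hi.1 _ hp
  exact MorphismProperty.of_retract (RetractArrow.ofLeftLiftingProperty d.fac) d.hi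

/-- The isovariant model structure. -/
noncomputable abbrev modelCategory : ModelCategory (Completed G) :=
  have : MorphismProperty.IsWeakFactorizationSystem (cofibrations (Completed G))
      (trivialFibrations (Completed G)) := by
    rw [trivialFibrations_eq_rlp]
    exact
      { rlp := MorphismProperty.rlp_llp_rlp _
        llp := rfl
        hasFactorization := inferInstanceAs (MorphismProperty.HasFactorization
          (generatingCofibrations G).rlp.llp (generatingCofibrations G).rlp) }
  have : MorphismProperty.IsWeakFactorizationSystem (trivialCofibrations (Completed G))
      (fibrations (Completed G)) := by
    rw [trivialCofibrations_eq_llp]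
    exact
      { rlp := MorphismProperty.rlp_llp_rlp _
        llp := rfl
        hasFactorization := inferInstanceAs (MorphismProperty.HasFactorization
          (generatingAcyclicCofibrations G).rlp.llp (generatingAcyclicCofibrations G).rlp) }
  ModelCategory.mk' (Completed G)

lemma isCofibrantlyGeneratedBy :
    letI := modelCategory G
    IsCofibrantlyGeneratedBy (generatingCofibrations G) (generatingAcyclicCofibrations G) :=
  letI := modelCategory G
  { hasLimits := inferInstance
    hasColimits := inferInstance
    factorization_cof := by
      refine (?_ : MorphismProperty.HasFunctorialFactorization
        (generatingCofibrations G).rlp.llp (trivialFibrations (Completed G)))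
      rw [show trivialFibrations (Completed G) = _ from trivialFibrations_eq_rlp G]
      infer_instance
    factorization_fib := by
      refine (?_ : MorphismProperty.HasFunctorialFactorization
        (trivialCofibrations (Completed G)) (generatingAcyclicCofibrations G).rlp)
      rw [show trivialCofibrations (Completed G) = _ from trivialCofibrations_eq_llp G]
      infer_instance
    isSmall_I := inferInstance
    isSmall_J := inferInstance
    domains_I _ _ :=
      isSmallRelativeTo_relativeCells generatingCofibrations_le_llp_embeddingTests _
    domains_J _ _ :=
      isSmallRelativeTo_relativeCells generatingAcyclicCofibrations_le_llp_embeddingTests _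
    trivialFibrations_eq := trivialFibrations_eq_rlp G
    fibrations_eq := rfl }

end ModelStructure

end IsvtTop

theorem mainTheorem2 (G : Type u) [Group G] [Finite G] :
    (∀ H : LTSeries (Subgroup G),
      Nonempty (IsvtTop.linkProd H ⊣ (IsvtTop.linkMap H : IsvtTop.Completed G ⥤ TopCat.{u}))) ∧
    ∃ _ : ModelCategory (IsvtTop.Completed G),
      IsCofibrantlyGeneratedBy (IsvtTop.generatingCofibrations G)
        (IsvtTop.generatingAcyclicCofibrations G) ∧
      (∀ ⦃X Y : IsvtTop.Completed G⦄ (f : X ⟶ Y), WeakEquivalence f ↔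
        ∀ H : LTSeries (Subgroup G), weakHomotopyEquivalences ((IsvtTop.linkMap H).map f)) ∧
      (∀ ⦃X Y : IsvtTop.Completed G⦄ (f : X ⟶ Y), Fibration f ↔
        ∀ H : LTSeries (Subgroup G), serreFibrations ((IsvtTop.linkMap H).map f)) :=
  letI := IsvtTop.modelCategory G
  ⟨fun H ↦ ⟨IsvtTop.linkAdjunction H⟩, this, IsvtTop.isCofibrantlyGeneratedBy G,
    fun _ _ f ↦ weakEquivalence_iff f,
    fun _ _ f ↦ (fibration_iff f).trans (IsvtTop.rlp_generatingAcyclicCofibrations_iff f)⟩
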